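/- **Setting.** A graphon over a probability space $(\Omega,\mathcal F,\pi)$ is a measurable, symmetric, nonnegative function $W$ on $\Omega\times\Omega$ with $\|W\|_1<\infty$, where $\|W\|_p^p=\int|W|^p\,d\pi\,d\pi$; it is an $L^2$ graphon if $\|W\|_2<\infty$ and normalized if $\|W\|_1=1$. For functions $W,W'$ on $\Omega\times\Omega$ and $\Omega'\times\Omega'$ let $$\delta_2(W,W')=\inf_\nu\Big(\int |W(x,y)-W'(x',y')|^2\,d\nu(x,x')\,d\nu(y,y')\Big)^{1/2},$$ the infimum being over all couplings $\nu$ of $\pi$ and $\pi'$. A block model $(\mathbf p,B)$ consists of a probability vector $\mathbf p=(p_1,\dots,p_k)$, $k\ge1$, and a symmetric $k\times k$ matrix $B$ with nonnegative entries; it is viewed as the graphon $(i,j)\mapsto B_{ij}$ over $\{1,\dots,k\}$ with the measure $\mathbf p$ (the same convention is used for $\delta_2$ if $B$ is an arbitrary real matrix). Put $$\varepsilon^{(2)}_{\ge\kappa}(W)=\inf\{\delta_2(W',W): W'=(\mathbf p,B)\text{ a block model with } p_i\ge\kappa\text{ for all }i\},\qquad \mathrm{tail}^{(2)}_\rho(W)=\|W-\min\{W,\rho^{-1}\}\|_2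 .$$ *$W$-random graphs.* For $\rho>0$, given i.i.d. points $x_1,\dots,x_n$ with law $\pi$, the $W$-random graph $G$ on $\{1,\dots,n\}$ at target density $\rho$ contains, conditionally on $x_1,\dots,x_n$, each edge $ij$ ($i<j$) independently with probability $\min\{1,\rho W(x_i,x_j)\}$. A sequence $(G_n)$ of $W$-random graphs at target densities $\rho_n$ is defined on one probability space from one i.i.d. sequence $x_1,x_2,\dots$, $G_n$ being generated as above from $x_1,\dots,x_n$; no assumption is made on the joint behaviour of the edges of $G_n$ for different $n$. *Least squares algorithm.* Let $G$ be a graph on $n$ vertices with adjacency matrix $A(G)$, let $\kappa\in(0,1]$ with $\kappa n\ge1$, and let $k=\lceil n/\lfloor n\kappa\rfloor\rceil$. Let $(\hat\sigma,\hat B)$ be any minimizer of $\|A(G)-B^\sigma\|_2$ over all real $k\times k$ matrices $B$ and all maps $\sigma\colon\{1,\dots,n\}\to\{1,\dots,k\}$ all of whose nonempty classes $\sigma^{-1}(i)$ have size at least $\lfloor\kappa n\rfloor$. Here $(B^\sigma)_{uv}=B_{\sigma(u)\sigma(v)}$ and $\|A\|_2^2=n^{-2}\sum_{u,v}|A_{uv}|^2$.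 The output is $\widehat W=(\hat{\mathbf p},\hat B)$ with $\hat p_i=|\hat\sigma^{-1}(i)|/n$, and $\frac1\rho\widehat W=(\hat{\mathbf p},\frac1\rho\hat B)$. **Theorem.** Let $W$ be an $L^2$ graphon over an arbitrary probability space with $\|W\|_1=1$, and let $\widehat W$ be an output of the least squares algorithm with parameter $\kappa$ for a $W$-random graph on $n$ vertices with target density $\rho$. The statements hold simultaneously for all choices of the minimizers. (i) For all $C$, $L$ and $\varepsilon>0$ there is a constant $M$, depending only on $C,L,\varepsilon$, such that whenever $\|W\|_2\le L$, $n\ge2$, $0<\rho\le1$, $\kappa\in(n^{-1},1]$ and $\frac{1+\log(1/\kappa)}{\kappa^2}\le C\rho n$, with probability at least $1-\varepsilon$ $$\delta_2\Big(\frac1\rho\widehat W,W\Big)\le M\left(\varepsilon^{(2)}_{\ge\kappa}(W)+\sqrt[4]{\frac{1+\log(1/\kappa)}{\kappa^2\rho n}}+\sqrt[4]{\frac{\log n}{\kappa n}}+\mathrm{tail}^{(2)}_\rho(W)\right).$$ (ii) If $\kappa\in(0,1]$ is fixed and $\rho_n>0$ satisfies $\rho_n\to0$ and $n\rho_n\to\infty$,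 then with probability $1$, as $n\to\infty$, $\delta_2\big(\frac1{\rho_n}\widehat W,W\big)\to\varepsilon^{(2)}_{\ge\kappa}(W)$. (iii) If $\rho_n>0$ and $\kappa_n\in(0,1]$ satisfy $\rho_n\to0$, $n\rho_n\to\infty$, $\kappa_n\to0$ and $\kappa_n^{-2}\log(1/\kappa_n)=o(n\rho_n)$, then with probability $1$, as $n\to\infty$, $\delta_2\big(\frac1{\rho_n}\widehat W,W\big)\to0$. -/

import Mathlib

open MeasureTheory ProbabilityTheory Filter Topology Asymptotics
open scoped ENNReal NNReal Classical

universe u v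

noncomputable section

/-! ## Graphons, couplings and the invariant distance -/

/-- A graphon over the probability space `(Ω, π)`: a symmetric, nonnegative, integrable
measurable function on `Ω × Ω`. -/
structure IsGraphon {Ω : Type u} [MeasurableSpace Ω] (π : Measure Ω) (W : Ω → Ω → ℝ) : Prop where
  measurable : Measurable (Function.uncurry W)
  symm : ∀ x y, W x y = W y x
  nonneg : ∀ x y, 0 ≤ W x y
  integrable : Integrable (Function.uncurry W) (π.prod π)

/-- The `L^p` norm of a function on `Ω × Ω`. -/
def graphonNorm {Ω : Type u} [MeasurableSpace Ω] (p : ℝ≥0∞) (π : Measure Ω)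
    (W : Ω → Ω → ℝ) : ℝ≥0∞ :=
  eLpNorm (Function.uncurry W) p (π.prod π)

/-- `ν` is a coupling of `π` and `π'`. -/
def IsCoupling {Ω : Type u} {Ω' : Type v} [MeasurableSpace Ω] [MeasurableSpace Ω']
    (ν : Measure (Ω × Ω')) (π : Measure Ω) (π' : Measure Ω') : Prop :=
  ν.map Prod.fst = π ∧ ν.map Prod.snd = π'

/-- `δ_p(W, W')`: the infimum over all couplings `ν` of the `L^p(ν ⊗ ν)` norm of
`((x, x'), (y, y')) ↦ W (x, y) - W' (x', y')`. -/
def deltaDist {Ω : Type u} {Ω' : Type v} [MeasurableSpace Ω] [MeasurableSpace Ω'] (p : ℝ≥0∞)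
    (π : Measure Ω) (W : Ω → Ω → ℝ) (π' : Measure Ω') (W' : Ω' → Ω' → ℝ) : ℝ≥0∞ :=
  ⨅ (ν : Measure (Ω × Ω')) (_ : IsCoupling ν π π'),
    eLpNorm (fun q : (Ω × Ω') × (Ω × Ω') => W q.1.1 q.2.1 - W' q.1.2 q.2.2) p (ν.prod ν)

/-- `tail_ρ^{(p)}(W) = ‖W - min {W, ρ⁻¹}‖_p`. -/
def tailNorm {Ω : Type u} [MeasurableSpace Ω] (p : ℝ≥0∞) (ρ : ℝ) (π : Measure Ω)
    (W : Ω → Ω → ℝ) : ℝ≥0∞ :=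
  graphonNorm p π (fun x y => W x y - min (W x y) ρ⁻¹)

/-! ## Block models -/

/-- The data `(p, B)` of a block model on `k` blocks: block weights and a matrix. The constraints
on the data are in `BlockModel.IsValid`. -/
structure BlockModel where
  k : ℕ
  p : Fin k → ℝ
  B : Matrix (Fin k) (Fin k) ℝ

/-- The measure on the set of blocks that gives block `i` the mass `p i`. -/
def BlockModel.measure (b : BlockModel) : Measure (Fin b.k) :=
  ∑ i, ENNReal.ofReal (b.p i) • Measure.dirac i

/-- Scaling of the values: the block model `(p, c B)`. -/
def BlockModel.scale (c : ℝ) (b : BlockModel) : BlockModel := ⟨b.k, b.p, c • b.B⟩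

/-- Block models: `p` is a probability vector, `B` is symmetric with nonnegative entries. -/
structure BlockModel.IsValid (b : BlockModel) : Prop where
  p_nonneg : ∀ i, 0 ≤ b.p i
  p_sum : ∑ i, b.p i = 1
  B_symm : ∀ i j, b.B i j = b.B j i
  B_nonneg : ∀ i j, 0 ≤ b.B i j

/-- `δ_p` between a block model and a graphon. -/
def BlockModel.deltaTo {Ω : Type u} [MeasurableSpace Ω] (b : BlockModel) (p : ℝ≥0∞)
    (π : Measure Ω) (W : Ω → Ω → ℝ) : ℝ≥0∞ :=
  deltaDist p b.measure b.B π W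

/-- The oracle error `ε_{≥κ}^{(p)}(W)`: the infimum of `δ_p(W', W)` over all block models `W'`
whose block weights are all at least `κ`. -/
def oracleError {Ω : Type u} [MeasurableSpace Ω] (p : ℝ≥0∞) (κ : ℝ) (π : Measure Ω)
    (W : Ω → Ω → ℝ) : ℝ≥0∞ :=
  ⨅ (b : BlockModel) (_ : b.IsValid ∧ ∀ i, κ ≤ b.p i), b.deltaTo p π W

/-! ## `W`-random graphs -/

/-- The matrix `Q` with entries `min {1, ρ W(x_i, x_j)}` off the diagonal and `0` on it. -/
def weightedGraph {Ω : Type u} {n : ℕ} (ρ : ℝ) (W : Ω → Ω → ℝ) (x : Fin n → Ω) :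
    Matrix (Fin n) (Fin n) ℝ :=
  fun i j => if i = j then 0 else min 1 (ρ * W (x i) (x j))

/-- The probability of the graph `g` on `n` vertices when the edges `ij`, `i < j`, are present
independently with probabilities `Q i j`. -/
def graphProb {n : ℕ} (Q : Matrix (Fin n) (Fin n) ℝ) (g : SimpleGraph (Fin n)) : ℝ :=
  ∏ i, ∏ j ∈ Finset.Ioi i, if g.Adj i j then Q i j else 1 - Q i j

/-- The random graph `G` on `n` vertices, defined on the probability space `(X, P)`, is a
`W`-random graph at target density `ρ` with latent positions `x_1, …, x_n`: the positions are
i.i.d. with law `π`, and conditionally on them the edges of `G` are independent, `ij` being present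
with probability `min {1, ρ W(x_i, x_j)}`. -/
structure IsWRandomGraph {Ω : Type u} [MeasurableSpace Ω] (π : Measure Ω) (W : Ω → Ω → ℝ) (ρ : ℝ)
    {X : Type v} [MeasurableSpace X] (P : Measure X) {n : ℕ} (x : Fin n → X → Ω)
    (G : X → SimpleGraph (Fin n)) : Prop where
  measurable_pos : ∀ i, Measurable (x i)
  law_pos : ∀ i, P.map (x i) = π
  indep_pos : iIndepFun x P
  measurable_graph : ∀ g, MeasurableSet {ω | G ω = g}
  cond_law : ∀ (S : Set (Fin n → Ω)) (g : SimpleGraph (Fin n)), MeasurableSet S →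
    P ({ω | (fun i => x i ω) ∈ S} ∩ {ω | G ω = g}) =
      ∫⁻ ω in {ω | (fun i => x i ω) ∈ S},
        ENNReal.ofReal (graphProb (weightedGraph ρ W (fun i => x i ω)) g) ∂P

/-! ## The least squares algorithm -/

/-- The normalized norm `‖A‖_2`, where `‖A‖_2^2 = n⁻² ∑_{i,j} |A_{ij}|^2`. -/
def matrixNorm2 {n : ℕ} (A : Matrix (Fin n) (Fin n) ℝ) : ℝ :=
  Real.sqrt ((1 / (n : ℝ) ^ 2) * ∑ i, ∑ j, |A i j| ^ 2)

/-- The number `k = ⌈n / ⌊n κ⌋⌉` of classes. -/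
def numClasses (n : ℕ) (κ : ℝ) : ℕ := ⌈(n : ℝ) / (⌊(n : ℝ) * κ⌋₊ : ℝ)⌉₊

/-- The class `V_i` of the partition `σ`. -/
def partClass {n k : ℕ} (σ : Fin n → Fin k) (i : Fin k) : Finset (Fin n) :=
  Finset.univ.filter (fun v => σ v = i)

/-- All nonempty classes of the partition `σ` have size at least `⌊n κ⌋`. -/
def IsAdmissible {n k : ℕ} (κ : ℝ) (σ : Fin n → Fin k) : Prop :=
  ∀ i, (partClass σ i).Nonempty → ⌊(n : ℝ) * κ⌋₊ ≤ (partClass σ i).card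

/-- `b` is an output of the least squares algorithm with input `G` and parameter `κ`: the block
model `(p̂, B̂)` for some `(σ, B̂)` that minimizes `‖A(G) - B^σ‖_2` over all admissible partitions
`σ` into `k` classes and all real `k × k` matrices; `p̂ i` is the relative size of class `i`. -/
def IsLeastSquaresOutput {n : ℕ} (κ : ℝ) (G : SimpleGraph (Fin n)) (b : BlockModel) : Prop :=
  ∃ (σ : Fin n → Fin (numClasses n κ))
    (B : Matrix (Fin (numClasses n κ)) (Fin (numClasses n κ)) ℝ),
    IsAdmissible κ σ ∧
    (∀ (σ' : Fin n → Fin (numClasses n κ))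
      (B' : Matrix (Fin (numClasses n κ)) (Fin (numClasses n κ)) ℝ), IsAdmissible κ σ' →
      matrixNorm2 (G.adjMatrix ℝ - B.submatrix σ σ) ≤
        matrixNorm2 (G.adjMatrix ℝ - B'.submatrix σ' σ')) ∧
    b = ⟨numClasses n κ, fun i => ((partClass σ i).card : ℝ) / (n : ℝ), B⟩

/-- The right-hand side of the oracle inequality, without its constant. -/
def oracleBound {Ω : Type u} [MeasurableSpace Ω] (π : Measure Ω) (W : Ω → Ω → ℝ)
    (n : ℕ) (κ ρ : ℝ) : ℝ≥0∞ :=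
  oracleError 2 κ π W
    + ENNReal.ofReal (((1 + Real.log (1 / κ)) / (κ ^ 2 * ρ * n)) ^ (1 / 4 : ℝ))
    + ENNReal.ofReal ((Real.log n / (κ * n)) ^ (1 / 4 : ℝ))
    + tailNorm 2 ρ π W

end

/-! ## Measures given by finitely many weights -/

/-! Let `A` be the adjacency matrix, `Q` the matrix of edge probabilities, and `H` the matrix of the
values of `W` at pairs of different sample points, with zero diagonal. Everything rests on three
comparisons: `A` with `Q`, `Q / ρ` with `H`, and `H` with `W`.

Given the positions, a Chernoff bound and a union bound over labellings and sign matrices show that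
`A - Q` is small when tested against every block matrix with `k` classes (`BlockClose`,
`IsWRandomGraph.blockClose`). The squared distances of a block matrix to `A` and to `Q` differ by a
term independent of that matrix and by twice such a test. A minimizer has block averages of `A` as
values, so its entries are controlled, and it is therefore almost optimal for `Q` as well
(`matrixNorm2_compare`). The entries of the scaled block matrices are of order `1/κ` and the
deviation is `√((1 + log (1/κ))/(ρ n))`; the square root of the product is the fourth root in the
oracle bound.

The competitor in this comparison comes from a block model `b` that is almost optimal for the oracle
error. Composing couplings through `W` gives a coupling of the uniform measure on the vertices with
the blocks of `b`, i.e. a fractional labelling. Independent random labels with these distributions,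
followed by a small correction of the class sizes, give an honest admissible partition of nearly the
same cost (`exists_rounding`). The class weights fluctuate by a relative amount of about `(κ
n)^(-1/2)`, which costs a fourth root of `1/(κ n)` in the norm.

The distance of `Q / ρ` to `H` is the square root of a pair average of the squared tail of `W`. The
distance of `H` to `W` is handled by labelling the sample points at random according to a coupling
of `W` with a block model: this leaves a pair average of squared differences and the error of
empirical block weights (`deltaDist_sampledMatrix_le`). For (i), Markov's inequality bounds all
these averages.

For (ii) and (iii) the averages are controlled for all sample sizes at once by a maximal inequality
(`IsSample.measure_exists_offDiagSum_gt_le`): decompose according to the last time a threshold is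
exceeded, and use that this event is symmetric in the points seen so far. With Borel–Cantelli,
almost every realization is regular (`IsRegularRealization`), and the rest is deterministic, which
makes the conclusion hold for all choices of minimizers. The upper bound uses one fixed competitor,
which exists in (iii) because block models are dense. The lower bound in (ii) holds because the
output has class weights at least `κ - 1/n` and can be changed slightly into an admissible block
model (`IsLeastSquaresOutput.oracleError_le`). -/

/-- The measure on a finite type that gives the point `i` the mass `w i`. -/
noncomputable def weightMeasure {ι : Type*} [Fintype ι] [MeasurableSpace ι] (w : ι → ℝ) : Measure ι :=
  ∑ i, ENNReal.ofReal (w i) • Measure.dirac i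

section weights

variable {ι : Type*} [Fintype ι] [MeasurableSpace ι] [MeasurableSingletonClass ι]

lemma lintegral_weightMeasure (w : ι → ℝ) (f : ι → ℝ≥0∞) :
    ∫⁻ i, f i ∂(weightMeasure w) = ∑ i, ENNReal.ofReal (w i) * f i := by
  simp [weightMeasure]

lemma weightMeasure_singleton (w : ι → ℝ) (i : ι) :
    weightMeasure w {i} = ENNReal.ofReal (w i) := by
  rw [weightMeasure, Measure.finsetSum_apply, Finset.sum_eq_single i] <;>
  simp +contextual

lemma isProbabilityMeasure_weightMeasure {w : ι → ℝ} (h0 : ∀ i, 0 ≤ w i) (h1 : ∑ i, w i = 1) :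
    IsProbabilityMeasure (weightMeasure w) := by
  constructor
  rw [← lintegral_one, lintegral_weightMeasure]
  simp only [mul_one]
  rw [← ENNReal.ofReal_sum_of_nonneg fun i _ => h0 i, h1, ENNReal.ofReal_one]

lemma eq_weightMeasure (μ : Measure ι) [IsFiniteMeasure μ] :
    μ = weightMeasure fun i => (μ {i}).toReal := by
  refine Measure.ext_of_singleton fun i => ?_
  rw [weightMeasure_singleton, ENNReal.ofReal_toReal (measure_ne_top _ _)]

/-- The `L²` norm of a matrix whose row and column indices are weighted by `w`. -/
noncomputable def weightedNorm {ι : Type*} [Fintype ι] (w : ι → ℝ) (f : ι → ι → ℝ) : ℝ :=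
  Real.sqrt (∑ i, ∑ j, w i * w j * f i j ^ 2)

lemma eLpNorm_two_sq {α : Type*} [MeasurableSpace α] (μ : Measure α) (f : α → ℝ) :
    eLpNorm f 2 μ ^ 2 = ∫⁻ a, ENNReal.ofReal (f a ^ 2) ∂μ := by
  rw [eLpNorm_eq_lintegral_rpow_enorm_toReal (by norm_num) (by norm_num), ← ENNReal.rpow_natCast,
    ← ENNReal.rpow_mul]
  norm_num
  refine lintegral_congr fun a => ?_
  rw [← ofReal_norm, ← ENNReal.ofReal_pow (norm_nonneg _), Real.norm_eq_abs, sq_abs]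

lemma lintegral_prod_weightMeasure (w : ι → ℝ) (f : ι × ι → ℝ≥0∞) :
    ∫⁻ q, f q ∂((weightMeasure w).prod (weightMeasure w)) =
      ∑ i, ∑ j, ENNReal.ofReal (w i) * ENNReal.ofReal (w j) * f (i, j) := by
  have : DiscreteMeasurableSpace ι := ⟨fun s => s.toFinite.measurableSet⟩
  rw [lintegral_prod _ (Measurable.of_discrete).aemeasurable, lintegral_weightMeasure]
  simp only [lintegral_weightMeasure, Finset.mul_sum, mul_assoc]

lemma eLpNorm_prod_weightMeasure {w : ι → ℝ} (h0 : ∀ i, 0 ≤ w i) (f : ι → ι → ℝ) :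
    eLpNorm (fun q : ι × ι => f q.1 q.2) 2 ((weightMeasure w).prod (weightMeasure w)) =
      ENNReal.ofReal (weightedNorm w f) := by
  refine (ENNReal.pow_right_strictMono two_ne_zero).injective ?_
  rw [eLpNorm_two_sq, lintegral_prod_weightMeasure, weightedNorm,
    ← ENNReal.ofReal_pow (Real.sqrt_nonneg _), Real.sq_sqrt, ENNReal.ofReal_sum_of_nonneg]
  · refine Finset.sum_congr rfl fun i _ => ?_
    rw [ENNReal.ofReal_sum_of_nonneg]
    · refine Finset.sum_congr rfl fun j _ => ?_
      rw [ENNReal.ofReal_mul (mul_nonneg (h0 i) (h0 j)), ENNReal.ofReal_mul (h0 i)]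
    · intro j _
      have := h0 i; have := h0 j; positivity
  · intro i _
    exact Finset.sum_nonneg fun j _ => by have := h0 i; have := h0 j; positivity
  · exact Finset.sum_nonneg fun i _ => Finset.sum_nonneg fun j _ => by
      have := h0 i; have := h0 j; positivity

end weights

/-! ## The invariant distance -/

section deltaDist

variable {α : Type*} {β : Type*} {γ : Type*} [MeasurableSpace α] [MeasurableSpace β]
  [MeasurableSpace γ]

lemma eLpNorm_prod_map {p : ℝ≥0∞} {μ : Measure α} [SFinite μ] {f : α → β} (hf : Measurable f)
    {F : β × β → ℝ} (hF : Measurable F) :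
    eLpNorm F p ((μ.map f).prod (μ.map f)) =
      eLpNorm (fun q : α × α => F (f q.1, f q.2)) p (μ.prod μ) := by
  rw [Measure.map_prod_map μ μ hf hf,
    eLpNorm_map_measure hF.aestronglyMeasurable (hf.prodMap hf).aemeasurable]
  rfl

lemma measurable_coupling_diff {W : α → α → ℝ} {W' : β → β → ℝ}
    (hW : Measurable (Function.uncurry W)) (hW' : Measurable (Function.uncurry W')) :
    Measurable fun q : (α × β) × (α × β) => W q.1.1 q.2.1 - W' q.1.2 q.2.2 :=
  (hW.comp (f := fun q : (α × β) × (α × β) => (q.1.1, q.2.1)) (by fun_prop)).sub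
    (hW'.comp (f := fun q : (α × β) × (α × β) => (q.1.2, q.2.2)) (by fun_prop))

lemma deltaDist_le_of_map {p : ℝ≥0∞} {μ : Measure γ} [SFinite μ] {f : γ → α} {g : γ → β}
    (hf : Measurable f) (hg : Measurable g) {W : α → α → ℝ} {W' : β → β → ℝ}
    (hW : Measurable (Function.uncurry W)) (hW' : Measurable (Function.uncurry W')) :
    deltaDist p (μ.map f) W (μ.map g) W' ≤
      eLpNorm (fun q : γ × γ => W (f q.1) (f q.2) - W' (g q.1) (g q.2)) p (μ.prod μ) := by
  have hfg : Measurable fun z => (f z, g z) := hf.prodMk hg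
  refine (iInf₂_le (μ.map fun z => (f z, g z)) ⟨?_, ?_⟩).trans_eq ?_
  · rw [eLpNorm_prod_map hfg (measurable_coupling_diff hW hW')]
  · rw [Measure.map_map measurable_fst hfg]; rfl
  · rw [Measure.map_map measurable_snd hfg]; rfl

lemma IsCoupling.isProbabilityMeasure {ν : Measure (α × β)} {π : Measure α} {π' : Measure β}
    [IsProbabilityMeasure π] (h : IsCoupling ν π π') : IsProbabilityMeasure ν := by
  constructor
  have : ν.map Prod.fst Set.univ = 1 := by rw [h.1]; simp
  rwa [Measure.map_apply measurable_fst MeasurableSet.univ] at this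

lemma deltaDist_comm_le {p : ℝ≥0∞} {π : Measure α} {π' : Measure β} [IsProbabilityMeasure π]
    {W : α → α → ℝ} {W' : β → β → ℝ}
    (hW : Measurable (Function.uncurry W)) (hW' : Measurable (Function.uncurry W')) :
    deltaDist p π' W' π W ≤ deltaDist p π W π' W' := by
  refine le_iInf₂ fun ν hν => ?_
  have := hν.isProbabilityMeasure
  have h := deltaDist_le_of_map (p := p) (μ := ν) measurable_snd measurable_fst hW' hW
  rw [hν.1, hν.2] at h
  refine h.trans_eq ?_
  rw [← eLpNorm_neg]
  congr 1
  ext q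
  simp

/-- Two couplings with a common marginal are marginals of one measure. -/
lemma exists_gluing [StandardBorelSpace α] [Nonempty α] (ν₁ : Measure (α × β))
    (ν₂ : Measure (β × γ)) [IsFiniteMeasure ν₁] [IsFiniteMeasure ν₂]
    (h : ν₁.map Prod.snd = ν₂.map Prod.fst) :
    ∃ μ : Measure ((β × γ) × α), IsFiniteMeasure μ ∧ μ.map Prod.fst = ν₂ ∧
      μ.map (fun z => (z.2, z.1.1)) = ν₁ := by
  -- The `α` coordinate is drawn from its conditional law given the `β` coordinate, independently of
  -- the `γ` coordinate. Only `α` has to be standard Borel for this.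
  set η := (ν₁.map Prod.swap).condKernel
  have hη : (ν₂.map Prod.fst) ⊗ₘ η = ν₁.map Prod.swap := by
    rw [← h]
    have := (ν₁.map Prod.swap).disintegrate η
    rwa [Measure.fst, Measure.map_map measurable_fst measurable_swap] at this
  refine ⟨ν₂ ⊗ₘ (η.comap Prod.fst measurable_fst), inferInstance, Measure.fst_compProd _ _, ?_⟩
  have h1 : (ν₂ ⊗ₘ (η.comap Prod.fst measurable_fst)).map (fun z => (z.1.1, z.2)) =
      ν₁.map Prod.swap := by
    rw [← hη]
    ext s hs
    rw [Measure.map_apply (by fun_prop) hs, Measure.compProd_apply hs,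
      Measure.compProd_apply ((by fun_prop : Measurable fun z : (β × γ) × α => (z.1.1, z.2)) hs),
      lintegral_map (Kernel.measurable_kernel_prodMk_left hs) measurable_fst]
    rfl
  have h2 : (fun z : (β × γ) × α => (z.2, z.1.1)) = Prod.swap ∘ fun z => (z.1.1, z.2) := rfl
  rw [h2, ← Measure.map_map measurable_swap (by fun_prop), h1,
    Measure.map_map measurable_swap measurable_swap]
  simp

/-- Glue the two couplings along their common marginal and apply Minkowski's inequality to the glued
measure. The regularity assumption falls on the first space alone, which is finite in every
application, so the space of `W` can be arbitrary. -/
lemma deltaDist_triangle [StandardBorelSpace α] [Nonempty α] {p : ℝ≥0∞} (hp : 1 ≤ p)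
    {π₁ : Measure α} {π₂ : Measure β} {π₃ : Measure γ} [IsProbabilityMeasure π₁]
    [IsProbabilityMeasure π₂] {W₁ : α → α → ℝ} {W₂ : β → β → ℝ} {W₃ : γ → γ → ℝ}
    (h₁ : Measurable (Function.uncurry W₁)) (h₂ : Measurable (Function.uncurry W₂))
    (h₃ : Measurable (Function.uncurry W₃)) :
    deltaDist p π₁ W₁ π₃ W₃ ≤ deltaDist p π₁ W₁ π₂ W₂ + deltaDist p π₂ W₂ π₃ W₃ := by
  refine ENNReal.le_iInf₂_add_iInf₂ fun ν₁ hν₁ ν₂ hν₂ => ?_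
  have := hν₁.isProbabilityMeasure
  have := hν₂.isProbabilityMeasure
  obtain ⟨μ, hμ, hμ₂, hμ₁⟩ := exists_gluing ν₁ ν₂ (hν₁.2.trans hν₂.1.symm)
  have e₁ : π₁ = μ.map Prod.snd := by
    rw [← hν₁.1, ← hμ₁, Measure.map_map measurable_fst (by fun_prop)]; rfl
  have e₃ : π₃ = μ.map fun z => z.1.2 := by
    rw [← hν₂.2, ← hμ₂, Measure.map_map measurable_snd (by fun_prop)]; rfl
  have m₁ : Measurable fun q : ((β × γ) × α) × ((β × γ) × α) =>
      W₁ q.1.2 q.2.2 - W₂ q.1.1.1 q.2.1.1 :=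
    (h₁.comp (f := fun q : ((β × γ) × α) × ((β × γ) × α) => (q.1.2, q.2.2)) (by fun_prop)).sub
    (h₂.comp (f := fun q : ((β × γ) × α) × ((β × γ) × α) => (q.1.1.1, q.2.1.1)) (by fun_prop))
  have m₂ : Measurable fun q : ((β × γ) × α) × ((β × γ) × α) =>
      W₂ q.1.1.1 q.2.1.1 - W₃ q.1.1.2 q.2.1.2 :=
    (h₂.comp (f := fun q : ((β × γ) × α) × ((β × γ) × α) => (q.1.1.1, q.2.1.1)) (by fun_prop)).sub
    (h₃.comp (f := fun q : ((β × γ) × α) × ((β × γ) × α) => (q.1.1.2, q.2.1.2)) (by fun_prop))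
  calc deltaDist p π₁ W₁ π₃ W₃
      ≤ eLpNorm (fun q : ((β × γ) × α) × ((β × γ) × α) =>
          W₁ q.1.2 q.2.2 - W₃ q.1.1.2 q.2.1.2) p (μ.prod μ) := by
        rw [e₁, e₃]
        exact deltaDist_le_of_map measurable_snd (by fun_prop) h₁ h₃
    _ ≤ _ := by
        refine le_trans (le_of_eq ?_) ((eLpNorm_add_le (μ := μ.prod μ) m₁.aestronglyMeasurable
          m₂.aestronglyMeasurable hp).trans_eq ?_)
        · congr 1; ext q; simp
        · congr 1
          · rw [← hμ₁, eLpNorm_prod_map (by fun_prop) (measurable_coupling_diff h₁ h₂)]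
          · rw [← hμ₂, eLpNorm_prod_map (by fun_prop) (measurable_coupling_diff h₂ h₃)]

end deltaDist

/-! ## Relabelling and rounding of couplings of finite measures -/

section finite

lemma weightedNorm_nonneg {ι : Type*} [Fintype ι] (w : ι → ℝ) (f : ι → ι → ℝ) :
    0 ≤ weightedNorm w f := Real.sqrt_nonneg _

lemma weightedNorm_add_le {ι : Type*} [Fintype ι] {w : ι → ℝ} (h0 : ∀ i, 0 ≤ w i)
    (f g : ι → ι → ℝ) :
    weightedNorm w (fun i j => f i j + g i j) ≤ weightedNorm w f + weightedNorm w g := by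
  let _ : MeasurableSpace ι := ⊤
  have : DiscreteMeasurableSpace ι := ⟨fun _ => trivial⟩
  have h := eLpNorm_add_le (μ := (weightMeasure w).prod (weightMeasure w)) (p := 2)
    (f := fun q : ι × ι => f q.1 q.2) (g := fun q : ι × ι => g q.1 q.2)
    Measurable.of_discrete.aestronglyMeasurable Measurable.of_discrete.aestronglyMeasurable
    (by norm_num)
  rw [eLpNorm_prod_weightMeasure h0, eLpNorm_prod_weightMeasure h0,
    ← ENNReal.ofReal_add (weightedNorm_nonneg w f) (weightedNorm_nonneg w g)] at h
  have h2 := eLpNorm_prod_weightMeasure h0 fun i j => f i j + g i j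
  rw [← ENNReal.ofReal_le_ofReal_iff (add_nonneg (weightedNorm_nonneg w f)
    (weightedNorm_nonneg w g)), ← h2]
  exact h

lemma weightedNorm_sq {ι : Type*} [Fintype ι] {w : ι → ℝ} (h0 : ∀ i, 0 ≤ w i) (f : ι → ι → ℝ) :
    weightedNorm w f ^ 2 = ∑ i, ∑ j, w i * w j * f i j ^ 2 :=
  Real.sq_sqrt (Finset.sum_nonneg fun i _ => Finset.sum_nonneg fun j _ => by
      have := h0 i; have := h0 j; positivity)

lemma sum_mul_comp_eq_sum_fiber {ι κ : Type*} [Fintype ι] [Fintype κ] [DecidableEq κ]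
    (l : ι → κ) (c : ι → ℝ) (g : κ → ℝ) :
    ∑ i, c i * g (l i) = ∑ a, (∑ i, if l i = a then c i else 0) * g a := by
  simp_rw [Finset.sum_mul, ite_mul, zero_mul]
  rw [Finset.sum_comm]
  simp

lemma sum_mul_comp_eq_sum_fiber₂ {ι κ : Type*} [Fintype ι] [Fintype κ] [DecidableEq κ]
    (l : ι → κ) (c d : ι → ℝ) (g : κ → κ → ℝ) :
    ∑ i, ∑ j, c i * d j * g (l i) (l j) =
      ∑ a, ∑ b, g a b * ((∑ i, if l i = a then c i else 0) * ∑ i, if l i = b then d i else 0) := by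
  calc ∑ i, ∑ j, c i * d j * g (l i) (l j)
      = ∑ i, c i * (fun a => ∑ j, d j * g a (l j)) (l i) := by
        simp_rw [Finset.mul_sum, mul_assoc]
    _ = _ := by
        rw [sum_mul_comp_eq_sum_fiber l c fun a => ∑ j, d j * g a (l j)]
        refine Finset.sum_congr rfl fun a _ => ?_
        rw [sum_mul_comp_eq_sum_fiber l d (g a), Finset.mul_sum]
        exact Finset.sum_congr rfl fun b _ => by ring

/-- A bound for the change of a block matrix when the labels `l` are replaced by `l'`. -/
lemma sum_sq_relabel_le {ι κ : Type*} [Fintype ι] [Fintype κ] [DecidableEq κ]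
    {w : ι → ℝ} (hw : ∀ i, 0 ≤ w i) (l l' : ι → κ) {B : κ → κ → ℝ} (hB : ∀ a b, B a b = B b a) :
    ∑ i, ∑ j, w i * w j * (B (l i) (l j) - B (l' i) (l' j)) ^ 2 ≤
      4 * ∑ a, ∑ b, B a b ^ 2 *
        ((∑ i, if l i = a then (if l i ≠ l' i then w i else 0) else 0) *
            (∑ i, if l i = b then w i else 0) +
          (∑ i, if l' i = a then (if l i ≠ l' i then w i else 0) else 0) *
            (∑ i, if l' i = b then w i else 0)) := by
  set c : ι → ℝ := fun i => if l i ≠ l' i then w i else 0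
  have hc : ∀ i, 0 ≤ c i := fun i => by simp only [c]; split_ifs <;> simp [hw]
  -- A pair contributes only if at least one of its two labels changes. Charging it to such an index
  -- and using `(s - t)² ≤ 2 (s² + t²)` gives the two terms; symmetry of `B` makes their sums equal.
  have key : ∀ i j, w i * w j * (B (l i) (l j) - B (l' i) (l' j)) ^ 2 ≤
      2 * (c i * w j * (B (l i) (l j) ^ 2 + B (l' i) (l' j) ^ 2)) +
      2 * (c j * w i * (B (l j) (l i) ^ 2 + B (l' j) (l' i) ^ 2)) := by
    intro i j
    have hi := hw i
    have hj := hw j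
    have hwij : 0 ≤ w i * w j := mul_nonneg hi hj
    rw [hB (l j), hB (l' j)]
    set s := B (l i) (l j) with hs
    set t := B (l' i) (l' j) with ht
    have hst : (s - t) ^ 2 ≤ 2 * (s ^ 2 + t ^ 2) := by nlinarith [sq_nonneg (s + t)]
    have h1 := mul_le_mul_of_nonneg_left hst hwij
    have hci : 0 ≤ c i * w j * (s ^ 2 + t ^ 2) := mul_nonneg (mul_nonneg (hc i) hj) (by positivity)
    have hcj : 0 ≤ c j * w i * (s ^ 2 + t ^ 2) := mul_nonneg (mul_nonneg (hc j) hi) (by positivity)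
    by_cases h : l i = l' i
    · by_cases h' : l j = l' j
      · have : s = t := by rw [hs, ht, h, h']
        rw [this, sub_self]
        rw [this] at hci hcj
        simp only [ne_eq, OfNat.ofNat_ne_zero, not_false_eq_true, zero_pow, mul_zero]
        linarith
      · have : c j = w j := by simp [c, h']
        rw [this] at hcj ⊢
        nlinarith
    · have : c i = w i := by simp [c, h]
      rw [this] at hci ⊢
      nlinarith
  calc _ ≤ ∑ i, ∑ j, (2 * (c i * w j * (B (l i) (l j) ^ 2 + B (l' i) (l' j) ^ 2)) +
      2 * (c j * w i * (B (l j) (l i) ^ 2 + B (l' j) (l' i) ^ 2))) :=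
        Finset.sum_le_sum fun i _ => Finset.sum_le_sum fun j _ => key i j
    _ = 4 * (∑ i, ∑ j, c i * w j * (B (l i) (l j) ^ 2) +
          ∑ i, ∑ j, c i * w j * (B (l' i) (l' j) ^ 2)) := by
        simp_rw [Finset.sum_add_distrib]
        rw [Finset.sum_comm (f := fun i j => 2 * (c j * w i * (B (l j) (l i) ^ 2 +
          B (l' j) (l' i) ^ 2)))]
        simp_rw [← Finset.mul_sum, mul_add, Finset.sum_add_distrib]
        ring
    _ = _ := by
        rw [sum_mul_comp_eq_sum_fiber₂ l c w (fun a b => B a b ^ 2),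
          sum_mul_comp_eq_sum_fiber₂ l' c w (fun a b => B a b ^ 2), ← Finset.sum_add_distrib]
        simp_rw [← Finset.sum_add_distrib, ← mul_add, c]

/-- A bound for the squared `L²` distance of the block models `(p, B)` and `(p', B)`. -/
noncomputable def transportCost {κ : Type*} [Fintype κ] (p p' : κ → ℝ) (B : κ → κ → ℝ) : ℝ :=
  4 * ∑ a, ∑ b, B a b ^ 2 * (|p a - p' a| * (p b + p' b))

lemma sum_sq_relabel_le_transportCost {ι κ : Type*} [Fintype ι] [Fintype κ] [DecidableEq κ]
    {w : ι → ℝ} (hw : ∀ i, 0 ≤ w i) {l l' : ι → κ} {B : κ → κ → ℝ} (hB : ∀ a b, B a b = B b a)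
    {p p' : κ → ℝ} (hp : ∀ a, p a = ∑ i, if l i = a then w i else 0)
    (hp' : ∀ a, p' a = ∑ i, if l' i = a then w i else 0)
    (h : ∀ a, (∑ i, if l i = a then (if l i ≠ l' i then w i else 0) else 0) ≤ |p a - p' a|)
    (h' : ∀ a, (∑ i, if l' i = a then (if l i ≠ l' i then w i else 0) else 0) ≤ |p a - p' a|) :
    ∑ i, ∑ j, w i * w j * (B (l i) (l j) - B (l' i) (l' j)) ^ 2 ≤ transportCost p p' B := by
  refine (sum_sq_relabel_le hw l l' hB).trans ?_
  rw [transportCost]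
  gcongr with a _ b _
  rw [← hp, ← hp', mul_add]
  have h1 : 0 ≤ p b := by
    rw [hp]; exact Finset.sum_nonneg fun i _ => by split_ifs <;> simp [hw]
  have h2 : 0 ≤ p' b := by
    rw [hp']; exact Finset.sum_nonneg fun i _ => by split_ifs <;> simp [hw]
  exact add_le_add (mul_le_mul_of_nonneg_right (h a) h1) (mul_le_mul_of_nonneg_right (h' a) h2)

/-- Leave the common mass `min (p a) (p' a)` in place and spread the remaining excess over the
remaining deficits by a normalized product. -/
lemma exists_transport {κ : Type*} [Fintype κ] {p p' : κ → ℝ} (hp : ∀ a, 0 ≤ p a)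
    (hp' : ∀ a, 0 ≤ p' a) (h : ∑ a, p a = ∑ a, p' a) :
    ∃ T : κ → κ → ℝ, (∀ a b, 0 ≤ T a b) ∧ (∀ a, ∑ b, T a b = p a) ∧ (∀ b, ∑ a, T a b = p' b) ∧
      ∀ a, min (p a) (p' a) ≤ T a a := by
  set m : κ → ℝ := fun a => min (p a) (p' a)
  set S := ∑ a, (p a - m a)
  have hS' : ∑ a, (p' a - m a) = S := by simp [S, h]
  have hm : ∀ a, 0 ≤ p a - m a := fun a => by simp [m]
  have hm' : ∀ a, 0 ≤ p' a - m a := fun a => by simp [m]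
  have hS : 0 ≤ S := Finset.sum_nonneg fun a _ => hm a
  -- If `S = 0` there is no excess at all, and the division by zero in the product term returns the
  -- correct value `0`.
  have hz : ∀ a, (p a - m a) * S / S = p a - m a := fun a => by
    rcases hS.eq_or_lt with h0 | h0
    · rw [← h0]
      have := (Finset.sum_eq_zero_iff_of_nonneg fun a _ => hm a).1 h0.symm a (Finset.mem_univ _)
      simp [this]
    · field_simp
  have hz' : ∀ a, S * (p' a - m a) / S = p' a - m a := fun a => by
    rcases hS.eq_or_lt with h0 | h0
    · rw [← h0]
      have := (Finset.sum_eq_zero_iff_of_nonneg fun a _ => hm' a).1 (hS'.trans h0.symm) a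
        (Finset.mem_univ _)
      simp [this]
    · field_simp
  refine ⟨fun a b => (if a = b then m a else 0) + (p a - m a) * (p' b - m b) / S, ?_, ?_, ?_, ?_⟩
  · intro a b
    have h1 : 0 ≤ m a := le_min (hp a) (hp' a)
    have h2 : 0 ≤ (p a - m a) * (p' b - m b) / S := div_nonneg (mul_nonneg (hm a) (hm' b)) hS
    beta_reduce
    split_ifs <;> linarith
  · intro a
    rw [Finset.sum_add_distrib, ← Finset.sum_div, ← Finset.mul_sum, hS', hz]
    simp
  · intro b
    rw [Finset.sum_add_distrib, ← Finset.sum_div, ← Finset.sum_mul, hz']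
    simp
  · intro a
    have h2 : 0 ≤ (p a - m a) * (p' a - m a) / S := div_nonneg (mul_nonneg (hm a) (hm' a)) hS
    simp only [if_true]
    exact le_add_of_nonneg_right h2

lemma map_weightMeasure {ι κ : Type*} [Fintype ι] [Fintype κ] [DecidableEq κ] [MeasurableSpace ι]
    [MeasurableSpace κ] [MeasurableSingletonClass ι] [MeasurableSingletonClass κ] {w : ι → ℝ}
    (hw : ∀ i, 0 ≤ w i) (f : ι → κ) :
    (weightMeasure w).map f = weightMeasure fun a => ∑ i, if f i = a then w i else 0 := by
  have : DiscreteMeasurableSpace ι := ⟨fun s => s.toFinite.measurableSet⟩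
  refine Measure.ext_of_singleton fun a => ?_
  rw [Measure.map_apply Measurable.of_discrete (measurableSet_singleton a),
    weightMeasure_singleton, weightMeasure, Measure.finsetSum_apply,
    ENNReal.ofReal_sum_of_nonneg fun i _ => by split_ifs <;> simp [hw]]
  refine Finset.sum_congr rfl fun i _ => ?_
  by_cases h : f i = a <;> simp [h]

lemma measurable_uncurry_of_finite {κ : Type*} [Finite κ] [MeasurableSpace κ]
    [MeasurableSingletonClass κ] (B : κ → κ → ℝ) : Measurable (Function.uncurry B) :=
  have : DiscreteMeasurableSpace κ := ⟨fun s => s.toFinite.measurableSet⟩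
  Measurable.of_discrete

/-- In the transport that keeps the common mass, at most `|p a - p' a|` leaves or enters block `a`.
The relabelling bound then applies to the index set of pairs, labelled by the two coordinates. -/
lemma deltaDist_weightMeasure_le {κ : Type*} [Fintype κ] [MeasurableSpace κ]
    [MeasurableSingletonClass κ] {p p' : κ → ℝ} (hp : ∀ a, 0 ≤ p a)
    (hp' : ∀ a, 0 ≤ p' a) (h : ∑ a, p a = ∑ a, p' a) {B : κ → κ → ℝ} (hB : ∀ a b, B a b = B b a) :
    deltaDist 2 (weightMeasure p) B (weightMeasure p') B ≤
      ENNReal.ofReal (Real.sqrt (transportCost p p' B)) := by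
  obtain ⟨T, hT, h1, h2, h3⟩ := exists_transport hp hp' h
  have hw : ∀ z : κ × κ, 0 ≤ (fun z : κ × κ => T z.1 z.2) z := fun z => hT _ _
  have e1 : ∀ a, p a = ∑ z : κ × κ, if z.1 = a then T z.1 z.2 else 0 := fun a => by
    rw [Fintype.sum_prod_type, Finset.sum_eq_single a] <;> simp +contextual [h1]
  have e2 : ∀ a, p' a = ∑ z : κ × κ, if z.2 = a then T z.1 z.2 else 0 := fun a => by
    rw [Fintype.sum_prod_type_right, Finset.sum_eq_single a] <;> simp +contextual [h2]
  have m1 : weightMeasure p = (weightMeasure fun z : κ × κ => T z.1 z.2).map Prod.fst := by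
    rw [map_weightMeasure hw]; congr 1; ext a; exact e1 a
  have m2 : weightMeasure p' = (weightMeasure fun z : κ × κ => T z.1 z.2).map Prod.snd := by
    rw [map_weightMeasure hw]; congr 1; ext a; exact e2 a
  rw [m1, m2]
  refine (deltaDist_le_of_map measurable_fst measurable_snd (measurable_uncurry_of_finite B)
    (measurable_uncurry_of_finite B)).trans ?_
  rw [eLpNorm_prod_weightMeasure hw (fun z z' => B z.1 z'.1 - B z.2 z'.2)]
  refine ENNReal.ofReal_le_ofReal (Real.sqrt_le_sqrt ?_)
  have hpos : ∀ a b, (0 : ℝ) ≤ if a ≠ b then T a b else 0 := fun a b => by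
    split_ifs <;> simp [hT]
  refine sum_sq_relabel_le_transportCost hw hB e1 e2 (fun a => ?_) (fun a => ?_)
  · have : (∑ z : κ × κ, if z.1 = a then (if z.1 ≠ z.2 then T z.1 z.2 else 0) else 0) =
        p a - T a a := by
      rw [Fintype.sum_prod_type, Finset.sum_eq_single a _ (by simp)]
      · rw [← h1, ← Finset.add_sum_erase _ _ (Finset.mem_univ a),
          ← Finset.add_sum_erase _ (T a) (Finset.mem_univ a)]
        simp only [if_true, ne_eq, not_true, if_false, zero_add, add_sub_cancel_left]
        refine Finset.sum_congr rfl fun b hb => ?_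
        rw [if_pos]
        exact fun h => (Finset.mem_erase.1 hb).1 h.symm
      · intro b _ hb
        simp [hb]
    rw [this]
    have := h3 a
    rcases le_total (p a) (p' a) with h | h
    · rw [min_eq_left h] at this
      have := abs_nonneg (p a - p' a); linarith
    · rw [min_eq_right h] at this
      have := le_abs_self (p a - p' a); linarith
  · have : (∑ z : κ × κ, if z.2 = a then (if z.1 ≠ z.2 then T z.1 z.2 else 0) else 0) =
        p' a - T a a := by
      rw [Fintype.sum_prod_type_right, Finset.sum_eq_single a _ (by simp)]
      · rw [← h2, ← Finset.add_sum_erase _ _ (Finset.mem_univ a),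
          ← Finset.add_sum_erase _ (fun b => T b a) (Finset.mem_univ a)]
        simp only [if_true, ne_eq, not_true, if_false, zero_add, add_sub_cancel_left]
        refine Finset.sum_congr rfl fun b hb => ?_
        rw [if_pos]
        exact fun h => (Finset.mem_erase.1 hb).1 h
      · intro b _ hb
        simp [hb]
    rw [this]
    have := h3 a
    rcases le_total (p a) (p' a) with h | h
    · rw [min_eq_left h] at this
      have := neg_abs_le (p a - p' a); linarith
    · rw [min_eq_right h] at this
      have := abs_nonneg (p a - p' a); linarith

end finite

/-! ### Integer class sizes and labellings that attain them -/

section relabel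

/-- Take differences of the floors of successive partial sums: the floor of a sum of two terms
exceeds the sum of the floors by `0` or `1`. -/
lemma exists_nat_rounding {κ : Type*} (s : Finset κ) {p : κ → ℝ} (hp : ∀ a, 0 ≤ p a) :
    ∃ c : κ → ℕ, ∑ a ∈ s, c a = ⌊∑ a ∈ s, p a⌋₊ ∧ ∀ a, ⌊p a⌋₊ ≤ c a ∧ c a ≤ ⌊p a⌋₊ + 1 := by
  classical
  induction s using Finset.induction_on with
  | empty => exact ⟨fun a => ⌊p a⌋₊, by simp, fun a => ⟨le_rfl, Nat.le_succ _⟩⟩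
  | insert a s ha ih =>
    obtain ⟨c, h1, h2⟩ := ih
    have hs : 0 ≤ ∑ a ∈ s, p a := Finset.sum_nonneg fun a _ => hp a
    have hl : ⌊p a⌋₊ + ⌊∑ a ∈ s, p a⌋₊ ≤ ⌊p a + ∑ a ∈ s, p a⌋₊ := by
      refine Nat.le_floor ?_
      push_cast
      exact add_le_add (Nat.floor_le (hp a)) (Nat.floor_le hs)
    have hu : ⌊p a + ∑ a ∈ s, p a⌋₊ ≤ ⌊p a⌋₊ + ⌊∑ a ∈ s, p a⌋₊ + 1 := by
      refine Nat.lt_succ_iff.1 ((Nat.floor_lt (add_nonneg (hp a) hs)).2 ?_)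
      have := Nat.lt_floor_add_one (p a)
      have := Nat.lt_floor_add_one (∑ a ∈ s, p a)
      push_cast
      linarith
    refine ⟨Function.update c a (⌊p a + ∑ a ∈ s, p a⌋₊ - ⌊∑ a ∈ s, p a⌋₊), ?_, fun b => ?_⟩
    · rw [Finset.sum_insert ha, Finset.sum_insert ha, Finset.sum_update_of_notMem ha, h1,
        Function.update_self]
      omega
    · by_cases hb : b = a
      · subst hb
        rw [Function.update_self]
        omega
      · rw [Function.update_of_ne hb]
        exact h2 b

variable {n k : ℕ}

lemma card_partClass (σ : Fin n → Fin k) (a : Fin k) :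
    (partClass σ a).card = (Finset.univ.filter fun v => σ v = a).card := rfl

lemma exists_map_with_counts {c : Fin k → ℕ} (hc : ∑ a, c a = n) :
    ∃ r : Fin n → Fin k, ∀ a, (partClass r a).card = c a := by
  subst hc
  refine ⟨fun i => (finSigmaFinEquiv.symm i).1, fun a => ?_⟩
  rw [card_partClass]
  have hinj : Function.Injective fun j : Fin (c a) => finSigmaFinEquiv (n := c) ⟨a, j⟩ :=
    fun i j h => by simpa using h
  have : (Finset.univ.filter fun v => (finSigmaFinEquiv (n := c).symm v).1 = a) =
      Finset.univ.image fun j : Fin (c a) => finSigmaFinEquiv (n := c) ⟨a, j⟩ := by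
    ext v
    simp only [Finset.mem_filter, Finset.mem_univ, true_and, Finset.mem_image]
    constructor
    · intro h
      subst h
      exact ⟨(finSigmaFinEquiv (n := c).symm v).2, by simp⟩
    · rintro ⟨j, rfl⟩
      simp
  rw [this, Finset.card_image_of_injective _ hinj]
  simp

/-- A labelling can be changed to one with prescribed class sizes so that each class only loses
points or only gains points. -/
lemma exists_relabelling (l : Fin n → Fin k) {c : Fin k → ℕ} (hc : ∑ a, c a = n) :
    ∃ l' : Fin n → Fin k, (∀ a, (partClass l' a).card = c a) ∧ ∀ a,
      ((Finset.univ.filter fun v => l v = a ∧ l v ≠ l' v).card : ℝ) ≤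
        |((partClass l a).card : ℝ) - c a| ∧
      ((Finset.univ.filter fun v => l' v = a ∧ l v ≠ l' v).card : ℝ) ≤
        |((partClass l a).card : ℝ) - c a| := by
  obtain ⟨r, hr⟩ := exists_map_with_counts hc
  have : Nonempty {r : Fin n → Fin k // ∀ a, (partClass r a).card = c a} := ⟨⟨r, hr⟩⟩
  -- Among all labellings with the prescribed class sizes, take one that agrees with `l` in as many
  -- points as possible.
  obtain ⟨⟨l', hl'⟩, hmax⟩ := Finite.exists_max
    fun r : {r : Fin n → Fin k // ∀ a, (partClass r a).card = c a} =>
      (Finset.univ.filter fun v => l v = r.1 v).card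
  refine ⟨l', hl', fun a => ?_⟩
  set O := Finset.univ.filter fun v => l v = a ∧ l v ≠ l' v
  set I := Finset.univ.filter fun v => l' v = a ∧ l v ≠ l' v
  set C := Finset.univ.filter fun v => l v = a ∧ l' v = a
  have hN : (partClass l a).card = C.card + O.card := by
    rw [card_partClass, ← Finset.card_filter_add_card_filter_not (fun v => l' v = a),
      Finset.filter_filter, Finset.filter_filter]
    congr 2
    ext v
    simp only [Finset.mem_filter, Finset.mem_univ, true_and, O]
    constructor <;> rintro ⟨rfl, h⟩ <;> exact ⟨rfl, fun h' => h h'.symm⟩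
  have hN' : c a = C.card + I.card := by
    rw [← hl' a, card_partClass, ← Finset.card_filter_add_card_filter_not (fun v => l v = a),
      Finset.filter_filter, Finset.filter_filter]
    congr 2
    · ext v
      simp only [Finset.mem_filter, Finset.mem_univ, true_and, C]
      tauto
    · ext v
      simp only [Finset.mem_filter, Finset.mem_univ, true_and, I]
      constructor <;> rintro ⟨rfl, h⟩ <;> exact ⟨rfl, h⟩
  -- If a class both lost a point `i` and gained a point `j`, exchanging the new labels of `i` and
  -- `j` would keep all class sizes, restore the label of `i` and destroy no agreement, against
  -- maximality.
  have hOI : O = ∅ ∨ I = ∅ := by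
    by_contra! h
    obtain ⟨⟨i, hi⟩, ⟨j, hj⟩⟩ := h
    simp only [Finset.mem_filter, Finset.mem_univ, true_and, O, I] at hi hj
    refine absurd (hmax ⟨l' ∘ Equiv.swap i j, fun b => ?_⟩) (not_le.2 (Finset.card_lt_card ?_))
    · rw [← hl' b, card_partClass, card_partClass]
      refine Finset.card_equiv (Equiv.swap i j) fun v => ?_
      simp
    · rw [Finset.ssubset_iff_of_subset]
      · refine ⟨i, ?_, ?_⟩
        · simp [hi.1, hj.1]
        · simpa using hi.2
      · intro v
        simp only [Finset.mem_filter, Finset.mem_univ, true_and, Function.comp_apply]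
        intro hv
        rw [Equiv.swap_apply_of_ne_of_ne, hv]
        · rintro rfl; exact hi.2 hv
        · rintro rfl; exact hj.2 hv
  rw [hN, hN']
  push_cast
  rcases hOI with h | h <;> rw [h] <;> simp

end relabel

/-! ## Independent random labels -/

section expectation

variable {ι κ : Type*} [Fintype ι] [Fintype κ]

/-- The expectation of `f l` when the labels `l i` are independent with distributions `q i`. -/
noncomputable def labelExp [DecidableEq ι] (q : ι → κ → ℝ) (f : (ι → κ) → ℝ) : ℝ :=
  ∑ l : ι → κ, (∏ i, q i (l i)) * f l

variable [DecidableEq ι] {q : ι → κ → ℝ}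

lemma labelExp_add (f g : (ι → κ) → ℝ) :
    labelExp q (fun l => f l + g l) = labelExp q f + labelExp q g := by
  simp [labelExp, mul_add, Finset.sum_add_distrib]

lemma labelExp_const_mul (c : ℝ) (f : (ι → κ) → ℝ) :
    labelExp q (fun l => c * f l) = c * labelExp q f := by
  simp only [labelExp, Finset.mul_sum]
  exact Finset.sum_congr rfl fun l _ => by ring

lemma labelExp_sum {τ : Type*} (s : Finset τ) (f : τ → (ι → κ) → ℝ) :
    labelExp q (fun l => ∑ t ∈ s, f t l) = ∑ t ∈ s, labelExp q (f t) := by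
  simp only [labelExp, Finset.mul_sum]
  exact Finset.sum_comm

lemma labelExp_prod (φ : ι → κ → ℝ) :
    labelExp q (fun l => ∏ i, φ i (l i)) = ∏ i, ∑ a, q i a * φ i a := by
  simp only [labelExp, ← Finset.prod_mul_distrib]
  rw [Finset.prod_univ_sum, Fintype.piFinset_univ]

lemma labelExp_one (h1 : ∀ i, ∑ a, q i a = 1) : labelExp q (fun _ => 1) = 1 := by
  have := labelExp_prod (q := q) fun _ _ => 1
  simpa [h1] using this

lemma labelExp_const (h1 : ∀ i, ∑ a, q i a = 1) (c : ℝ) : labelExp q (fun _ => c) = c := by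
  have := labelExp_const_mul (q := q) c fun _ => 1
  simpa [labelExp_one h1] using this

/-- The probabilistic method: some outcome does not exceed the mean. -/
lemma exists_le_labelExp (hq : ∀ i a, 0 ≤ q i a) (h1 : ∀ i, ∑ a, q i a = 1)
    (f : (ι → κ) → ℝ) : ∃ l, f l ≤ labelExp q f := by
  by_contra! h
  have h0 : labelExp q (fun l => f l - labelExp q f) = 0 := by
    have := labelExp_add (q := q) f fun _ => - labelExp q f
    rw [labelExp_const h1] at this
    simpa [sub_eq_add_neg] using this
  have h2 := (Finset.sum_eq_zero_iff_of_nonneg fun l _ => mul_nonneg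
    (Finset.prod_nonneg fun i _ => hq i _) (sub_nonneg.2 (h l).le)).1 h0
  have h3 := labelExp_one h1
  rw [labelExp, Finset.sum_eq_zero] at h3
  · exact zero_ne_one h3
  · intro l hl
    rw [mul_one]
    exact (mul_eq_zero.1 (h2 l hl)).resolve_right (sub_pos.2 (h l)).ne'

lemma labelExp_apply (h1 : ∀ i, ∑ a, q i a = 1) (i : ι) (g : κ → ℝ) :
    labelExp q (fun l => g (l i)) = ∑ a, q i a * g a := by
  have h := labelExp_prod (q := q) fun m a => if m = i then g a else 1
  have e : ∀ l : ι → κ, (∏ m, if m = i then g (l m) else 1) = g (l i) := fun l => by simp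
  simp only [e] at h
  rw [h, Finset.prod_eq_single i]
  · simp
  · intro m _ hm
    simp [hm, h1]
  · simp

lemma labelExp_apply₂ [DecidableEq κ] (h1 : ∀ i, ∑ a, q i a = 1) {i j : ι} (hij : i ≠ j)
    (g : κ → κ → ℝ) :
    labelExp q (fun l => g (l i) (l j)) = ∑ a, ∑ b, q i a * q j b * g a b := by
  have hind : ∀ a b, labelExp q (fun l => (if l i = a then 1 else 0) *
      (if l j = b then 1 else 0)) = q i a * q j b := by
    intro a b
    have h := labelExp_prod (q := q) fun m c => if m = i then (if c = a then 1 else 0) else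
      if m = j then (if c = b then 1 else 0) else 1
    have e : ∀ l : ι → κ, (∏ m, if m = i then (if l m = a then 1 else 0) else
      if m = j then (if l m = b then 1 else 0) else (1 : ℝ)) =
        (if l i = a then 1 else 0) * (if l j = b then 1 else 0) := fun l => by
      rw [Finset.prod_eq_mul i j hij]
      · simp [hij.symm]
      · rintro c _ ⟨h1, h2⟩; simp [h1, h2]
      · simp
      · simp
    simp only [e] at h
    rw [h, Finset.prod_eq_mul i j hij]
    · simp [hij.symm]
    · rintro c _ ⟨h2, h3⟩; simp [h2, h3, h1]
    · simp
    · simp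
  have e : ∀ l : ι → κ, g (l i) (l j) = ∑ a, ∑ b, g a b * ((if l i = a then 1 else 0) *
      (if l j = b then 1 else 0)) := fun l => by simp
  simp only [e]
  rw [labelExp_sum]
  refine Finset.sum_congr rfl fun a _ => ?_
  rw [labelExp_sum]
  refine Finset.sum_congr rfl fun b _ => ?_
  rw [labelExp_const_mul, hind]
  ring

/-- The centred indicators of different indices are uncorrelated, and each has variance `q - q² ≤
q`. -/
lemma labelExp_sq_sum_le [DecidableEq κ] (h1 : ∀ i, ∑ a, q i a = 1)
    (a : κ) :
    labelExp q (fun l => (∑ i, ((if l i = a then 1 else 0) - q i a)) ^ 2) ≤ ∑ i, q i a := by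
  have e : ∀ l : ι → κ, (∑ i, ((if l i = a then 1 else 0) - q i a)) ^ 2 =
      ∑ i, ∑ j, ((if l i = a then 1 else 0) - q i a) * ((if l j = a then 1 else 0) - q j a) :=
    fun l => by rw [sq, Finset.sum_mul_sum]
  simp only [e]
  rw [labelExp_sum]
  refine Finset.sum_le_sum fun i _ => ?_
  rw [labelExp_sum, Finset.sum_eq_single i]
  · rw [labelExp_apply h1 i fun b => ((if b = a then 1 else 0) - q i a) *
      ((if b = a then 1 else 0) - q i a)]
    have : ∀ b, q i b * (((if b = a then 1 else 0) - q i a) * ((if b = a then 1 else 0) - q i a)) =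
        (1 - 2 * q i a) * (if b = a then q i b else 0) + q i a ^ 2 * q i b := fun b => by
      split_ifs <;> ring
    simp only [this, Finset.sum_add_distrib, ← Finset.mul_sum, h1]
    simp only [Finset.sum_ite_eq', Finset.mem_univ, if_true]
    nlinarith [sq_nonneg (q i a)]
  · intro j _ hj
    rw [labelExp_apply₂ h1 hj.symm fun b c => ((if b = a then 1 else 0) - q i a) *
      ((if c = a then 1 else 0) - q j a)]
    have : ∀ b c, q i b * q j c * (((if b = a then 1 else 0) - q i a) *
      ((if c = a then 1 else 0) - q j a)) = ((if b = a then q i b else 0) - q i a * q i b) *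
      ((if c = a then q j c else 0) - q j a * q j c) := fun b c => by split_ifs <;> ring
    simp only [this, ← Finset.mul_sum]
    rw [Finset.sum_eq_zero]
    intro b _
    simp [Finset.sum_sub_distrib, ← Finset.mul_sum, h1]
  · simp

end expectation

/-! ### Rounding a fractional labelling to a partition -/

section rounding

/-- An affine bound for `transportCost` in the squared relative errors `y a` of the weights. -/
noncomputable def affineCost {κ : Type*} [Fintype κ] (η : ℝ) (p : κ → ℝ) (B : κ → κ → ℝ)
    (y : κ → ℝ) : ℝ :=
  ∑ a, ∑ b, 4 * (p a * p b * B a b ^ 2) *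
    ((1 / 2 + 3 / (2 * η)) * y a + (y b + (η ^ 2 / 2 + 9 / 2 * η)))

/-- With relative errors `u`, `v` of the weights `p'` in two blocks, the cost of a pair is at most
`(u + η)(v + 3)` times its weight. The inequalities `2uv ≤ u² + v²`, `2u ≤ u²/η + η` and `2ηv ≤ η² +
v²` make this affine in `u²` and `v²`, so that a mean over random labels needs only second moments
of the class weights. -/
lemma transportCost_le_affineCost {κ : Type*} [Fintype κ] {η : ℝ} (h0 : 0 < η) (hη : η ≤ 1)
    {p p' p'' : κ → ℝ} (hp : ∀ a, 0 < p a) (h : ∀ a, |p'' a - p a| ≤ η * p a) (B : κ → κ → ℝ) :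
    transportCost p' p'' B ≤ affineCost η p B fun a => (p' a - p a) ^ 2 / p a ^ 2 := by
  rw [transportCost, affineCost, Finset.mul_sum]
  refine Finset.sum_le_sum fun a _ => ?_
  rw [Finset.mul_sum]
  refine Finset.sum_le_sum fun b _ => ?_
  have hu : |p' a - p a| = |p' a - p a| / p a * p a := by field_simp [(hp a).ne']
  have hv : |p' b - p b| = |p' b - p b| / p b * p b := by field_simp [(hp b).ne']
  have hu0 : 0 ≤ |p' a - p a| / p a := div_nonneg (abs_nonneg _) (hp a).le
  have hv0 : 0 ≤ |p' b - p b| / p b := div_nonneg (abs_nonneg _) (hp b).le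
  have hu2 : (p' a - p a) ^ 2 / p a ^ 2 = (|p' a - p a| / p a) ^ 2 := by rw [div_pow, sq_abs]
  have hv2 : (p' b - p b) ^ 2 / p b ^ 2 = (|p' b - p b| / p b) ^ 2 := by rw [div_pow, sq_abs]
  rw [hu2, hv2]
  set u := |p' a - p a| / p a
  set v := |p' b - p b| / p b
  have ha : |p' a - p'' a| ≤ (u + η) * p a := by
    have h1 := h a
    have h2 := abs_sub_le (p' a) (p a) (p'' a)
    rw [abs_sub_comm (p a), hu] at h2
    linarith
  have hb : p' b + p'' b ≤ (v + 3) * p b := by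
    have h1 := le_abs_self (p' b - p b)
    have h2 := (le_abs_self _).trans (h b)
    have h3 : η * p b ≤ p b := by nlinarith [hp b]
    rw [hv] at h1
    linarith
  have hprod : |p' a - p'' a| * (p' b + p'' b) ≤ ((u + η) * p a) * ((v + 3) * p b) :=
    (mul_le_mul_of_nonneg_left hb (abs_nonneg _)).trans
      (mul_le_mul_of_nonneg_right ha (mul_nonneg (by linarith) (hp b).le))
  have key : (u + η) * (v + 3) ≤
      (1 / 2 + 3 / (2 * η)) * u ^ 2 + (v ^ 2 + (η ^ 2 / 2 + 9 / 2 * η)) := by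
    have h1 : 2 * u ≤ u ^ 2 / η + η := by
      rw [← sub_nonneg]
      have : u ^ 2 / η + η - 2 * u = (u - η) ^ 2 / η := by field_simp; ring
      rw [this]; positivity
    have h2 : 3 / (2 * η) * u ^ 2 = 3 / 2 * (u ^ 2 / η) := by field_simp
    nlinarith [sq_nonneg (u - v), sq_nonneg (v - η)]
  calc 4 * (B a b ^ 2 * (|p' a - p'' a| * (p' b + p'' b)))
      ≤ 4 * (B a b ^ 2 * (((u + η) * p a) * ((v + 3) * p b))) := by gcongr
    _ = 4 * (p a * p b * B a b ^ 2) * ((u + η) * (v + 3)) := by ring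
    _ ≤ _ := mul_le_mul_of_nonneg_left key
      (by have := hp a; have := hp b; positivity)

/-- At `y = η²` the bracket is at most `2 η² + 6 η ≤ 8 η`; the factor `4` of the transport cost
makes it `32 η`. -/
lemma affineCost_le {κ : Type*} [Fintype κ] {η : ℝ} (h0 : 0 < η) (hη : η ≤ 1)
    {p : κ → ℝ} (hp : ∀ a, 0 ≤ p a) (B : κ → κ → ℝ) {y : κ → ℝ} (hy : ∀ a, y a ≤ η ^ 2) :
    affineCost η p B y ≤ 32 * η * weightedNorm p B ^ 2 := by
  rw [weightedNorm_sq hp, Finset.mul_sum, affineCost]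
  refine Finset.sum_le_sum fun a _ => ?_
  rw [Finset.mul_sum]
  refine Finset.sum_le_sum fun b _ => ?_
  have h1 : (1 / 2 + 3 / (2 * η)) * y a + (y b + (η ^ 2 / 2 + 9 / 2 * η)) ≤ 8 * η := by
    have h2 : (1 / 2 + 3 / (2 * η)) * y a ≤ (1 / 2 + 3 / (2 * η)) * η ^ 2 :=
      mul_le_mul_of_nonneg_left (hy a) (by positivity)
    have h3 : 3 / (2 * η) * η ^ 2 = 3 / 2 * η := by field_simp
    nlinarith [hy b]
  have h2 : 0 ≤ 4 * (p a * p b * B a b ^ 2) := by have := hp a; have := hp b; positivity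
  calc _ ≤ 4 * (p a * p b * B a b ^ 2) * (8 * η) := mul_le_mul_of_nonneg_left h1 h2
    _ = _ := by ring

lemma affineCost_nonneg {κ : Type*} [Fintype κ] {η : ℝ} (h0 : 0 < η)
    {p : κ → ℝ} (hp : ∀ a, 0 ≤ p a) (B : κ → κ → ℝ) {y : κ → ℝ} (hy : ∀ a, 0 ≤ y a) :
    0 ≤ affineCost η p B y :=
  Finset.sum_nonneg fun a _ => Finset.sum_nonneg fun b _ => by
    have := hp a; have := hp b; have := hy a; have := hy b; positivity

lemma sum_diag_le_weightedNorm {κ : Type*} [Fintype κ] {p : κ → ℝ} (hp : ∀ a, 0 ≤ p a)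
    (B : κ → κ → ℝ) {s t : ℝ} (ht : 0 ≤ t) (hs : ∀ a, s ≤ t * p a) :
    s * ∑ a, p a * B a a ^ 2 ≤ t * weightedNorm p B ^ 2 := by
  rw [weightedNorm_sq hp, Finset.mul_sum, Finset.mul_sum]
  refine Finset.sum_le_sum fun a _ => ?_
  calc s * (p a * B a a ^ 2) ≤ t * p a * (p a * B a a ^ 2) :=
        mul_le_mul_of_nonneg_right (hs a) (by have := hp a; positivity)
    _ = t * (p a * p a * B a a ^ 2) := by ring
    _ ≤ _ := by
        gcongr
        exact Finset.single_le_sum (f := fun b => p a * p b * B a b ^ 2)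
          (fun b _ => by have := hp a; have := hp b; positivity) (Finset.mem_univ a)

variable {n k : ℕ}

lemma matrixNorm2_eq_weightedNorm (A : Matrix (Fin n) (Fin n) ℝ) :
    matrixNorm2 A = weightedNorm (fun _ => 1 / (n : ℝ)) A := by
  unfold matrixNorm2 weightedNorm
  rw [Finset.mul_sum]
  congr 1
  refine Finset.sum_congr rfl fun i _ => ?_
  rw [Finset.mul_sum]
  refine Finset.sum_congr rfl fun j _ => ?_
  rw [sq_abs]
  ring

/-- A coupling `w` of the uniform distribution on `n` points with the weights `p` can be rounded
to a map without losing much in the `L²` distance of `H` and `B`. -/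
lemma exists_rounding (hn : 0 < n) {H : Fin n → Fin n → ℝ} (hH : ∀ i, H i i = 0)
    {B : Fin k → Fin k → ℝ} (hB : ∀ a b, B a b = B b a) {p : Fin k → ℝ} {κ η K : ℝ} (hκ : 0 < κ)
    (hη : 0 < η) (hη1 : η ≤ 1) (hηκ : 1 / (n * κ) ≤ η ^ 2) (hK : 0 < K)
    (hp : ∀ a, κ ≤ p a) (hp1 : ∑ a, p a = 1)
    {w : Fin n → Fin k → ℝ} (hw : ∀ i a, 0 ≤ w i a) (hw1 : ∀ i, ∑ a, w i a = 1 / n)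
    (hw2 : ∀ a, ∑ i, w i a = p a) {o : ℝ}
    (ho : ∑ i, ∑ j, ∑ a, ∑ b, w i a * w j b * (H i j - B a b) ^ 2 ≤ o) :
    ∃ σ : Fin n → Fin k, (∀ a, ⌊(n : ℝ) * κ⌋₊ ≤ (partClass σ a).card) ∧
      weightedNorm (fun _ => 1 / (n : ℝ)) (fun i j => H i j - B (σ i) (σ j)) ≤
        Real.sqrt (o + η * weightedNorm p B ^ 2 + 32 * K * η * weightedNorm p B ^ 2) +
        Real.sqrt ((o + η * weightedNorm p B ^ 2) / K + 32 * η * weightedNorm p B ^ 2) := by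
  have hn' : (0 : ℝ) < n := Nat.cast_pos.2 hn
  have hp0 : ∀ a, 0 < p a := fun a => hκ.trans_le (hp a)
  have hηn : ∀ a, 1 / (n : ℝ) ≤ η ^ 2 * p a := fun a => by
    calc 1 / (n : ℝ) = 1 / (n * κ) * κ := by field_simp
      _ ≤ η ^ 2 * p a := mul_le_mul hηκ (hp a) hκ.le (by positivity)
  have hη2 : η ^ 2 ≤ η := by nlinarith
  have hb0 : 0 ≤ weightedNorm p B ^ 2 := sq_nonneg _
  -- The conditional law of the block given the point `i` in the coupling. Labels are drawn
  -- independently from these laws.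
  set q : Fin n → Fin k → ℝ := fun i a => n * w i a
  have hq : ∀ i a, 0 ≤ q i a := fun i a => mul_nonneg hn'.le (hw i a)
  have hq1 : ∀ i, ∑ a, q i a = 1 := fun i => by
    simp only [q, ← Finset.mul_sum, hw1]; field_simp
  have hq2 : ∀ a, ∑ i, q i a = n * p a := fun a => by simp only [q, ← Finset.mul_sum, hw2]
  set ph : (Fin n → Fin k) → Fin k → ℝ := fun l a => ∑ i, if l i = a then 1 / (n : ℝ) else 0
  set y : (Fin n → Fin k) → Fin k → ℝ := fun l a => (ph l a - p a) ^ 2 / p a ^ 2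
  set obj : (Fin n → Fin k) → ℝ := fun l =>
    ∑ i, ∑ j, 1 / (n : ℝ) * (1 / (n : ℝ)) * (H i j - B (l i) (l j)) ^ 2
  have hobj : ∀ l, 0 ≤ obj l := fun l => Finset.sum_nonneg fun i _ => Finset.sum_nonneg
    fun j _ => by positivity
  -- The empirical weight of class `a` has mean `p a` and variance at most `p a / n`, so its squared
  -- relative error has mean at most `1 / (n * p a) ≤ η²`.
  have Ey : ∀ a, labelExp q (fun l => y l a) ≤ η ^ 2 := by
    intro a
    have e : ∀ l : Fin n → Fin k, y l a = 1 / ((n : ℝ) ^ 2 * p a ^ 2) *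
        (∑ i, ((if l i = a then 1 else 0) - q i a)) ^ 2 := fun l => by
      simp only [y, ph]
      rw [Finset.sum_sub_distrib, hq2]
      have : (∑ i, if l i = a then 1 / (n : ℝ) else 0) =
          1 / (n : ℝ) * ∑ i, if l i = a then 1 else 0 := by
        rw [Finset.mul_sum]; simp
      rw [this]
      have := (hp0 a).ne'
      field_simp
    simp only [e]
    rw [labelExp_const_mul]
    calc _ ≤ 1 / ((n : ℝ) ^ 2 * p a ^ 2) * ∑ i, q i a :=
          mul_le_mul_of_nonneg_left (labelExp_sq_sum_le hq1 a) (by positivity)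
      _ = (1 / n) / p a := by
          rw [hq2]; have := (hp0 a).ne'; field_simp
      _ ≤ η ^ 2 := by rw [div_le_iff₀ (hp0 a)]; exact hηn a
  have Ecost : labelExp q (fun l => affineCost η p B (y l)) ≤ 32 * η * weightedNorm p B ^ 2 := by
    have : labelExp q (fun l => affineCost η p B (y l)) =
        affineCost η p B fun a => labelExp q fun l => y l a := by
      simp only [affineCost]
      rw [labelExp_sum]
      refine Finset.sum_congr rfl fun a _ => ?_
      rw [labelExp_sum]
      refine Finset.sum_congr rfl fun b _ => ?_
      rw [labelExp_const_mul, labelExp_add, labelExp_add, labelExp_const_mul,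
        labelExp_const hq1]
    rw [this]
    exact affineCost_le hη hη1 (fun a => (hp0 a).le) B Ey
  -- For `i ≠ j` independence reproduces the cost of the coupling exactly. On the diagonal both
  -- labels coincide; there `H` vanishes and the extra terms `B a a ^ 2 / n` in the mean are
  -- absorbed by `η ‖B‖²`.
  have Eobj : labelExp q obj ≤ o + η * weightedNorm p B ^ 2 := by
    have h1 : ∀ i j, labelExp q (fun l => 1 / (n : ℝ) * (1 / (n : ℝ)) *
        (H i j - B (l i) (l j)) ^ 2) ≤ ∑ a, ∑ b, w i a * w j b * (H i j - B a b) ^ 2 +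
          if j = i then 1 / (n : ℝ) * ∑ a, w i a * B a a ^ 2 else 0 := by
      intro i j
      rw [labelExp_const_mul]
      by_cases hij : j = i
      · subst hij
        rw [labelExp_apply hq1 j fun a => (H j j - B a a) ^ 2, hH]
        have h0 : 0 ≤ ∑ a, ∑ b, w j a * w j b * (0 - B a b) ^ 2 :=
          Finset.sum_nonneg fun a _ => Finset.sum_nonneg fun b _ => by
            have := hw j a; have := hw j b; positivity
        have h2 : 1 / (n : ℝ) * (1 / (n : ℝ)) * ∑ a, q j a * (0 - B a a) ^ 2 =
            1 / (n : ℝ) * ∑ a, w j a * B a a ^ 2 := by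
          rw [mul_assoc, Finset.mul_sum]
          congr 1
          refine Finset.sum_congr rfl fun a _ => ?_
          simp only [q]; field_simp; ring
        rw [if_pos rfl, h2]
        linarith
      · rw [labelExp_apply₂ hq1 (Ne.symm hij) fun a b => (H i j - B a b) ^ 2, if_neg hij, add_zero,
          Finset.mul_sum]
        refine le_of_eq (Finset.sum_congr rfl fun a _ => ?_)
        rw [Finset.mul_sum]
        refine Finset.sum_congr rfl fun b _ => ?_
        simp only [q]; field_simp
    have h2 : labelExp q obj ≤ ∑ i, ∑ j, (∑ a, ∑ b, w i a * w j b * (H i j - B a b) ^ 2 +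
          if j = i then 1 / (n : ℝ) * ∑ a, w i a * B a a ^ 2 else 0) := by
      simp only [obj]
      rw [labelExp_sum]
      refine Finset.sum_le_sum fun i _ => ?_
      rw [labelExp_sum]
      exact Finset.sum_le_sum fun j _ => h1 i j
    refine h2.trans ?_
    simp only [Finset.sum_add_distrib, Finset.sum_ite_eq', Finset.mem_univ, if_true]
    refine add_le_add ho ?_
    rw [← Finset.mul_sum, Finset.sum_comm]
    simp only [← Finset.sum_mul, hw2]
    refine (sum_diag_le_weightedNorm (fun a => (hp0 a).le) B (sq_nonneg η) hηn).trans ?_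
    exact mul_le_mul_of_nonneg_right hη2 hb0
  -- One labelling must be good for both errors at once, so their combination with weight `K` is
  -- averaged. The parameter `K` shifts error from one square root of the conclusion to the other.
  obtain ⟨l, hl⟩ := exists_le_labelExp hq hq1 fun l => obj l + K * affineCost η p B (y l)
  rw [labelExp_add, labelExp_const_mul] at hl
  have hl2 : obj l + K * affineCost η p B (y l) ≤ (o + η * weightedNorm p B ^ 2) +
      K * (32 * η * weightedNorm p B ^ 2) :=
    hl.trans (add_le_add Eobj (mul_le_mul_of_nonneg_left Ecost hK.le))
  obtain ⟨c, hc, hc2⟩ := exists_nat_rounding (Finset.univ : Finset (Fin k))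
    (p := fun a => n * p a) fun a => mul_nonneg hn'.le (hp0 a).le
  rw [← Finset.mul_sum, hp1, mul_one, Nat.floor_natCast] at hc
  obtain ⟨σ, hσ, hσ2⟩ := exists_relabelling l hc
  have hcard : ∀ (τ : Fin n → Fin k) a, (∑ i, if τ i = a then 1 / (n : ℝ) else 0) =
      ((partClass τ a).card : ℝ) / n := fun τ a => by
    rw [card_partClass, ← Finset.sum_filter, Finset.sum_const, nsmul_eq_mul]; ring
  -- The correction of the class sizes moves `l` to `σ`; the rounded sizes are within `1/n`, hence
  -- within a relative error `η`, of the weights `p`.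
  have hR : ∑ i, ∑ j, 1 / (n : ℝ) * (1 / (n : ℝ)) * (B (l i) (l j) - B (σ i) (σ j)) ^ 2 ≤
      affineCost η p B (y l) := by
    have hdiv : ∀ a, |((partClass l a).card : ℝ) - c a| / n =
        |((partClass l a).card : ℝ) / n - c a / n| := fun a => by
      rw [← sub_div, abs_div, abs_of_pos hn']
    refine (sum_sq_relabel_le_transportCost (p := ph l) (p' := fun a => (c a : ℝ) / n)
      (fun _ => by positivity) hB (fun a => rfl)
      (fun a => by rw [hcard, hσ]) (fun a => ?_) fun a => ?_).trans ?_
    · simp only [ph]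
      rw [hcard, ← hdiv, ← Finset.sum_filter, ← Finset.sum_filter, Finset.filter_filter,
        Finset.sum_const, nsmul_eq_mul, mul_one_div]
      exact div_le_div_of_nonneg_right (hσ2 a).1 hn'.le
    · simp only [ph]
      rw [hcard, ← hdiv, ← Finset.sum_filter, ← Finset.sum_filter, Finset.filter_filter,
        Finset.sum_const, nsmul_eq_mul, mul_one_div]
      exact div_le_div_of_nonneg_right (hσ2 a).2 hn'.le
    · refine transportCost_le_affineCost hη hη1 hp0 (fun a => ?_) B
      have h1 := Nat.floor_le (mul_nonneg hn'.le (hp0 a).le)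
      have h2 := Nat.lt_floor_add_one ((n : ℝ) * p a)
      have h3 : (⌊(n : ℝ) * p a⌋₊ : ℝ) ≤ c a := by exact_mod_cast (hc2 a).1
      have h4 : (c a : ℝ) ≤ ⌊(n : ℝ) * p a⌋₊ + 1 := by exact_mod_cast (hc2 a).2
      have h5 : (c a : ℝ) / n - p a = (c a - n * p a) / n := by field_simp
      rw [h5, abs_div, abs_of_pos hn']
      calc _ ≤ 1 / (n : ℝ) := by
            refine div_le_div_of_nonneg_right (abs_le.2 ⟨by linarith, by linarith⟩) hn'.le
        _ ≤ η ^ 2 * p a := hηn a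
        _ ≤ η * p a := mul_le_mul_of_nonneg_right hη2 (hp0 a).le
  have hA0 : 0 ≤ affineCost η p B (y l) :=
    affineCost_nonneg hη (fun a => (hp0 a).le) B fun a => by simp only [y]; positivity
  refine ⟨σ, fun a => ?_, ?_⟩
  · rw [hσ]
    exact (Nat.floor_mono (mul_le_mul_of_nonneg_left (hp a) hn'.le)).trans (hc2 a).1
  · have htri := weightedNorm_add_le (w := fun _ : Fin n => 1 / (n : ℝ)) (fun _ => by positivity)
      (fun i j => H i j - B (l i) (l j)) (fun i j => B (l i) (l j) - B (σ i) (σ j))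
    simp only [sub_add_sub_cancel] at htri
    refine htri.trans (add_le_add (Real.sqrt_le_sqrt ?_) (Real.sqrt_le_sqrt ?_))
    · have := mul_nonneg hK.le hA0
      calc _ = obj l := rfl
        _ ≤ _ := by linarith
    · refine hR.trans ?_
      have := hobj l
      rw [div_add' _ _ _ hK.ne', le_div_iff₀ hK]
      linarith

end rounding

/-! ## Deterministic analysis of the least squares algorithm -/

section leastSquares

variable {n k : ℕ}

/-- The sum of the entries of `A` in the block `(a, b)`. -/
noncomputable def blockSum (A : Matrix (Fin n) (Fin n) ℝ) (σ : Fin n → Fin k) (a b : Fin k) : ℝ :=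
  ∑ u ∈ partClass σ a, ∑ v ∈ partClass σ b, A u v

/-- The average of the entries of `A` in the block `(a, b)`. -/
noncomputable def blockAvg (A : Matrix (Fin n) (Fin n) ℝ) (σ : Fin n → Fin k) (a b : Fin k) : ℝ :=
  blockSum A σ a b / ((partClass σ a).card * (partClass σ b).card)

lemma sum_mul_block (A : Matrix (Fin n) (Fin n) ℝ) (σ : Fin n → Fin k) (C : Fin k → Fin k → ℝ) :
    ∑ u, ∑ v, A u v * C (σ u) (σ v) = ∑ a, ∑ b, blockSum A σ a b * C a b := by
  have h1 : ∀ a b, blockSum A σ a b * C a b =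
      ∑ u ∈ partClass σ a, ∑ v ∈ partClass σ b, A u v * C (σ u) (σ v) := by
    intro a b
    rw [blockSum, Finset.sum_mul]
    refine Finset.sum_congr rfl fun u hu => ?_
    rw [Finset.sum_mul]
    refine Finset.sum_congr rfl fun v hv => ?_
    rw [(Finset.mem_filter.1 hu).2, (Finset.mem_filter.1 hv).2]
  simp only [h1]
  have h2 : ∀ a, ∑ b, ∑ u ∈ partClass σ a, ∑ v ∈ partClass σ b, A u v * C (σ u) (σ v) =
      ∑ u ∈ partClass σ a, ∑ v, A u v * C (σ u) (σ v) := by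
    intro a
    rw [Finset.sum_comm]
    refine Finset.sum_congr rfl fun u _ => ?_
    exact Finset.sum_fiberwise Finset.univ σ fun v => A u v * C (σ u) (σ v)
  simp only [h2]
  exact (Finset.sum_fiberwise Finset.univ σ fun u => ∑ v, A u v * C (σ u) (σ v)).symm

lemma blockSum_blockAvg (A : Matrix (Fin n) (Fin n) ℝ) (σ : Fin n → Fin k) (a b : Fin k) :
    blockSum (fun u v => blockAvg A σ (σ u) (σ v)) σ a b = blockSum A σ a b := by
  have : blockSum (fun u v => blockAvg A σ (σ u) (σ v)) σ a b =
      (partClass σ a).card * (partClass σ b).card * blockAvg A σ a b := by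
    have h1 : blockSum (fun u v => blockAvg A σ (σ u) (σ v)) σ a b =
        ∑ u ∈ partClass σ a, ∑ v ∈ partClass σ b, blockAvg A σ a b :=
      Finset.sum_congr rfl fun u hu => Finset.sum_congr rfl fun v hv => by
        beta_reduce
        rw [(Finset.mem_filter.1 hu).2, (Finset.mem_filter.1 hv).2]
    rw [h1]
    simp only [Finset.sum_const, nsmul_eq_mul]
    ring
  rw [this, blockAvg]
  rcases (partClass σ a).eq_empty_or_nonempty with h | h
  · simp [blockSum, h]
  rcases (partClass σ b).eq_empty_or_nonempty with h' | h'
  · simp [blockSum, h']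
  have h1 := Finset.card_pos.2 h
  have h2 := Finset.card_pos.2 h'
  field_simp

/-- Pythagoras: subtracting the block averages is the orthogonal projection off the matrices
constant on the blocks of `σ`. -/
lemma sum_sq_sub_block (A : Matrix (Fin n) (Fin n) ℝ) (σ : Fin n → Fin k)
    (B : Fin k → Fin k → ℝ) :
    ∑ u, ∑ v, (A u v - B (σ u) (σ v)) ^ 2 =
      ∑ u, ∑ v, (A u v - blockAvg A σ (σ u) (σ v)) ^ 2 +
      ∑ u, ∑ v, (blockAvg A σ (σ u) (σ v) - B (σ u) (σ v)) ^ 2 := by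
  have h1 := sum_mul_block A σ fun a b => blockAvg A σ a b - B a b
  have h2 := sum_mul_block (fun u v => blockAvg A σ (σ u) (σ v)) σ
    fun a b => blockAvg A σ a b - B a b
  simp only [blockSum_blockAvg] at h2
  rw [← h1] at h2
  rw [← sub_eq_zero]
  have h3 : ∑ u, ∑ v, ((A u v - B (σ u) (σ v)) ^ 2 - ((A u v - blockAvg A σ (σ u) (σ v)) ^ 2 +
      (blockAvg A σ (σ u) (σ v) - B (σ u) (σ v)) ^ 2)) =
      2 * (∑ u, ∑ v, A u v * (blockAvg A σ (σ u) (σ v) - B (σ u) (σ v)) -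
      ∑ u, ∑ v, blockAvg A σ (σ u) (σ v) * (blockAvg A σ (σ u) (σ v) - B (σ u) (σ v))) := by
    simp only [← Finset.sum_sub_distrib, Finset.mul_sum]
    refine Finset.sum_congr rfl fun u _ => Finset.sum_congr rfl fun v _ => by ring
  rw [h2, sub_self, mul_zero] at h3
  simpa only [Finset.sum_sub_distrib, Finset.sum_add_distrib] using h3

lemma matrixNorm2_sq (A : Matrix (Fin n) (Fin n) ℝ) :
    matrixNorm2 A ^ 2 = 1 / (n : ℝ) ^ 2 * ∑ u, ∑ v, A u v ^ 2 := by
  rw [matrixNorm2, Real.sq_sqrt]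
  · simp only [sq_abs]
  · exact mul_nonneg (by positivity) (Finset.sum_nonneg fun i _ => Finset.sum_nonneg
      fun j _ => by positivity)

lemma matrixNorm2_nonneg (A : Matrix (Fin n) (Fin n) ℝ) : 0 ≤ matrixNorm2 A := Real.sqrt_nonneg _

/-- By the orthogonal decomposition any other value on a nonempty block would cost more. Entries of
`B` that belong to empty classes are not determined, hence the evaluation at `σ u`, `σ v`. -/
lemma eq_blockAvg_of_forall_le (hn : 0 < n) {A : Matrix (Fin n) (Fin n) ℝ} {σ : Fin n → Fin k}
    {B : Matrix (Fin k) (Fin k) ℝ}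
    (h : ∀ B' : Matrix (Fin k) (Fin k) ℝ,
      matrixNorm2 (A - B.submatrix σ σ) ≤ matrixNorm2 (A - B'.submatrix σ σ)) (u v : Fin n) :
    B (σ u) (σ v) = blockAvg A σ (σ u) (σ v) := by
  have h1 := pow_le_pow_left₀ (matrixNorm2_nonneg _) (h (blockAvg A σ)) 2
  have hn' : (0 : ℝ) < n := Nat.cast_pos.2 hn
  rw [matrixNorm2_sq, matrixNorm2_sq] at h1
  have h2 : ∑ u, ∑ v, (A u v - B (σ u) (σ v)) ^ 2 ≤
      ∑ u, ∑ v, (A u v - blockAvg A σ (σ u) (σ v)) ^ 2 :=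
    le_of_mul_le_mul_left h1 (by positivity)
  rw [sum_sq_sub_block A σ B] at h2
  have h3 : ∑ u, ∑ v, (blockAvg A σ (σ u) (σ v) - B (σ u) (σ v)) ^ 2 = 0 :=
    le_antisymm (by linarith) (Finset.sum_nonneg fun i _ => Finset.sum_nonneg
      fun j _ => by positivity)
  have h4 := (Finset.sum_eq_zero_iff_of_nonneg fun i _ => Finset.sum_nonneg
    fun j _ => by positivity).1 h3 u (Finset.mem_univ _)
  have h5 := (Finset.sum_eq_zero_iff_of_nonneg fun j _ => by positivity).1 h4 v
    (Finset.mem_univ _)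
  exact (sub_eq_zero.1 (pow_eq_zero_iff two_ne_zero |>.1 h5)).symm

lemma blockAvg_comm {A : Matrix (Fin n) (Fin n) ℝ} (hA : ∀ u v, A u v = A v u) (σ : Fin n → Fin k)
    (a b : Fin k) : blockAvg A σ a b = blockAvg A σ b a := by
  have h : blockSum A σ a b = blockSum A σ b a :=
    Finset.sum_comm.trans (Finset.sum_congr rfl fun u _ => Finset.sum_congr rfl fun v _ => hA _ _)
  rw [blockAvg, blockAvg, h, mul_comm]

lemma blockAvg_nonneg {A : Matrix (Fin n) (Fin n) ℝ} (hA : ∀ u v, 0 ≤ A u v) (σ : Fin n → Fin k)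
    (a b : Fin k) : 0 ≤ blockAvg A σ a b :=
  div_nonneg (Finset.sum_nonneg fun u _ => Finset.sum_nonneg fun v _ => hA u v) (by positivity)

/-- `A` and `Q` are `Δ`-close when tested against all block matrices with entries in `[-1, 1]`. -/
def BlockClose (k : ℕ) (A Q : Matrix (Fin n) (Fin n) ℝ) (Δ : ℝ) : Prop :=
  ∀ (σ : Fin n → Fin k) (s : Fin k → Fin k → ℝ), (∀ a b, |s a b| ≤ 1) →
    ∑ u, ∑ v, (A u v - Q u v) * s (σ u) (σ v) ≤ (n : ℝ) ^ 2 * Δ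

/-- The test is linear in the entries of `s`, so for a fixed labelling it is largest at a sign
matrix, given by the signs of the block sums. This leaves finitely many tests for the union bound.
-/
lemma BlockClose.of_signs {A Q : Matrix (Fin n) (Fin n) ℝ} {Δ : ℝ}
    (h : ∀ (σ : Fin n → Fin k) (s : Fin k → Fin k → Bool),
      ∑ u, ∑ v, (A u v - Q u v) * (if s (σ u) (σ v) then 1 else -1) ≤ (n : ℝ) ^ 2 * Δ) :
    BlockClose k A Q Δ := by
  intro σ s hs
  have h1 := h σ fun a b => decide (0 ≤ blockSum (A - Q) σ a b)
  refine le_trans ?_ h1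
  have h2 := sum_mul_block (A - Q) σ s
  have h3 := sum_mul_block (A - Q) σ
    fun a b => if decide (0 ≤ blockSum (A - Q) σ a b) = true then 1 else -1
  simp only [Matrix.sub_apply] at h2 h3
  rw [h2, h3]
  refine Finset.sum_le_sum fun a _ => Finset.sum_le_sum fun b _ => ?_
  have := abs_le.1 (hs a b)
  by_cases h0 : 0 ≤ blockSum (A - Q) σ a b
  · rw [if_pos (decide_eq_true h0)]
    nlinarith
  · rw [if_neg (by simpa using h0)]
    nlinarith

lemma BlockClose.nonneg {A Q : Matrix (Fin n) (Fin n) ℝ} {Δ : ℝ} (hn : 0 < n) (hk : 0 < k)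
    (h : BlockClose k A Q Δ) : 0 ≤ Δ := by
  have := h (fun _ => ⟨0, hk⟩) (fun _ _ => 0) (by simp)
  simp only [mul_zero, Finset.sum_const_zero] at this
  have hn' : (0 : ℝ) < n := Nat.cast_pos.2 hn
  exact nonneg_of_mul_nonneg_right this (by positivity)

/-- Scale by `c` and test with both signs. Entries of `C` that the labelling does not reach may be
large, and are replaced by `0`. -/
lemma BlockClose.abs_sum_le {A Q : Matrix (Fin n) (Fin n) ℝ} {Δ : ℝ} (h : BlockClose k A Q Δ)
    (σ : Fin n → Fin k) {C : Fin k → Fin k → ℝ} {c : ℝ} (hc : 0 < c)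
    (hC : ∀ u v, |C (σ u) (σ v)| ≤ c) :
    |∑ u, ∑ v, (A u v - Q u v) * C (σ u) (σ v)| ≤ (n : ℝ) ^ 2 * (c * Δ) := by
  set s : Fin k → Fin k → ℝ := fun a b => if |C a b| ≤ c then C a b / c else 0
  have hs : ∀ a b, |s a b| ≤ 1 := by
    intro a b
    simp only [s]
    split_ifs with h
    · rw [abs_div, abs_of_pos hc]
      exact (div_le_one hc).2 h
    · simp
  have e : ∑ u, ∑ v, (A u v - Q u v) * C (σ u) (σ v) =
      c * ∑ u, ∑ v, (A u v - Q u v) * s (σ u) (σ v) := by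
    simp only [Finset.mul_sum]
    refine Finset.sum_congr rfl fun u _ => Finset.sum_congr rfl fun v _ => ?_
    simp only [s, if_pos (hC u v)]
    field_simp
  have h1 := h σ s hs
  have h2 := h σ (fun a b => - s a b) (by simpa using hs)
  simp only [mul_neg, Finset.sum_neg_distrib] at h2
  rw [e, abs_mul, abs_of_pos hc]
  calc _ ≤ c * ((n : ℝ) ^ 2 * Δ) :=
        mul_le_mul_of_nonneg_left (abs_le.2 ⟨by linarith, h1⟩) hc.le
    _ = _ := by ring

lemma abs_blockSum_le (Q : Matrix (Fin n) (Fin n) ℝ) (σ : Fin n → Fin k) (a b : Fin k) :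
    |blockSum Q σ a b| ≤
      Real.sqrt ((partClass σ a).card * (partClass σ b).card) * (n * matrixNorm2 Q) := by
  have h1 : blockSum Q σ a b ^ 2 ≤ ((partClass σ a).card * (partClass σ b).card : ℕ) *
      ∑ u, ∑ v, Q u v ^ 2 := by
    have e1 : blockSum Q σ a b = ∑ z ∈ partClass σ a ×ˢ partClass σ b, Q z.1 z.2 :=
      (Finset.sum_product _ _ fun z : Fin n × Fin n => Q z.1 z.2).symm
    have e2 : ∑ u, ∑ v, Q u v ^ 2 = ∑ z ∈ Finset.univ ×ˢ Finset.univ, Q z.1 z.2 ^ 2 :=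
      (Finset.sum_product _ _ fun z : Fin n × Fin n => Q z.1 z.2 ^ 2).symm
    rw [e1, e2, ← Finset.card_product]
    refine (sq_sum_le_card_mul_sum_sq).trans ?_
    gcongr
    · exact Finset.subset_univ _
    · exact Finset.subset_univ _
  have h2 : ∑ u, ∑ v, Q u v ^ 2 ≤ (n * matrixNorm2 Q) ^ 2 := by
    rw [mul_pow, matrixNorm2_sq, ← mul_assoc]
    rcases Nat.eq_zero_or_pos n with rfl | hn
    · simp
    · have hn' : (0 : ℝ) < n := Nat.cast_pos.2 hn
      refine le_of_eq ?_
      field_simp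
  refine abs_le_of_sq_le_sq ?_ (mul_nonneg (Real.sqrt_nonneg _)
    (mul_nonneg (Nat.cast_nonneg _) (matrixNorm2_nonneg _)))
  rw [mul_pow, Real.sq_sqrt (by positivity)]
  refine h1.trans ?_
  push_cast
  gcongr

/-- Split the block sum of `A` into that of `Q`, bounded by Cauchy–Schwarz, and that of `A - Q`,
bounded by testing against the indicator of the block; then divide by the block area, which is at
least `m²`. -/
lemma abs_blockAvg_le {A Q : Matrix (Fin n) (Fin n) ℝ} {Δ : ℝ} (h : BlockClose k A Q Δ)
    {σ : Fin n → Fin k} {a b : Fin k} {m : ℕ} (hm : 0 < m) (ha : m ≤ (partClass σ a).card)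
    (hb : m ≤ (partClass σ b).card) :
    |blockAvg A σ a b| ≤ n / m * matrixNorm2 Q + (n / m : ℝ) ^ 2 * Δ := by
  have hm' : (0 : ℝ) < m := Nat.cast_pos.2 hm
  have ha' : (m : ℝ) ≤ (partClass σ a).card := Nat.cast_le.2 ha
  have hb' : (m : ℝ) ≤ (partClass σ b).card := Nat.cast_le.2 hb
  set x : ℝ := ((partClass σ a).card : ℝ)
  set y : ℝ := ((partClass σ b).card : ℝ)
  have hx : 0 < x := hm'.trans_le ha'
  have hy : 0 < y := hm'.trans_le hb'
  have hmxy : (m : ℝ) ^ 2 ≤ x * y := by nlinarith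
  have h1 : |blockSum (A - Q) σ a b| ≤ (n : ℝ) ^ 2 * Δ := by
    have h2 := sum_mul_block (A - Q) σ fun c d => if c = a then if d = b then 1 else 0 else 0
    have h3 := h.abs_sum_le σ (C := fun c d => if c = a then if d = b then 1 else 0 else 0)
      one_pos fun u v => by split_ifs <;> simp
    simp only [Matrix.sub_apply] at h2
    rw [h2] at h3
    simpa using h3
  have h4 : blockSum A σ a b = blockSum Q σ a b + blockSum (A - Q) σ a b := by
    simp [blockSum, Finset.sum_sub_distrib]
  have hxy : 0 < x * y := mul_pos hx hy
  rw [blockAvg, abs_div, abs_of_pos hxy, h4]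
  have h5 : |blockSum Q σ a b + blockSum (A - Q) σ a b| / (x * y) ≤
      (Real.sqrt (x * y) * (n * matrixNorm2 Q)) / (x * y) + (n : ℝ) ^ 2 * Δ / (x * y) := by
    rw [← add_div]
    exact div_le_div_of_nonneg_right
      ((abs_add_le _ _).trans (add_le_add (abs_blockSum_le Q σ a b) h1)) hxy.le
  refine h5.trans (add_le_add ?_ ?_)
  · have hs : (m : ℝ) ≤ Real.sqrt (x * y) := Real.le_sqrt_of_sq_le hmxy
    have e : Real.sqrt (x * y) * (n * matrixNorm2 Q) / (x * y) =
        n * matrixNorm2 Q / Real.sqrt (x * y) := by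
      have h0 : 0 < Real.sqrt (x * y) := hm'.trans_le hs
      rw [div_eq_div_iff hxy.ne' h0.ne']
      have := Real.mul_self_sqrt hxy.le
      calc _ = n * matrixNorm2 Q * (Real.sqrt (x * y) * Real.sqrt (x * y)) := by ring
        _ = _ := by rw [this]
    rw [e, div_mul_eq_mul_div]
    exact div_le_div_of_nonneg_left (mul_nonneg (Nat.cast_nonneg _) (matrixNorm2_nonneg _)) hm' hs
  · rw [div_pow, div_mul_eq_mul_div]
    exact div_le_div_of_nonneg_left ((abs_nonneg _).trans h1) (by positivity) hmxy

/-- A near minimizer of the distance to `A` is a near minimizer of the distance to `Q`. -/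
lemma matrixNorm2_compare (hn : 0 < n) {A Q : Matrix (Fin n) (Fin n) ℝ} {Δ : ℝ}
    (h : BlockClose k A Q Δ) {σ σ' : Fin n → Fin k} {B B' : Matrix (Fin k) (Fin k) ℝ} {c c' : ℝ}
    (hc : 0 < c) (hc' : 0 < c') (hB : ∀ u v, |B (σ u) (σ v)| ≤ c)
    (hB' : ∀ u v, |B' (σ' u) (σ' v)| ≤ c')
    (hle : matrixNorm2 (A - B.submatrix σ σ) ≤ matrixNorm2 (A - B'.submatrix σ' σ')) :
    matrixNorm2 (Q - B.submatrix σ σ) ≤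
      matrixNorm2 (Q - B'.submatrix σ' σ') + Real.sqrt (2 * (c + c') * Δ) := by
  have hn' : (0 : ℝ) < n := Nat.cast_pos.2 hn
  have h0 : 0 ≤ Δ := h.nonneg hn (Fin.pos (σ ⟨0, hn⟩))
  have h1 := pow_le_pow_left₀ (matrixNorm2_nonneg _) hle 2
  -- Expanding the squares, the difference of the two squared distances depends on the block matrix
  -- only through its inner product with `A - Q`.
  have key : ∀ (τ : Fin n → Fin k) (C : Matrix (Fin k) (Fin k) ℝ),
      matrixNorm2 (A - C.submatrix τ τ) ^ 2 - matrixNorm2 (Q - C.submatrix τ τ) ^ 2 =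
      1 / (n : ℝ) ^ 2 * ∑ u, ∑ v, (A u v ^ 2 - Q u v ^ 2) -
      2 * (1 / (n : ℝ) ^ 2 * ∑ u, ∑ v, (A u v - Q u v) * C (τ u) (τ v)) := by
    intro τ C
    rw [matrixNorm2_sq, matrixNorm2_sq, ← mul_sub, mul_left_comm (2 : ℝ), ← mul_sub]
    congr 1
    simp only [Finset.mul_sum, ← Finset.sum_sub_distrib, Matrix.sub_apply, Matrix.submatrix_apply]
    exact Finset.sum_congr rfl fun u _ => Finset.sum_congr rfl fun v _ => by ring
  have e1 := key σ B
  have e2 := key σ' B'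
  have b1 := (abs_le.1 (h.abs_sum_le σ (C := B) hc hB)).2
  have b2 := (abs_le.1 (h.abs_sum_le σ' (C := B') hc' hB')).1
  have hn2 : (0 : ℝ) < 1 / (n : ℝ) ^ 2 := by positivity
  have b1' := mul_le_mul_of_nonneg_left b1 hn2.le
  have b2' := mul_le_mul_of_nonneg_left b2 hn2.le
  have s1 : 1 / (n : ℝ) ^ 2 * ((n : ℝ) ^ 2 * (c * Δ)) = c * Δ := by field_simp
  have s2 : 1 / (n : ℝ) ^ 2 * -((n : ℝ) ^ 2 * (c' * Δ)) = -(c' * Δ) := by field_simp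
  rw [s1] at b1'
  rw [s2] at b2'
  have hfin : matrixNorm2 (Q - B.submatrix σ σ) ^ 2 ≤
      matrixNorm2 (Q - B'.submatrix σ' σ') ^ 2 + 2 * (c + c') * Δ := by nlinarith
  refine abs_le_of_sq_le_sq' ?_ (add_nonneg (matrixNorm2_nonneg _) (Real.sqrt_nonneg _)) |>.2
  have := Real.sq_sqrt (show 0 ≤ 2 * (c + c') * Δ by positivity)
  nlinarith [mul_nonneg (matrixNorm2_nonneg (Q - B'.submatrix σ' σ'))
    (Real.sqrt_nonneg (2 * (c + c') * Δ))]

end leastSquares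

/-! ## Concentration of the adjacency matrix -/

section concentration

variable {n k : ℕ}

lemma prod_Ioi_eq_prod_subtype (h : Fin n → Fin n → ℝ) :
    ∏ i, ∏ j ∈ Finset.Ioi i, h i j = ∏ p : {p : Fin n × Fin n // p.1 < p.2}, h p.1.1 p.1.2 := by
  rw [← Finset.prod_subtype (Finset.univ.filter fun p : Fin n × Fin n => p.1 < p.2) (by simp)
    fun p => h p.1 p.2, Finset.prod_filter, Fintype.prod_prod_type]
  refine Finset.prod_congr rfl fun i _ => ?_
  rw [← Finset.prod_filter]
  congr 1
  ext j
  simp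

lemma sum_eq_sum_Ioi (M : Fin n → Fin n → ℝ) (hM : ∀ u v, M u v = M v u) (h0 : ∀ u, M u u = 0)
    (s : Fin n → Fin n → ℝ) :
    ∑ u, ∑ v, M u v * s u v = ∑ u, ∑ v ∈ Finset.Ioi u, M u v * (s u v + s v u) := by
  have e : ∀ (f : Fin n → Fin n → ℝ), ∑ u, ∑ v ∈ Finset.Ioi u, f u v =
      ∑ u, ∑ v, if u < v then f u v else 0 := fun f => by
    refine Finset.sum_congr rfl fun u _ => ?_
    rw [← Finset.sum_filter]
    congr 1
    ext v
    simp
  simp only [mul_add, Finset.sum_add_distrib]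
  rw [e, e, Finset.sum_comm (f := fun u v => if u < v then M u v * s v u else 0),
    ← Finset.sum_add_distrib]
  refine Finset.sum_congr rfl fun u _ => ?_
  rw [← Finset.sum_add_distrib]
  refine Finset.sum_congr rfl fun v _ => ?_
  rcases lt_trichotomy u v with h | h | h
  · simp [h, not_lt.2 h.le]
  · subst h; simp [h0]
  · simp [h, not_lt.2 h.le, hM u v]

/-- Uses `exp x - 1 ≤ x + x²` for `|x| ≤ 1` and `1 + t ≤ exp t`. The exponent carries the factor
`q`, which preserves the sparsity of the graph in the deviation bound. -/
lemma bernoulli_exp_le {q x : ℝ} (h0 : 0 ≤ q) (hx : |x| ≤ 1) :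
    q * Real.exp (x * (1 - q)) + (1 - q) * Real.exp (x * (0 - q)) ≤ Real.exp (q * x ^ 2) := by
  have e1 : Real.exp (x * (1 - q)) = Real.exp (x * (0 - q)) * Real.exp x := by
    rw [← Real.exp_add]; congr 1; ring
  have h1 : Real.exp x - 1 ≤ x + x ^ 2 := by
    have := (abs_le.1 (Real.abs_exp_sub_one_sub_id_le hx)).2
    linarith
  have h2 : 1 + q * (Real.exp x - 1) ≤ Real.exp (q * (x + x ^ 2)) := by
    have := Real.add_one_le_exp (q * (x + x ^ 2))
    have := mul_le_mul_of_nonneg_left h1 h0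
    linarith
  calc _ = Real.exp (x * (0 - q)) * (1 + q * (Real.exp x - 1)) := by rw [e1]; ring
    _ ≤ Real.exp (x * (0 - q)) * Real.exp (q * (x + x ^ 2)) := by gcongr
    _ = _ := by rw [← Real.exp_add]; congr 1; ring

lemma graphProb_nonneg {Q : Matrix (Fin n) (Fin n) ℝ} (h0 : ∀ i j, 0 ≤ Q i j)
    (h1 : ∀ i j, Q i j ≤ 1) (g : SimpleGraph (Fin n)) : 0 ≤ graphProb Q g :=
  Finset.prod_nonneg fun i _ => Finset.prod_nonneg fun j _ => by
    have := h0 i j; have := h1 i j; split_ifs <;> linarith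

lemma sum_comp_le_sum_of_injective {α β : Type*} [Fintype α] [Fintype β] {e : α → β}
    (he : Function.Injective e) {φ : β → ℝ} (hφ : ∀ b, 0 ≤ φ b) : ∑ a, φ (e a) ≤ ∑ b, φ b := by
  have h := Finset.sum_map Finset.univ ⟨e, he⟩ φ
  simp only [Function.Embedding.coeFn_mk] at h
  rw [← h]
  exact Finset.sum_le_sum_of_subset_of_nonneg (Finset.subset_univ _) fun b _ _ => hφ b

/-- The sum over graphs is at most the sum over all Boolean functions on the pairs `u < v`, where it
factorizes into one Bernoulli factor per pair. Only injectivity of graph ↦ function is needed, as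
all terms are nonnegative. -/
lemma sum_graphProb_mul_exp_le {Q : Matrix (Fin n) (Fin n) ℝ} (h0 : ∀ i j, 0 ≤ Q i j)
    (h1 : ∀ i j, Q i j ≤ 1) {c : Fin n → Fin n → ℝ} (hc : ∀ i j, |c i j| ≤ 1) :
    ∑ g : SimpleGraph (Fin n), graphProb Q g * Real.exp (∑ u, ∑ v ∈ Finset.Ioi u,
      c u v * (g.adjMatrix ℝ u v - Q u v)) ≤
      Real.exp (∑ u, ∑ v ∈ Finset.Ioi u, Q u v * c u v ^ 2) := by
  set F : {p : Fin n × Fin n // p.1 < p.2} → Bool → ℝ := fun p b =>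
    (if b then Q p.1.1 p.1.2 else 1 - Q p.1.1 p.1.2) *
      Real.exp (c p.1.1 p.1.2 * ((if b then 1 else 0) - Q p.1.1 p.1.2))
  have hF : ∀ p b, 0 ≤ F p b := fun p b => by
    have := h0 p.1.1 p.1.2; have := h1 p.1.1 p.1.2
    refine mul_nonneg ?_ (Real.exp_pos _).le
    split_ifs <;> linarith
  set e : SimpleGraph (Fin n) → ({p : Fin n × Fin n // p.1 < p.2} → Bool) :=
    fun g p => decide (g.Adj p.1.1 p.1.2)
  have he : Function.Injective e := by
    intro g g' h
    ext u v
    have hlt : ∀ u v, u < v → (g.Adj u v ↔ g'.Adj u v) := fun u v huv => by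
      simpa [e] using congrFun h ⟨(u, v), huv⟩
    rcases lt_trichotomy u v with huv | huv | huv
    · exact hlt u v huv
    · subst huv; simp
    · rw [g.adj_comm, g'.adj_comm]; exact hlt v u huv
  have hg : ∀ g : SimpleGraph (Fin n), graphProb Q g * Real.exp (∑ u, ∑ v ∈ Finset.Ioi u,
      c u v * (g.adjMatrix ℝ u v - Q u v)) = ∏ p, F p (e g p) := by
    intro g
    simp only [F, e]
    rw [graphProb, Real.exp_sum]
    simp only [Real.exp_sum]
    rw [← Finset.prod_mul_distrib]
    simp only [← Finset.prod_mul_distrib]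
    rw [prod_Ioi_eq_prod_subtype fun i j => (if g.Adj i j then Q i j else 1 - Q i j) *
      Real.exp (c i j * (g.adjMatrix ℝ i j - Q i j))]
    refine Finset.prod_congr rfl fun p _ => ?_
    by_cases h : g.Adj p.1.1 p.1.2 <;> simp [h, SimpleGraph.adjMatrix_apply]
  rw [Finset.sum_congr rfl fun g _ => hg g]
  refine (sum_comp_le_sum_of_injective he (φ := fun f => ∏ p, F p (f p))
    fun f => Finset.prod_nonneg fun p _ => hF p _).trans ?_
  calc _ = ∏ p, ∑ b, F p b := by rw [Finset.prod_univ_sum, Fintype.piFinset_univ]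
    _ ≤ ∏ p : {p : Fin n × Fin n // p.1 < p.2},
        Real.exp (Q p.1.1 p.1.2 * c p.1.1 p.1.2 ^ 2) := by
        refine Finset.prod_le_prod (fun p _ => Finset.sum_nonneg fun b _ => hF p b) fun p _ => ?_
        have := bernoulli_exp_le (h0 p.1.1 p.1.2) (hc p.1.1 p.1.2)
        simpa [F] using this
    _ = _ := by
        rw [← prod_Ioi_eq_prod_subtype fun i j => Real.exp (Q i j * c i j ^ 2), Real.exp_sum]
        simp only [Real.exp_sum]

/-- Chernoff bound for the sum of the entries of `A - Q` against a matrix with entries in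
`[-1, 1]`. -/
lemma sum_graphProb_deviation_le {Q : Matrix (Fin n) (Fin n) ℝ} (h0 : ∀ i j, 0 ≤ Q i j)
    (h1 : ∀ i j, Q i j ≤ 1) (hs : ∀ i j, Q i j = Q j i) (hd : ∀ i, Q i i = 0)
    {s : Fin n → Fin n → ℝ} (hs1 : ∀ i j, |s i j| ≤ 1) {l t S : ℝ} (hl : 0 ≤ l)
    (hl2 : l ≤ 1 / 2) (hS : ∑ u, ∑ v, Q u v ≤ S) :
    ∑ g : SimpleGraph (Fin n), (if t < ∑ u, ∑ v, (g.adjMatrix ℝ u v - Q u v) * s u v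
      then graphProb Q g else 0) ≤ Real.exp (-(l * t) + 2 * l ^ 2 * S) := by
  -- Each edge occurs in two entries of the matrix, with total coefficient at most `2` in absolute
  -- value; this is why `l ≤ 1/2` is required.
  have hc : ∀ i j, |l * (s i j + s j i)| ≤ 1 := fun i j => by
    rw [abs_mul, abs_of_nonneg hl]
    have := (abs_add_le (s i j) (s j i)).trans (add_le_add (hs1 i j) (hs1 j i))
    have h3 := mul_le_mul hl2 this (abs_nonneg _) (by norm_num)
    linarith
  have hmain := sum_graphProb_mul_exp_le h0 h1 hc
  have hexp : ∀ g : SimpleGraph (Fin n), ∑ u, ∑ v ∈ Finset.Ioi u,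
      l * (s u v + s v u) * (g.adjMatrix ℝ u v - Q u v) =
      l * ∑ u, ∑ v, (g.adjMatrix ℝ u v - Q u v) * s u v := by
    intro g
    rw [sum_eq_sum_Ioi (fun u v => g.adjMatrix ℝ u v - Q u v)
      (fun u v => by rw [hs, SimpleGraph.adjMatrix_apply, SimpleGraph.adjMatrix_apply, g.adj_comm])
      (fun u => by simp [hd]), Finset.mul_sum]
    refine Finset.sum_congr rfl fun u _ => ?_
    rw [Finset.mul_sum]
    exact Finset.sum_congr rfl fun v _ => by ring
  have hvar : ∑ u, ∑ v ∈ Finset.Ioi u, Q u v * (l * (s u v + s v u)) ^ 2 ≤ 2 * l ^ 2 * S := by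
    have h2 := sum_eq_sum_Ioi (fun u v => Q u v) hs hd fun _ _ => 1
    simp only [mul_one] at h2
    calc _ ≤ ∑ u, ∑ v ∈ Finset.Ioi u, 2 * l ^ 2 * (Q u v * (1 + 1)) := by
          refine Finset.sum_le_sum fun u _ => Finset.sum_le_sum fun v _ => ?_
          have h3 : (s u v + s v u) ^ 2 ≤ 4 := by
            have := abs_le.1 (hs1 u v); have := abs_le.1 (hs1 v u)
            nlinarith
          have h4 : 0 ≤ Q u v * l ^ 2 := mul_nonneg (h0 u v) (sq_nonneg l)
          nlinarith
      _ = 2 * l ^ 2 * ∑ u, ∑ v, Q u v := by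
          rw [h2]; simp only [Finset.mul_sum]
      _ ≤ _ := by gcongr
  have hle : ∀ g : SimpleGraph (Fin n),
      (if t < ∑ u, ∑ v, (g.adjMatrix ℝ u v - Q u v) * s u v then graphProb Q g else 0) ≤
      Real.exp (-(l * t)) * (graphProb Q g * Real.exp (∑ u, ∑ v ∈ Finset.Ioi u,
        l * (s u v + s v u) * (g.adjMatrix ℝ u v - Q u v))) := by
    intro g
    have hg := graphProb_nonneg h0 h1 g
    rw [hexp, mul_left_comm, ← Real.exp_add]
    split_ifs with h
    · refine le_mul_of_one_le_right hg (Real.one_le_exp ?_)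
      have := mul_le_mul_of_nonneg_left h.le hl
      linarith
    · exact mul_nonneg hg (Real.exp_pos _).le
  refine (Finset.sum_le_sum fun g _ => hle g).trans ?_
  rw [← Finset.mul_sum, Real.exp_add]
  exact mul_le_mul_of_nonneg_left (hmain.trans (Real.exp_le_exp.2 hvar)) (Real.exp_pos _).le

lemma weightedGraph_le_one {Ω : Type*} {W : Ω → Ω → ℝ} {ρ : ℝ} (x : Fin n → Ω) (i j : Fin n) : weightedGraph ρ W x i j ≤ 1 := by
  rw [weightedGraph]
  split_ifs
  · exact zero_le_one
  · exact min_le_left _ _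

lemma weightedGraph_diag {Ω : Type*} {W : Ω → Ω → ℝ} {ρ : ℝ} (x : Fin n → Ω) (i : Fin n) : weightedGraph ρ W x i i = 0 := by
  simp [weightedGraph]

variable {Ω : Type u} [MeasurableSpace Ω] {π : Measure Ω} {W : Ω → Ω → ℝ} {ρ : ℝ}

lemma weightedGraph_nonneg (hW : IsGraphon π W) (hρ : 0 ≤ ρ) (x : Fin n → Ω) (i j : Fin n) :
    0 ≤ weightedGraph ρ W x i j := by
  rw [weightedGraph]
  split_ifs
  · exact le_rfl
  · exact le_min zero_le_one (mul_nonneg hρ (hW.nonneg _ _))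

lemma weightedGraph_comm (hW : IsGraphon π W) (x : Fin n → Ω) (i j : Fin n) :
    weightedGraph ρ W x i j = weightedGraph ρ W x j i := by
  rw [weightedGraph, weightedGraph, hW.symm]
  simp only [eq_comm]

lemma measurable_weightedGraph (hW : IsGraphon π W) (i j : Fin n) :
    Measurable fun x : Fin n → Ω => weightedGraph ρ W x i j := by
  unfold weightedGraph
  split_ifs
  · exact measurable_const
  · have : Measurable fun x : Fin n → Ω => W (x i) (x j) :=
      hW.measurable.comp (f := fun x : Fin n → Ω => (x i, x j)) ((measurable_pi_apply i).prodMk (measurable_pi_apply j))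
    exact measurable_const.min (this.const_mul ρ)

/-- Chernoff's bound given the positions, summed over the `k ^ n` labellings and the `2 ^ (k ^ 2)`
sign matrices. The restriction to `∑ Q ≤ S` supplies the variance proxy, which a random `Q` does not
bound by itself. -/
lemma IsWRandomGraph.blockClose (hW : IsGraphon π W) (hρ : 0 ≤ ρ) {X : Type v} [MeasurableSpace X]
    {P : Measure X} [IsProbabilityMeasure P] {x : Fin n → X → Ω} {G : X → SimpleGraph (Fin n)}
    (hG : IsWRandomGraph π W ρ P x G) (k : ℕ) (hn : 0 < n) {l t S : ℝ} (hl : 0 ≤ l)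
    (hl2 : l ≤ 1 / 2) :
    P {ω | ∑ u, ∑ v, weightedGraph ρ W (fun i => x i ω) u v ≤ S ∧
        ¬ BlockClose k ((G ω).adjMatrix ℝ) (weightedGraph ρ W fun i => x i ω) (t / (n : ℝ) ^ 2)} ≤
      ENNReal.ofReal (k ^ n * 2 ^ (k ^ 2) * Real.exp (-(l * t) + 2 * l ^ 2 * S)) := by
  have hn' : (0 : ℝ) < n := Nat.cast_pos.2 hn
  set sg : (Fin n → Fin k) × (Fin k → Fin k → Bool) → Fin n → Fin n → ℝ :=
    fun z u v => if z.2 (z.1 u) (z.1 v) then 1 else -1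
  set D : SimpleGraph (Fin n) → (Fin n → Fin k) × (Fin k → Fin k → Bool) → (Fin n → Ω) → ℝ :=
    fun g z y => ∑ u, ∑ v, (g.adjMatrix ℝ u v - weightedGraph ρ W y u v) * sg z u v
  set T : SimpleGraph (Fin n) → Set (Fin n → Ω) := fun g =>
    {y | ∑ u, ∑ v, weightedGraph ρ W y u v ≤ S ∧ ∃ z, t < D g z y}
  have hmx : Measurable fun ω => fun i => x i ω := measurable_pi_lambda _ hG.measurable_pos
  have hD : ∀ g z, Measurable (D g z) := fun g z =>
    Finset.measurable_fun_sum _ fun u _ => Finset.measurable_fun_sum _ fun v _ =>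
      (measurable_const.sub (measurable_weightedGraph hW u v)).mul_const _
  have hT : ∀ g, MeasurableSet (T g) := by
    intro g
    refine (measurableSet_le (Finset.measurable_fun_sum _ fun u _ =>
      Finset.measurable_fun_sum _ fun v _ => measurable_weightedGraph hW u v)
      measurable_const).inter ?_
    have : {y : Fin n → Ω | ∃ z, t < D g z y} = ⋃ z, {y | t < D g z y} := by
      ext; simp
    change MeasurableSet {y : Fin n → Ω | ∃ z, t < D g z y}
    rw [this]
    exact MeasurableSet.iUnion fun z => measurableSet_lt measurable_const (hD g z)
  have hsub : {ω | ∑ u, ∑ v, weightedGraph ρ W (fun i => x i ω) u v ≤ S ∧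
        ¬ BlockClose k ((G ω).adjMatrix ℝ) (weightedGraph ρ W fun i => x i ω) (t / (n : ℝ) ^ 2)} ⊆
      -- The conditional law speaks about a measurable set of positions and one fixed graph, so the
      -- event is split according to the value of `G`.
      ⋃ g, ({ω | (fun i => x i ω) ∈ T g} ∩ {ω | G ω = g}) := by
    rintro ω ⟨h1, h2⟩
    refine Set.mem_iUnion.2 ⟨G ω, ⟨h1, ?_⟩, rfl⟩
    by_contra! h3
    refine h2 (BlockClose.of_signs fun σ s => ?_)
    have e : (n : ℝ) ^ 2 * (t / (n : ℝ) ^ 2) = t := by field_simp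
    rw [e]
    exact h3 (σ, s)
  refine (measure_mono hsub).trans ((measure_iUnion_fintype_le _ _).trans ?_)
  have hTm : ∀ g, MeasurableSet {ω | (fun i => x i ω) ∈ T g} := fun g => hmx (hT g)
  simp only [fun g => hG.cond_law (T g) g (hT g)]
  simp only [← fun g => lintegral_indicator (μ := P) (hTm g)]
  have hgp : ∀ g, Measurable fun y : Fin n → Ω => graphProb (weightedGraph ρ W y) g := by
    intro g
    refine Finset.measurable_fun_prod _ fun i _ => Finset.measurable_fun_prod _ fun j _ => ?_
    split_ifs
    · exact measurable_weightedGraph hW i j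
    · exact measurable_const.sub (measurable_weightedGraph hW i j)
  have hgx : ∀ g, Measurable fun ω => graphProb (weightedGraph ρ W fun i => x i ω) g :=
    fun g => (hgp g).comp hmx
  rw [← lintegral_finsetSum _ fun g _ => (hgx g).ennreal_ofReal.indicator (hTm g)]
  calc _ ≤ ∫⁻ _, ENNReal.ofReal (k ^ n * 2 ^ (k ^ 2) * Real.exp (-(l * t) + 2 * l ^ 2 * S)) ∂P := by
        refine lintegral_mono fun ω => ?_
        set y := fun i => x i ω
        set Q := weightedGraph ρ W y
        have hQ0 : ∀ i j, 0 ≤ Q i j := weightedGraph_nonneg hW hρ y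
        have hQ1 : ∀ i j, Q i j ≤ 1 := weightedGraph_le_one y
        have e : ∀ g, ({ω | (fun i => x i ω) ∈ T g}.indicator (fun ω =>
            ENNReal.ofReal (graphProb (weightedGraph ρ W fun i => x i ω) g)) ω) =
            ENNReal.ofReal (if y ∈ T g then graphProb Q g else 0) := by
          intro g
          rw [Set.indicator_apply]
          simp only [Set.mem_ofPred_eq]
          split_ifs <;> simp [Q, y]
        simp only [e]
        rw [← ENNReal.ofReal_sum_of_nonneg fun g _ => by
          split_ifs
          · exact graphProb_nonneg hQ0 hQ1 g
          · exact le_rfl]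
        refine ENNReal.ofReal_le_ofReal ?_
        by_cases hS : ∑ u, ∑ v, Q u v ≤ S
        swap
        · rw [Finset.sum_eq_zero]
          · positivity
          · exact fun g _ => if_neg fun h => hS h.1
        calc ∑ g, (if y ∈ T g then graphProb Q g else 0)
            ≤ ∑ g, ∑ z, (if t < D g z y then graphProb Q g else 0) := by
              refine Finset.sum_le_sum fun g _ => ?_
              have hpos : ∀ z ∈ Finset.univ, 0 ≤ if t < D g z y then graphProb Q g else 0 :=
                fun z _ => by
                  split_ifs
                  · exact graphProb_nonneg hQ0 hQ1 g
                  · exact le_rfl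
              split_ifs with h
              · obtain ⟨-, z, hz⟩ := h
                refine le_trans ?_ (Finset.single_le_sum hpos (Finset.mem_univ z))
                rw [if_pos hz]
              · exact Finset.sum_nonneg hpos
          _ = ∑ z, ∑ g, (if t < D g z y then graphProb Q g else 0) := Finset.sum_comm
          _ ≤ ∑ z : (Fin n → Fin k) × (Fin k → Fin k → Bool),
              Real.exp (-(l * t) + 2 * l ^ 2 * S) := by
              refine Finset.sum_le_sum fun z _ => ?_
              exact sum_graphProb_deviation_le hQ0 hQ1 (weightedGraph_comm hW y)
                (weightedGraph_diag y) (s := sg z) (fun i j => by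
                  simp only [sg]; split_ifs <;> simp) hl hl2 hS
          _ = _ := by
              rw [Finset.sum_const, nsmul_eq_mul, Finset.card_univ, Fintype.card_prod,
                Fintype.card_fun, Fintype.card_fun, Fintype.card_fun, Fintype.card_fin,
                Fintype.card_fin, Fintype.card_bool, ← pow_mul, ← sq]
              push_cast
              ring
    _ = _ := by simp

end concentration

/-! ### Size estimates for the number of classes and the explicit deviation bound -/

section concentration

lemma one_le_one_add_log {κ : ℝ} (h0 : 0 < κ) (h1 : κ ≤ 1) : 1 ≤ 1 + Real.log (1 / κ) := by
  have := Real.log_nonneg ((one_le_div h0).2 h1)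
  linarith

lemma one_le_floor {n : ℕ} {κ : ℝ} (h : 1 ≤ n * κ) : 1 ≤ ⌊(n : ℝ) * κ⌋₊ :=
  Nat.le_floor (by simpa using h)

lemma half_le_floor {n : ℕ} {κ : ℝ} (h : 1 ≤ n * κ) : n * κ / 2 ≤ ⌊(n : ℝ) * κ⌋₊ := by
  have h1 : (1 : ℝ) ≤ ⌊(n : ℝ) * κ⌋₊ := by exact_mod_cast one_le_floor h
  have := Nat.lt_floor_add_one ((n : ℝ) * κ)
  linarith

lemma div_floor_le {n : ℕ} {κ : ℝ} (h0 : 0 < κ) (h : 1 ≤ n * κ) :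
    (n : ℝ) / ⌊(n : ℝ) * κ⌋₊ ≤ 2 / κ := by
  have h1 := half_le_floor h
  have h2 : (0 : ℝ) < ⌊(n : ℝ) * κ⌋₊ := by linarith
  rw [div_le_div_iff₀ h2 h0]
  linarith

lemma numClasses_le {n : ℕ} {κ : ℝ} (h0 : 0 < κ) (h1 : κ ≤ 1) (h : 1 ≤ n * κ) :
    (numClasses n κ : ℝ) ≤ 3 / κ := by
  have h2 := Nat.ceil_lt_add_one (a := (n : ℝ) / ⌊(n : ℝ) * κ⌋₊) (by positivity)
  have h3 := div_floor_le h0 h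
  have h4 : 1 ≤ 1 / κ := (one_le_div h0).2 h1
  have h5 : 3 / κ = 2 / κ + 1 / κ := by ring
  rw [numClasses, h5]
  linarith

lemma numClasses_pos {n : ℕ} {κ : ℝ} (hn : 0 < n) (h : 1 ≤ n * κ) : 0 < numClasses n κ := by
  have := one_le_floor h
  have h1 : (0 : ℝ) < ⌊(n : ℝ) * κ⌋₊ := by exact_mod_cast this
  exact Nat.ceil_pos.2 (div_pos (Nat.cast_pos.2 hn) h1)

/-- The number of classes is at most `3/κ ≤ exp (2 (1 + log (1/κ)))`, which handles the labellings.
Its square is at most `9/κ²`, and the density assumption together with `ρ ≤ 1` bounds `1/κ²` by `C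
n`, which handles the sign matrices. -/
lemma card_labellings_le {n : ℕ} {κ ρ C : ℝ} (hn : 0 < n) (h0 : 0 < κ) (h1 : κ ≤ 1)
    (h : 1 ≤ n * κ) (hρ1 : ρ ≤ 1) (hC : 1 ≤ C)
    (hs : (1 + Real.log (1 / κ)) / κ ^ 2 ≤ C * (ρ * n)) :
    (numClasses n κ : ℝ) ^ n * 2 ^ (numClasses n κ ^ 2) ≤
      Real.exp ((2 + 9 * C) * (n * (1 + Real.log (1 / κ)))) := by
  have hn' : (0 : ℝ) < n := Nat.cast_pos.2 hn
  have hk := numClasses_le h0 h1 h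
  have hL := one_le_one_add_log h0 h1
  set L := 1 + Real.log (1 / κ) with hLdef
  have e1 : (numClasses n κ : ℝ) ≤ Real.exp (2 * L) := by
    refine hk.trans ?_
    have h3 : (3 : ℝ) ≤ Real.exp 2 := by have := Real.add_one_le_exp (2 : ℝ); linarith
    have h4 : Real.exp (Real.log (1 / κ)) = 1 / κ := Real.exp_log (by positivity)
    calc 3 / κ = 3 * (1 / κ) := by ring
      _ ≤ Real.exp 2 * Real.exp (Real.log (1 / κ)) := by rw [h4]; gcongr
      _ = Real.exp (2 + Real.log (1 / κ)) := by rw [Real.exp_add]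
      _ ≤ _ := Real.exp_le_exp.2 (by rw [hLdef] at hL ⊢; linarith)
  have e2 : ((numClasses n κ ^ 2 : ℕ) : ℝ) ≤ 9 * C * (n * L) := by
    have h5 : (numClasses n κ : ℝ) ^ 2 ≤ (3 / κ) ^ 2 := by gcongr
    have h6 : 1 / κ ^ 2 ≤ L / κ ^ 2 := by gcongr
    have h7 : C * (ρ * n) ≤ C * n := by
      refine mul_le_mul_of_nonneg_left ?_ (by linarith)
      nlinarith
    have h8 : C * n ≤ C * (n * L) := by
      refine mul_le_mul_of_nonneg_left ?_ (by linarith)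
      nlinarith
    push_cast
    calc _ ≤ (3 / κ) ^ 2 := h5
      _ = 9 * (1 / κ ^ 2) := by rw [div_pow]; ring
      _ ≤ 9 * (C * (n * L)) := by linarith
      _ = _ := by ring
  have e3 : (2 : ℝ) ^ (numClasses n κ ^ 2) ≤ Real.exp (9 * C * (n * L)) := by
    have h9 : (2 : ℝ) ≤ Real.exp 1 := by have := Real.add_one_le_exp (1 : ℝ); linarith
    calc (2 : ℝ) ^ (numClasses n κ ^ 2) ≤ Real.exp 1 ^ (numClasses n κ ^ 2) := by gcongr
      _ = Real.exp ((numClasses n κ ^ 2 : ℕ)) := by rw [← Real.exp_nat_mul, mul_one]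
      _ ≤ _ := Real.exp_le_exp.2 e2
  calc (numClasses n κ : ℝ) ^ n * 2 ^ (numClasses n κ ^ 2)
      ≤ Real.exp (2 * L) ^ n * Real.exp (9 * C * (n * L)) := by gcongr
    _ = _ := by
      rw [← Real.exp_nat_mul, ← Real.exp_add]
      congr 1
      ring

/-- The factor of the deviation bound for the adjacency matrix. -/
noncomputable def deviationConst (C h K : ℝ) : ℝ := 2 * Real.sqrt C * (2 + 9 * C + K + h)

lemma deviationConst_nonneg {C h K : ℝ} (hC : 1 ≤ C) (hh : 0 ≤ h) (hK : 0 ≤ K) :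
    0 ≤ deviationConst C h K := by
  unfold deviationConst; positivity

lemma IsWRandomGraph.measure_not_blockClose_le {Ω : Type u} [MeasurableSpace Ω] {π : Measure Ω}
    {W : Ω → Ω → ℝ} {ρ : ℝ} (hW : IsGraphon π W) (hρ : 0 < ρ) (hρ1 : ρ ≤ 1) {X : Type v}
    [MeasurableSpace X] {P : Measure X} [IsProbabilityMeasure P] {n : ℕ} {x : Fin n → X → Ω}
    {G : X → SimpleGraph (Fin n)} (hG : IsWRandomGraph π W ρ P x G) (hn : 0 < n)
    {κ C h K : ℝ} (h0 : 0 < κ) (h1 : κ ≤ 1) (hκ : 1 ≤ n * κ) (hC : 1 ≤ C)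
    (hh : 0 ≤ h) (hK : 0 ≤ K) (hs : (1 + Real.log (1 / κ)) / κ ^ 2 ≤ C * (ρ * n)) :
    P {ω | ∑ u, ∑ v, weightedGraph ρ W (fun i => x i ω) u v ≤ ρ * n ^ 2 * h ∧
        ¬ BlockClose (numClasses n κ) ((G ω).adjMatrix ℝ) (weightedGraph ρ W fun i => x i ω)
          (deviationConst C h K * ρ * Real.sqrt ((1 + Real.log (1 / κ)) / (ρ * n)))} ≤
      ENNReal.ofReal (Real.exp (-(K * n))) := by
  have hn' : (0 : ℝ) < n := Nat.cast_pos.2 hn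
  have hL := one_le_one_add_log h0 h1
  have hcard := card_labellings_le hn h0 h1 hκ hρ1 hC hs
  set L := 1 + Real.log (1 / κ) with hLdef
  set θ := L / (ρ * n) with hθ
  have hθ0 : 0 ≤ θ := by positivity
  have hθC : θ ≤ C := by
    rw [hθ, div_le_iff₀ (by positivity)]
    have h6 : L / 1 ≤ L / κ ^ 2 :=
      div_le_div_of_nonneg_left (by linarith) (by positivity) (by nlinarith)
    rw [div_one] at h6
    linarith
  have hsC : 1 ≤ Real.sqrt C := Real.one_le_sqrt.2 hC
  set τ := deviationConst C h K with hτ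
  -- Up to a constant the optimal Chernoff parameter; since `θ ≤ C`, the normalization makes it at
  -- most `1/2`. Then `l t` equals `(2 + 9 C + K + h) n L`, where `2 + 9 C` pays for the union
  -- bound, `h` for the variance, and `K` is left over.
  set l := Real.sqrt θ / (2 * Real.sqrt C) with hl
  have hl0 : 0 ≤ l := by positivity
  have hl2 : l ≤ 1 / 2 := by
    rw [hl, div_le_iff₀ (by positivity)]
    have := Real.sqrt_le_sqrt hθC
    linarith
  have hmain := hG.blockClose hW hρ.le (numClasses n κ) hn hl0 hl2
    (t := τ * ρ * Real.sqrt θ * n ^ 2) (S := ρ * n ^ 2 * h)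
  have e1 : τ * ρ * Real.sqrt θ * (n : ℝ) ^ 2 / (n : ℝ) ^ 2 = τ * ρ * Real.sqrt θ := by field_simp
  rw [e1] at hmain
  refine hmain.trans (ENNReal.ofReal_le_ofReal ?_)
  have hsq : Real.sqrt θ * Real.sqrt θ = θ := Real.mul_self_sqrt hθ0
  have hsqC : Real.sqrt C * Real.sqrt C = C := Real.mul_self_sqrt (by linarith)
  have e2 : ρ * (n : ℝ) ^ 2 * θ = n * L := by rw [hθ]; field_simp
  have e3 : l * (τ * ρ * Real.sqrt θ * n ^ 2) = (2 + 9 * C + K + h) * (n * L) := by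
    rw [← e2, hl, hτ, deviationConst]
    calc _ = (2 + 9 * C + K + h) * (ρ * n ^ 2 * (Real.sqrt θ * Real.sqrt θ)) := by
          field_simp
      _ = _ := by rw [hsq]
  have e4 : 2 * l ^ 2 * (ρ * n ^ 2 * h) ≤ h * (n * L) := by
    have : l ^ 2 = θ / (4 * C) := by
      rw [hl, div_pow, sq, hsq, mul_pow, sq (Real.sqrt C), hsqC]; norm_num
    rw [this, ← e2]
    have h7 : θ / (4 * C) ≤ θ / 2 := div_le_div_of_nonneg_left hθ0 (by norm_num) (by linarith)
    have h8 : 0 ≤ ρ * n ^ 2 * h := by positivity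
    nlinarith
  have hnL : (n : ℝ) ≤ n * L := by nlinarith
  calc _ ≤ Real.exp ((2 + 9 * C) * (n * L)) *
        Real.exp (-(l * (τ * ρ * Real.sqrt θ * n ^ 2)) + 2 * l ^ 2 * (ρ * n ^ 2 * h)) := by gcongr
    _ ≤ Real.exp (-(K * n)) := by
        rw [← Real.exp_add, Real.exp_le_exp, e3]
        have := mul_le_mul_of_nonneg_left hnL hK
        nlinarith

end concentration

/-! ## Sums over pairs of an i.i.d. sample -/

set_option linter.unusedSectionVars false

section sample

/-- The variables `x i` are independent with common law `π`. -/
structure IsSample {Ω : Type*} [MeasurableSpace Ω] (π : Measure Ω) {X : Type*} [MeasurableSpace X]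
    (P : Measure X) {ι : Type*} (x : ι → X → Ω) : Prop where
  measurable : ∀ i, Measurable (x i)
  law : ∀ i, P.map (x i) = π
  indep : iIndepFun x P

variable {Ω : Type*} [MeasurableSpace Ω] {π : Measure Ω} [IsProbabilityMeasure π]
  {X : Type*} [MeasurableSpace X] {P : Measure X} [IsProbabilityMeasure P]

lemma IsWRandomGraph.isSample {Ω : Type u} [MeasurableSpace Ω] {π : Measure Ω} {W : Ω → Ω → ℝ}
    {ρ : ℝ} {X : Type v} [MeasurableSpace X] {P : Measure X} {n : ℕ} {x : Fin n → X → Ω}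
    {G : X → SimpleGraph (Fin n)} (h : IsWRandomGraph π W ρ P x G) : IsSample π P x :=
  ⟨h.measurable_pos, h.law_pos, h.indep_pos⟩

/-- Independence of a sequence concerns finite subfamilies only, and each of these lies in an
initial segment. -/
lemma IsSample.of_forall_fin {x : ℕ → X → Ω}
    (h : ∀ n : ℕ, IsSample π P fun i : Fin n => x i) : IsSample π P x where
  measurable i := (h (i + 1)).measurable ⟨i, i.lt_succ_self⟩
  law i := (h (i + 1)).law ⟨i, i.lt_succ_self⟩
  indep := by
    rw [iIndepFun_iff_finset]
    intro s
    have hlt : ∀ i : s, (i : ℕ) < s.sup id + 1 := fun i =>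
      Nat.lt_succ_of_le (Finset.le_sup (f := id) i.2)
    exact (h (s.sup id + 1)).indep.precomp (g := fun i : s => ⟨i, hlt i⟩) fun _ _ hij =>
      Subtype.ext (Fin.mk.inj hij)

lemma IsSample.comp {ι κ : Type*} {x : ι → X → Ω} (h : IsSample π P x) {e : κ → ι}
    (he : Function.Injective e) : IsSample π P fun i => x (e i) :=
  ⟨fun _ => h.measurable _, fun _ => h.law _, h.indep.precomp he⟩

lemma IsSample.map_eq {ι : Type*} {x : ι → X → Ω} (h : IsSample π P x) :
    P.map (fun ω i => x i ω) = Measure.infinitePi fun _ => π := by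
  rw [h.indep.map_fun_eq_infinitePi_map h.measurable]
  simp only [h.law]

lemma IsSample.map_pair {ι : Type*} {x : ι → X → Ω} (h : IsSample π P x) {i j : ι} (hij : i ≠ j) :
    P.map (fun ω => (x i ω, x j ω)) = π.prod π := by
  have := (indepFun_iff_map_prod_eq_prod_map_map (h.measurable i).aemeasurable
    (h.measurable j).aemeasurable).1 (h.indep.indepFun hij)
  rwa [h.law, h.law] at this

lemma IsSample.lintegral_pair {ι : Type*} {x : ι → X → Ω} (h : IsSample π P x) {i j : ι}
    (hij : i ≠ j) {f : Ω → Ω → ℝ≥0∞} (hf : Measurable (Function.uncurry f)) :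
    ∫⁻ ω, f (x i ω) (x j ω) ∂P = ∫⁻ z, f z.1 z.2 ∂(π.prod π) := by
  rw [← h.map_pair hij]
  exact (lintegral_map (f := Function.uncurry f) hf
    ((h.measurable i).prodMk (h.measurable j))).symm

/-- The sum of `f` over the pairs of different sample points. -/
noncomputable def offDiagSum {Ω : Type*} {n : ℕ} (f : Ω → Ω → ℝ≥0∞) (y : Fin n → Ω) : ℝ≥0∞ :=
  ∑ i, ∑ j, if i = j then 0 else f (y i) (y j)

lemma measurable_eval_pair {f : Ω → Ω → ℝ≥0∞} (hf : Measurable (Function.uncurry f)) {ι : Type*}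
    (i j : ι) : Measurable fun y : ι → Ω => f (y i) (y j) :=
  hf.comp (f := fun y : ι → Ω => (y i, y j)) ((measurable_pi_apply i).prodMk (measurable_pi_apply j))

lemma measurable_offDiagSum {n : ℕ} {f : Ω → Ω → ℝ≥0∞} (hf : Measurable (Function.uncurry f)) :
    Measurable (offDiagSum (n := n) f) :=
  Finset.measurable_fun_sum _ fun i _ => Finset.measurable_fun_sum _ fun j _ => by
    split_ifs
    · exact measurable_const
    · exact measurable_eval_pair hf i j

lemma IsSample.lintegral_offDiagSum_le {n : ℕ} {x : Fin n → X → Ω} (h : IsSample π P x)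
    {f : Ω → Ω → ℝ≥0∞} (hf : Measurable (Function.uncurry f)) :
    ∫⁻ ω, offDiagSum f (fun i => x i ω) ∂P ≤ n ^ 2 * ∫⁻ z, f z.1 z.2 ∂(π.prod π) := by
  have hm : ∀ i j, Measurable fun ω => if i = j then 0 else f (x i ω) (x j ω) := fun i j => by
    split_ifs
    · exact measurable_const
    · exact hf.comp (f := fun ω => (x i ω, x j ω)) ((h.measurable i).prodMk (h.measurable j))
  simp only [offDiagSum]
  rw [lintegral_finsetSum _ fun i _ => Finset.measurable_fun_sum _ fun j _ => hm i j]
  simp only [fun i => lintegral_finsetSum (μ := P) Finset.univ fun j _ => hm i j]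
  calc _ ≤ ∑ i : Fin n, ∑ j : Fin n, ∫⁻ z, f z.1 z.2 ∂(π.prod π) := by
        refine Finset.sum_le_sum fun i _ => Finset.sum_le_sum fun j _ => ?_
        by_cases hij : i = j
        · simp [hij]
        · simp only [hij, if_false]
          exact (h.lintegral_pair hij hf).le
    _ = _ := by simp; ring

lemma offDiagSum_eq_range {n : ℕ} (f : Ω → Ω → ℝ≥0∞) (y : ℕ → Ω) :
    offDiagSum f (fun i : Fin n => y i) =
      ∑ i ∈ Finset.range n, ∑ j ∈ Finset.range n, if i = j then 0 else f (y i) (y j) := by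
  simp only [offDiagSum, Finset.sum_range, Fin.ext_iff]

lemma offDiagSum_perm {n : ℕ} (f : Ω → Ω → ℝ≥0∞) (y : ℕ → Ω) {e : Equiv.Perm ℕ}
    (he : ∀ i, i < n ↔ e i < n) :
    offDiagSum f (fun i : Fin n => y (e i)) = offDiagSum f (fun i : Fin n => y i) := by
  rw [offDiagSum_eq_range, offDiagSum_eq_range f fun i => y (e i)]
  refine Finset.sum_equiv e (by simpa using he) fun i _ => ?_
  refine Finset.sum_equiv e (by simpa using he) fun j _ => ?_
  simp

lemma swap_lt_iff {a b n : ℕ} (ha : a < n) (hb : b < n) (i : ℕ) :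
    i < n ↔ Equiv.swap a b i < n := by
  rw [Equiv.swap_apply_def]
  split_ifs <;> omega

/-- Exchangeability: a permutation of the indices does not change the product law of the sequence.
Two transpositions below `n` carry `(i, j)` to `(0, 1)`, and `E` is invariant under both. -/
lemma IsSample.setLIntegral_pair_eq {x : ℕ → X → Ω} (h : IsSample π P x) {f : Ω → Ω → ℝ≥0∞}
    (hf : Measurable (Function.uncurry f)) {E : Set (ℕ → Ω)} (hE : MeasurableSet E) {n : ℕ}
    (hinv : ∀ a b, a < n → b < n → ∀ y, (fun i => y (Equiv.swap a b i)) ∈ E ↔ y ∈ E)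
    {i j : ℕ} (hi : i < n) (hj : j < n) (hij : i ≠ j) :
    ∫⁻ ω in {ω | (fun i => x i ω) ∈ E}, f (x i ω) (x j ω) ∂P =
      ∫⁻ ω in {ω | (fun i => x i ω) ∈ E}, f (x 0 ω) (x 1 ω) ∂P := by
  have key : ∀ a b, a < n → b < n → ∀ i j,
      ∫⁻ ω in {ω | (fun i => x i ω) ∈ E}, f (x i ω) (x j ω) ∂P =
      ∫⁻ ω in {ω | (fun i => x i ω) ∈ E},
        f (x (Equiv.swap a b i) ω) (x (Equiv.swap a b j) ω) ∂P := by
    intro a b ha hb i j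
    have h' := h.comp (Equiv.swap a b).injective
    have m1 : Measurable fun ω => fun i => x i ω := measurable_pi_lambda _ h.measurable
    have m2 : Measurable fun ω => fun i => x (Equiv.swap a b i) ω :=
      measurable_pi_lambda _ h'.measurable
    have e1 := setLIntegral_map (μ := P) hE (measurable_eval_pair hf i j) m1
    have e2 := setLIntegral_map (μ := P) hE (measurable_eval_pair hf i j) m2
    rw [h.map_eq] at e1
    rw [h'.map_eq] at e2
    have e3 := e1.symm.trans e2
    have e4 : (fun ω i => x (Equiv.swap a b i) ω) ⁻¹' E = (fun ω i => x i ω) ⁻¹' E := by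
      ext ω
      exact hinv a b ha hb fun i => x i ω
    rw [e4] at e3
    exact e3
  have h0 : 0 < n := by omega
  have h1 : 1 < n := by omega
  rw [key i 0 hi h0 i j, Equiv.swap_apply_left]
  set j' := Equiv.swap i 0 j with hj'
  have hj'n : j' < n := (swap_lt_iff hi h0 j).1 hj
  have hj'0 : j' ≠ 0 := by
    intro h
    have : j = i := by
      have h2 := congrArg (Equiv.swap i 0) h
      rw [hj', Equiv.swap_apply_self, Equiv.swap_apply_right] at h2
      exact h2
    exact hij this.symm
  rw [key j' 1 hj'n h1 0 j', Equiv.swap_apply_left,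
    Equiv.swap_apply_of_ne_of_ne hj'0.symm zero_ne_one]

/-- Decomposition of an event according to the last time at which `c n < S n`. -/
lemma mul_measure_exists_lt_le {S : ℕ → X → ℝ≥0∞} (hS : ∀ n, Measurable (S n)) {c : ℕ → ℝ≥0∞}
    {g : X → ℝ≥0∞} {t : ℝ≥0∞} {N : ℕ}
    (h : ∀ n, t * P {ω | c n < S n ω ∧ ∀ m ∈ Finset.Ioc n N, S m ω ≤ c m} ≤
      ∫⁻ ω in {ω | c n < S n ω ∧ ∀ m ∈ Finset.Ioc n N, S m ω ≤ c m}, g ω ∂P) :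
    t * P {ω | ∃ n ≤ N, c n < S n ω} ≤ ∫⁻ ω, g ω ∂P := by
  have hE : ∀ n, MeasurableSet {ω | c n < S n ω ∧ ∀ m ∈ Finset.Ioc n N, S m ω ≤ c m} := by
    intro n
    have : {ω | c n < S n ω ∧ ∀ m ∈ Finset.Ioc n N, S m ω ≤ c m} =
        {ω | c n < S n ω} ∩ ⋂ m ∈ Finset.Ioc n N, {ω | S m ω ≤ c m} := by
      ext y; simp
    rw [this]
    exact (measurableSet_lt measurable_const (hS n)).inter
      (Finset.measurableSet_biInter _ fun m _ => measurableSet_le (hS m) measurable_const)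
  generalize hEdef : (fun n => {ω | c n < S n ω ∧ ∀ m ∈ Finset.Ioc n N, S m ω ≤ c m}) = E at *
  have hmem : ∀ n ω, ω ∈ E n ↔ c n < S n ω ∧ ∀ m ∈ Finset.Ioc n N, S m ω ≤ c m := by
    intro n ω; rw [← hEdef]; rfl
  have h' : ∀ n, t * P (E n) ≤ ∫⁻ ω in E n, g ω ∂P := by subst hEdef; exact h
  have hE' : ∀ n, MeasurableSet (E n) := by subst hEdef; exact hE
  -- Exceeding the threshold at a later time `m ≤ N` contradicts that `n` was the last such time, so
  -- the events are disjoint and their integrals add up to at most one full integral.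
  have hdisj : (↑(Finset.range (N + 1)) : Set ℕ).PairwiseDisjoint E := by
    have : ∀ n m, n < m → m ∈ Finset.range (N + 1) → ∀ y, y ∈ E n → y ∈ E m → False := by
      intro n m hnm hmN y h1 h2
      have h3 := ((hmem n y).1 h1).2 m
        (Finset.mem_Ioc.2 ⟨hnm, Nat.lt_succ_iff.1 (Finset.mem_range.1 hmN)⟩)
      exact absurd ((hmem m y).1 h2).1 (not_lt.2 h3)
    intro n hn m hm hne
    refine Set.disjoint_left.2 fun ω h1 h2 => ?_
    rcases lt_or_gt_of_ne hne with hlt | hlt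
    · exact this n m hlt hm _ h1 h2
    · exact this m n hlt hn _ h2 h1
  have hcover : {ω | ∃ n ≤ N, c n < S n ω} ⊆ ⋃ n ∈ Finset.range (N + 1), E n := by
    rintro ω ⟨n, hn, hlt⟩
    have hA : ((Finset.range (N + 1)).filter fun n => c n < S n ω).Nonempty :=
      ⟨n, Finset.mem_filter.2 ⟨Finset.mem_range.2 (Nat.lt_succ_of_le hn), hlt⟩⟩
    have hmax := Finset.mem_filter.1 (Finset.max'_mem _ hA)
    refine Set.mem_biUnion hmax.1 ((hmem _ _).2 ⟨hmax.2, fun m hm => ?_⟩)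
    by_contra! h1
    have h2 := Finset.mem_Ioc.1 hm
    exact absurd (Finset.le_max' _ m (Finset.mem_filter.2
      ⟨Finset.mem_range.2 (Nat.lt_succ_of_le h2.2), h1⟩)) (not_le.2 h2.1)
  calc _ ≤ t * ∑ n ∈ Finset.range (N + 1), P (E n) := by
        gcongr
        exact (measure_mono hcover).trans (measure_biUnion_finset_le _ _)
    _ ≤ ∑ n ∈ Finset.range (N + 1), ∫⁻ ω in E n, g ω ∂P := by
        rw [Finset.mul_sum]
        exact Finset.sum_le_sum fun n _ => h' n
    _ = ∫⁻ ω in ⋃ n ∈ Finset.range (N + 1), E n, g ω ∂P :=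
        (lintegral_biUnion_finset hdisj (fun n _ => hE' n) _).symm
    _ ≤ ∫⁻ ω, g ω ∂P := setLIntegral_le_lintegral _ _

/-- Integrate `t n² < offDiagSum` over the symmetric event. By exchangeability each of the at most
`n²` pairs contributes the same integral, so the factor `n²` cancels. -/
lemma IsSample.mul_measure_le_setLIntegral {x : ℕ → X → Ω} (h : IsSample π P x)
    {f : Ω → Ω → ℝ≥0∞} (hf : Measurable (Function.uncurry f)) {t : ℝ≥0∞} {n : ℕ} {E : Set (ℕ → Ω)}
    (hE : MeasurableSet E) (hlt : ∀ y ∈ E, t * n ^ 2 < offDiagSum f fun i : Fin n => y i)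
    (hinv : ∀ a b, a < n → b < n → ∀ y, (fun i => y (Equiv.swap a b i)) ∈ E ↔ y ∈ E) :
    t * P {ω | (fun i => x i ω) ∈ E} ≤
      ∫⁻ ω in {ω | (fun i => x i ω) ∈ E}, f (x 0 ω) (x 1 ω) ∂P := by
  have hm : Measurable fun ω => fun i => x i ω := measurable_pi_lambda _ h.measurable
  have hmij : ∀ i j : Fin n, Measurable fun ω =>
      if i = j then 0 else f (x i ω) (x j ω) := fun i j => by
    split_ifs
    · exact measurable_const
    · exact (measurable_eval_pair hf (i : ℕ) j).comp hm
  rcases Nat.eq_zero_or_pos n with rfl | hn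
  · have : {ω | (fun i => x i ω) ∈ E} = ∅ := by
      refine Set.eq_empty_iff_forall_notMem.2 fun ω h1 => ?_
      have h2 := hlt _ h1
      simp [offDiagSum] at h2
    rw [this]; simp
  have h1 : t * n ^ 2 * P {ω | (fun i => x i ω) ∈ E} ≤
      ∫⁻ ω in {ω | (fun i => x i ω) ∈ E}, offDiagSum f (fun i : Fin n => x i ω) ∂P := by
    rw [← setLIntegral_const]
    refine setLIntegral_mono (Finset.measurable_fun_sum _ fun i _ =>
      Finset.measurable_fun_sum _ fun j _ => hmij i j) fun ω h1 => (hlt _ h1).le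
  have h2 : ∫⁻ ω in {ω | (fun i => x i ω) ∈ E}, offDiagSum f (fun i : Fin n => x i ω) ∂P ≤
      n ^ 2 * ∫⁻ ω in {ω | (fun i => x i ω) ∈ E}, f (x 0 ω) (x 1 ω) ∂P := by
    simp only [offDiagSum]
    rw [lintegral_finsetSum _ fun i _ => Finset.measurable_fun_sum _ fun j _ => hmij i j]
    simp only [fun i => lintegral_finsetSum (μ := P.restrict {ω | (fun i => x i ω) ∈ E})
      Finset.univ fun j _ => hmij i j]
    calc _ ≤ ∑ i : Fin n, ∑ j : Fin n,
          ∫⁻ ω in {ω | (fun i => x i ω) ∈ E}, f (x 0 ω) (x 1 ω) ∂P := by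
          refine Finset.sum_le_sum fun i _ => Finset.sum_le_sum fun j _ => ?_
          by_cases hij : i = j
          · simp [hij]
          · simp only [hij, if_false]
            exact (h.setLIntegral_pair_eq hf hE hinv i.2 j.2 fun h => hij (Fin.ext h)).le
      _ = _ := by simp; ring
  have h3 := h1.trans h2
  have hn2 : ((n : ℝ≥0∞) ^ 2) ≠ 0 := by simp; omega
  have hn3 : ((n : ℝ≥0∞) ^ 2) ≠ ∞ := by simp
  rw [mul_comm t, mul_assoc] at h3
  exact (ENNReal.mul_le_mul_iff_right hn2 hn3).1 h3

/-- A maximal inequality for the averages of `f` over pairs of sample points. -/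
lemma IsSample.measure_exists_offDiagSum_gt_le {x : ℕ → X → Ω} (h : IsSample π P x)
    {f : Ω → Ω → ℝ≥0∞} (hf : Measurable (Function.uncurry f)) {t : ℝ≥0∞} :
    t * P {ω | ∃ n : ℕ, t * n ^ 2 < offDiagSum f (fun i : Fin n => x i ω)} ≤
      ∫⁻ z, f z.1 z.2 ∂(π.prod π) := by
  have hS : ∀ n : ℕ, Measurable fun y : ℕ → Ω => offDiagSum f fun i : Fin n => y i := fun n =>
    (measurable_offDiagSum hf).comp (measurable_pi_lambda _ fun i => measurable_pi_apply _)
  have hSx : ∀ n : ℕ, Measurable fun ω => offDiagSum f fun i : Fin n => x i ω := fun n =>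
    (measurable_offDiagSum hf).comp (measurable_pi_lambda _ fun i => h.measurable i)
  have hN : ∀ N : ℕ, t * P {ω | ∃ n ≤ N, t * (n : ℝ≥0∞) ^ 2 <
      offDiagSum f fun i : Fin n => x i ω} ≤ ∫⁻ z, f z.1 z.2 ∂(π.prod π) := by
    intro N
    rw [← h.lintegral_pair zero_ne_one hf]
    refine mul_measure_exists_lt_le (S := fun n ω => offDiagSum f fun i : Fin n => x i ω)
      (c := fun n => t * (n : ℝ≥0∞) ^ 2) hSx fun n => ?_
    -- The event involves only sums over the first `m ≥ n` points, which permutations of the first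
    -- `n` points do not change. Decomposing by the first exceedance instead would involve earlier
    -- sums and lose this symmetry.
    refine h.mul_measure_le_setLIntegral hf (n := n)
      (E := {y | t * (n : ℝ≥0∞) ^ 2 < offDiagSum f (fun i : Fin n => y i) ∧
        ∀ m ∈ Finset.Ioc n N, offDiagSum f (fun i : Fin m => y i) ≤ t * (m : ℝ≥0∞) ^ 2})
      ?_ (fun y hy => hy.1) fun a b ha hb y => ?_
    · have : {y : ℕ → Ω | t * (n : ℝ≥0∞) ^ 2 < offDiagSum f (fun i : Fin n => y i) ∧
          ∀ m ∈ Finset.Ioc n N, offDiagSum f (fun i : Fin m => y i) ≤ t * (m : ℝ≥0∞) ^ 2} =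
          {y | t * (n : ℝ≥0∞) ^ 2 < offDiagSum f (fun i : Fin n => y i)} ∩
          ⋂ m ∈ Finset.Ioc n N, {y | offDiagSum f (fun i : Fin m => y i) ≤ t * (m : ℝ≥0∞) ^ 2} := by
        ext y; simp
      rw [this]
      exact (measurableSet_lt measurable_const (hS n)).inter
        (Finset.measurableSet_biInter _ fun m _ => measurableSet_le (hS m) measurable_const)
    · simp only [Set.mem_ofPred_eq]
      rw [offDiagSum_perm f y (swap_lt_iff ha hb)]
      refine and_congr Iff.rfl (forall₂_congr fun m hm => ?_)
      have hnm := (Finset.mem_Ioc.1 hm).1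
      rw [offDiagSum_perm f y (swap_lt_iff (ha.trans hnm) (hb.trans hnm))]
  have hU : {ω | ∃ n : ℕ, t * n ^ 2 < offDiagSum f (fun i : Fin n => x i ω)} =
      ⋃ N : ℕ, {ω | ∃ n ≤ N, t * (n : ℝ≥0∞) ^ 2 < offDiagSum f fun i : Fin n => x i ω} := by
    ext ω
    simp only [Set.mem_ofPred_eq, Set.mem_iUnion]
    exact ⟨fun ⟨n, hn⟩ => ⟨n, n, le_rfl, hn⟩, fun ⟨_, n, _, hn⟩ => ⟨n, hn⟩⟩
  have hmono : Monotone fun N : ℕ =>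
      {ω | ∃ n ≤ N, t * (n : ℝ≥0∞) ^ 2 < offDiagSum f fun i : Fin n => x i ω} :=
    fun N M hNM ω ⟨n, hn, hlt⟩ => ⟨n, hn.trans hNM, hlt⟩
  rw [hU, hmono.measure_iUnion, ENNReal.mul_iSup]
  exact iSup_le hN

/-- The maximal inequality with threshold `2 ^ (-m)` bounds the probability of failure for some `n`
by `2 ^ (-m)`. Borel–Cantelli in `m` then gives a bound uniform in `n`, so no rate in the sample
size is needed. -/
lemma IsSample.ae_eventually_offDiagSum_le {x : ℕ → X → Ω} (h : IsSample π P x)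
    {f : ℕ → Ω → Ω → ℝ≥0∞} (hf : ∀ m, Measurable (Function.uncurry (f m)))
    (hint : ∀ m, ∫⁻ z, f m z.1 z.2 ∂(π.prod π) ≤ (1 / 4) ^ m) :
    ∀ᵐ ω ∂P, ∀ᶠ m in atTop, ∀ n : ℕ,
      offDiagSum (f m) (fun i : Fin n => x i ω) ≤ (1 / 2) ^ m * n ^ 2 := by
  have h1 : ∀ m : ℕ, P {ω | ∃ n : ℕ, (1 / 2 : ℝ≥0∞) ^ m * n ^ 2 <
      offDiagSum (f m) (fun i : Fin n => x i ω)} ≤ (1 / 2) ^ m := by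
    intro m
    have h2 := (h.measure_exists_offDiagSum_gt_le (hf m) (t := (1 / 2) ^ m)).trans (hint m)
    have e : (1 / 4 : ℝ≥0∞) ^ m = (1 / 2) ^ m * (1 / 2) ^ m := by
      rw [← mul_pow]
      congr 1
      rw [one_div, one_div, ← ENNReal.mul_inv (by simp) (by simp)]
      norm_num
    rw [e] at h2
    have hpos : (1 / 2 : ℝ≥0∞) ^ m ≠ 0 := by simp
    have htop : (1 / 2 : ℝ≥0∞) ^ m ≠ ∞ := by simp
    exact (ENNReal.mul_le_mul_iff_right hpos htop).1 h2
  have hsum : ∑' m : ℕ, P {ω | ∃ n : ℕ, (1 / 2 : ℝ≥0∞) ^ m * n ^ 2 <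
      offDiagSum (f m) (fun i : Fin n => x i ω)} ≠ ∞ := by
    refine ne_top_of_le_ne_top ?_ (ENNReal.tsum_le_tsum h1)
    rw [ENNReal.tsum_geometric]
    simp
  filter_upwards [ae_eventually_notMem hsum] with ω hω
  filter_upwards [hω] with m hm n
  exact not_lt.1 fun hlt => hm ⟨n, hlt⟩

end sample

/-! ## The distance of a sampled matrix to the graphon -/

section couplingWeights

variable {n k : ℕ}

/-- The uniform distribution on `n` points. -/
noncomputable def uniformWeight (n : ℕ) : Measure (Fin n) := weightMeasure fun _ => 1 / (n : ℝ)

lemma isProbabilityMeasure_uniformWeight (hn : 0 < n) :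
    IsProbabilityMeasure (uniformWeight n) :=
  isProbabilityMeasure_weightMeasure (fun _ => by positivity) (by
    have : (n : ℝ) ≠ 0 := Nat.cast_ne_zero.2 hn.ne'
    simp [this])

lemma deltaDist_le_of_weights {w : Fin n → Fin k → ℝ} (hw : ∀ i a, 0 ≤ w i a)
    (H : Fin n → Fin n → ℝ) (B : Fin k → Fin k → ℝ) :
    deltaDist 2 (weightMeasure fun i => ∑ a, w i a) H (weightMeasure fun a => ∑ i, w i a) B ≤
      ENNReal.ofReal (Real.sqrt (∑ i, ∑ j, ∑ a, ∑ b, w i a * w j b * (H i j - B a b) ^ 2)) := by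
  have hw' : ∀ z : Fin n × Fin k, 0 ≤ (fun z : Fin n × Fin k => w z.1 z.2) z := fun z => hw _ _
  have m1 : (weightMeasure fun i => ∑ a, w i a) =
      (weightMeasure fun z : Fin n × Fin k => w z.1 z.2).map Prod.fst := by
    rw [map_weightMeasure hw']
    congr 1; ext i
    rw [Fintype.sum_prod_type, Finset.sum_eq_single i] <;> simp +contextual
  have m2 : (weightMeasure fun a => ∑ i, w i a) =
      (weightMeasure fun z : Fin n × Fin k => w z.1 z.2).map Prod.snd := by
    rw [map_weightMeasure hw']
    congr 1; ext a
    rw [Fintype.sum_prod_type_right, Finset.sum_eq_single a] <;> simp +contextual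
  rw [m1, m2]
  refine (deltaDist_le_of_map measurable_fst measurable_snd (measurable_uncurry_of_finite H)
    (measurable_uncurry_of_finite B)).trans ?_
  rw [eLpNorm_prod_weightMeasure hw' (fun z z' => H z.1 z'.1 - B z.2 z'.2), weightedNorm]
  refine ENNReal.ofReal_le_ofReal (Real.sqrt_le_sqrt (le_of_eq ?_))
  simp only [Fintype.sum_prod_type]
  refine Finset.sum_congr rfl fun i _ => ?_
  rw [Finset.sum_comm]

lemma exists_weights_of_deltaDist_lt {H : Fin n → Fin n → ℝ} {B : Fin k → Fin k → ℝ}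
    {p : Fin n → ℝ} {p' : Fin k → ℝ} (hp : ∀ i, 0 ≤ p i) (hp1 : ∑ i, p i = 1)
    (hp' : ∀ a, 0 ≤ p' a) {c : ℝ}
    (h : deltaDist 2 (weightMeasure p) H (weightMeasure p') B < ENNReal.ofReal c) :
    ∃ w : Fin n → Fin k → ℝ, (∀ i a, 0 ≤ w i a) ∧ (∀ i, ∑ a, w i a = p i) ∧
      (∀ a, ∑ i, w i a = p' a) ∧
      ∑ i, ∑ j, ∑ a, ∑ b, w i a * w j b * (H i j - B a b) ^ 2 ≤ c ^ 2 := by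
  have := isProbabilityMeasure_weightMeasure hp hp1
  simp only [deltaDist, iInf_lt_iff] at h
  obtain ⟨ν, hν, hlt⟩ := h
  have := hν.isProbabilityMeasure
  set w : Fin n × Fin k → ℝ := fun z => (ν {z}).toReal
  have hw : ∀ z, 0 ≤ w z := fun z => ENNReal.toReal_nonneg
  have hνw : ν = weightMeasure w := eq_weightMeasure ν
  rw [hνw] at hν hlt
  obtain ⟨h1, h2⟩ := hν
  rw [map_weightMeasure hw] at h1 h2
  refine ⟨fun i a => w (i, a), fun i a => hw _, fun i => ?_, fun a => ?_, ?_⟩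
  · have h3 := congrArg (fun μ => μ {i}) h1
    simp only [weightMeasure_singleton] at h3
    rw [ENNReal.ofReal_eq_ofReal_iff (Finset.sum_nonneg fun z _ => by
      split_ifs <;> simp [hw]) (hp i), Fintype.sum_prod_type, Finset.sum_eq_single i] at h3
    · simpa using h3
    · intro j _ hj; simp [hj]
    · simp
  · have h3 := congrArg (fun μ => μ {a}) h2
    simp only [weightMeasure_singleton] at h3
    rw [ENNReal.ofReal_eq_ofReal_iff (Finset.sum_nonneg fun z _ => by
      split_ifs <;> simp [hw]) (hp' a), Fintype.sum_prod_type_right, Finset.sum_eq_single a] at h3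
    · simpa using h3
    · intro j _ hj; simp [hj]
    · simp
  · rw [eLpNorm_prod_weightMeasure hw (fun z z' => H z.1 z'.1 - B z.2 z'.2)] at hlt
    have h4 := (ENNReal.ofReal_lt_ofReal_iff_of_nonneg (weightedNorm_nonneg _ _)).1 hlt
    have h5 := pow_le_pow_left₀ (weightedNorm_nonneg _ _) h4.le 2
    rw [weightedNorm_sq hw] at h5
    refine le_trans (le_of_eq ?_) h5
    simp only [Fintype.sum_prod_type]
    refine Finset.sum_congr rfl fun i _ => ?_
    rw [Finset.sum_comm]

end couplingWeights

/-! ### Fractional labels of sample points and the resulting coupling -/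

section sampledMatrix

variable {Ω : Type*} [MeasurableSpace Ω] {π : Measure Ω} [IsProbabilityMeasure π] {n k : ℕ}

/-- The conditional distributions of the labels given the point of `Ω` in a coupling. -/
lemma IsCoupling.exists_fractional_labels {p : Fin k → ℝ} {ν : Measure (Fin k × Ω)}
    (hp : ∀ a, 0 ≤ p a) (hp1 : ∑ a, p a = 1) (hν : IsCoupling ν (weightMeasure p) π) :
    ∃ q : Fin k → Ω → ℝ, (∀ a, Measurable (q a)) ∧ (∀ a x, 0 ≤ q a x) ∧ (∀ x, ∑ a, q a x = 1) ∧
      (∀ f : Fin k × Ω → ℝ≥0∞, Measurable f →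
        ∫⁻ z, f z ∂ν = ∫⁻ x, ∑ a, ENNReal.ofReal (q a x) * f (a, x) ∂π) ∧
      ∀ a, ∫⁻ x, ENNReal.ofReal (q a x) ∂π = ENNReal.ofReal (p a) := by
  have := isProbabilityMeasure_weightMeasure hp hp1
  have := hν.isProbabilityMeasure
  have : Nonempty (Fin k) := by
    by_contra h
    rw [not_nonempty_iff] at h
    simp at hp1
  -- It is the block that is conditioned on the point of `Ω`. The set of blocks is finite, so the
  -- disintegration exists whatever `Ω` is.
  set κ := (ν.map Prod.swap).condKernel
  have hκ : π ⊗ₘ κ = ν.map Prod.swap := by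
    have h := (ν.map Prod.swap).disintegrate κ
    rwa [Measure.fst, Measure.map_map measurable_fst measurable_swap,
      show (Prod.fst ∘ Prod.swap : Fin k × Ω → Ω) = Prod.snd from rfl, hν.2] at h
  have hofReal : ∀ a x, ENNReal.ofReal (κ x {a}).toReal = κ x {a} := fun a x =>
    ENNReal.ofReal_toReal (measure_ne_top _ _)
  have hf : ∀ f : Fin k × Ω → ℝ≥0∞, Measurable f →
      ∫⁻ z, f z ∂ν = ∫⁻ x, ∑ a, ENNReal.ofReal (κ x {a}).toReal * f (a, x) ∂π := by
    intro f hf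
    have hfs : Measurable fun z : Ω × Fin k => f z.swap := hf.comp measurable_swap
    have h1 : ∫⁻ z, f z.swap ∂(ν.map Prod.swap) = ∫⁻ z, f z ∂ν := by
      rw [lintegral_map hfs measurable_swap]
      simp
    rw [← h1, ← hκ, Measure.lintegral_compProd hfs]
    refine lintegral_congr fun x => ?_
    simp only [hofReal, lintegral_fintype, Prod.swap_prod_mk, mul_comm]
  refine ⟨fun a x => (κ x {a}).toReal, fun a =>
    (κ.measurable_coe (measurableSet_singleton a)).ennreal_toReal,
    fun a x => ENNReal.toReal_nonneg, fun x => ?_, hf, fun a => ?_⟩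
  · rw [← ENNReal.toReal_sum fun a _ => measure_ne_top _ _]
    have : ∑ a, κ x {a} = 1 := by
      rw [sum_measure_singleton]; simp
    rw [this]; rfl
  · have h1 := hf (fun z => if z.1 = a then 1 else 0) (by
      refine Measurable.ite ?_ measurable_const measurable_const
      exact measurable_fst (measurableSet_singleton a))
    simp only [mul_ite, mul_one, mul_zero, Finset.sum_ite_eq', Finset.mem_univ, if_true] at h1
    rw [← h1, ← weightMeasure_singleton, ← hν.1,
      Measure.map_apply measurable_fst (measurableSet_singleton a),
      ← lintegral_indicator_one (measurable_fst (measurableSet_singleton a))]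
    refine lintegral_congr fun z => ?_
    simp [Set.indicator_apply]

/-- The matrix of values of `W` at the pairs of different sample points. -/
def sampledMatrix {Ω : Type*} (W : Ω → Ω → ℝ) (y : Fin n → Ω) : Matrix (Fin n) (Fin n) ℝ :=
  fun i j => if i = j then 0 else W (y i) (y j)

/-- The conditional expected squared difference of `W` and `B` when labels are drawn
according to `q`. -/
noncomputable def labelledDiff {Ω : Type*} (W : Ω → Ω → ℝ) (B : Fin k → Fin k → ℝ)
    (q : Fin k → Ω → ℝ) (x y : Ω) : ℝ :=
  ∑ a, ∑ b, q a x * q b y * (W x y - B a b) ^ 2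

lemma labelledDiff_nonneg {Ω : Type*} {W : Ω → Ω → ℝ} {B : Fin k → Fin k → ℝ}
    {q : Fin k → Ω → ℝ} (hq : ∀ a x, 0 ≤ q a x) (x y : Ω) : 0 ≤ labelledDiff W B q x y :=
  Finset.sum_nonneg fun a _ => Finset.sum_nonneg fun b _ =>
    mul_nonneg (mul_nonneg (hq a x) (hq b y)) (sq_nonneg _)

lemma measurable_labelledDiff {W : Ω → Ω → ℝ} (hW : Measurable (Function.uncurry W))
    {B : Fin k → Fin k → ℝ} {q : Fin k → Ω → ℝ} (hq : ∀ a, Measurable (q a)) :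
    Measurable (Function.uncurry (labelledDiff W B q)) := by
  have h : Measurable fun z : Ω × Ω => ∑ a, ∑ b, q a z.1 * q b z.2 * (W z.1 z.2 - B a b) ^ 2 :=
    Finset.measurable_fun_sum _ fun a _ => Finset.measurable_fun_sum _ fun b _ => by
      have h1 : Measurable fun z : Ω × Ω => q a z.1 := (hq a).comp measurable_fst
      have h2 : Measurable fun z : Ω × Ω => q b z.2 := (hq b).comp measurable_snd
      have h3 : Measurable fun z : Ω × Ω => W z.1 z.2 := hW
      fun_prop
  exact h

/-- Under `ν ⊗ ν` the two blocks are conditionally independent given the two points of `Ω`, so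
integrating them out of the coupling cost leaves exactly the averaged squared difference. -/
lemma lintegral_labelledDiff {W : Ω → Ω → ℝ} (hW : Measurable (Function.uncurry W))
    {B : Fin k → Fin k → ℝ} {q : Fin k → Ω → ℝ} (hq : ∀ a, Measurable (q a))
    (hq0 : ∀ a x, 0 ≤ q a x) {ν : Measure (Fin k × Ω)} [SFinite ν]
    (hf : ∀ f : Fin k × Ω → ℝ≥0∞, Measurable f →
      ∫⁻ z, f z ∂ν = ∫⁻ x, ∑ a, ENNReal.ofReal (q a x) * f (a, x) ∂π) :
    ∫⁻ z, ENNReal.ofReal (labelledDiff W B q z.1 z.2) ∂(π.prod π) =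
      eLpNorm (fun z : (Fin k × Ω) × (Fin k × Ω) => B z.1.1 z.2.1 - W z.1.2 z.2.2) 2
        (ν.prod ν) ^ 2 := by
  have hm := measurable_coupling_diff (measurable_uncurry_of_finite B) hW
  have hm2 : Measurable fun z : (Fin k × Ω) × (Fin k × Ω) =>
      ENNReal.ofReal ((B z.1.1 z.2.1 - W z.1.2 z.2.2) ^ 2) := (hm.pow_const 2).ennreal_ofReal
  have hm3 : Measurable fun z : Ω × Ω => ENNReal.ofReal (labelledDiff W B q z.1 z.2) :=
    (measurable_labelledDiff hW hq).ennreal_ofReal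
  rw [eLpNorm_two_sq, lintegral_prod _ hm2.aemeasurable, hf _ hm2.lintegral_prod_right',
    lintegral_prod _ hm3.aemeasurable]
  refine lintegral_congr fun x => ?_
  have h1 : ∀ a, ∫⁻ z, ENNReal.ofReal ((B a z.1 - W x z.2) ^ 2) ∂ν =
      ∫⁻ y, ∑ b, ENNReal.ofReal (q b y) * ENNReal.ofReal ((B a b - W x y) ^ 2) ∂π := fun a =>
    hf _ (hm2.comp (measurable_prodMk_left (x := (a, x))))
  have hmy : ∀ a b, Measurable fun y => ENNReal.ofReal (q b y) *
      ENNReal.ofReal ((B a b - W x y) ^ 2) := fun a b =>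
    (hq b).ennreal_ofReal.mul (((measurable_const.sub
      (hW.comp measurable_prodMk_left)).pow_const 2).ennreal_ofReal)
  simp only [h1]
  simp only [← fun a => lintegral_const_mul (μ := π) (ENNReal.ofReal (q a x))
    (Finset.measurable_fun_sum Finset.univ fun b _ => hmy a b)]
  rw [← lintegral_finsetSum _ fun a _ => (Finset.measurable_fun_sum _ fun b _ => hmy a b).const_mul _]
  refine lintegral_congr fun y => ?_
  rw [labelledDiff, ENNReal.ofReal_sum_of_nonneg fun a _ => Finset.sum_nonneg fun b _ =>
    mul_nonneg (mul_nonneg (hq0 a x) (hq0 b y)) (sq_nonneg _)]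
  refine Finset.sum_congr rfl fun a _ => ?_
  rw [ENNReal.ofReal_sum_of_nonneg fun b _ =>
    mul_nonneg (mul_nonneg (hq0 a x) (hq0 b y)) (sq_nonneg _), Finset.mul_sum]
  refine Finset.sum_congr rfl fun b _ => ?_
  rw [ENNReal.ofReal_mul (mul_nonneg (hq0 a x) (hq0 b y)), ENNReal.ofReal_mul (hq0 a x), mul_assoc,
    sub_sq_comm]

/-- The average of the label distributions at the sample points. -/
noncomputable def empiricalWeight {Ω : Type*} (q : Fin k → Ω → ℝ) (y : Fin n → Ω) (a : Fin k) : ℝ :=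
  ∑ i, q a (y i) / n

/-- The distance of the sampled matrix to the graphon is controlled by a pair average and the
deviation of the empirical label weights. -/
lemma deltaDist_sampledMatrix_le (hn : 0 < n) {W : Ω → Ω → ℝ}
    (hW : Measurable (Function.uncurry W)) {B : Fin k → Fin k → ℝ} (hB : ∀ a b, B a b = B b a)
    {p : Fin k → ℝ} (hp : ∀ a, 0 ≤ p a) (hp1 : ∑ a, p a = 1)
    {q : Fin k → Ω → ℝ} (hq0 : ∀ a x, 0 ≤ q a x) (hq1 : ∀ x, ∑ a, q a x = 1) (y : Fin n → Ω) :
    deltaDist 2 (uniformWeight n) (sampledMatrix W y) π W ≤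
      2 * (offDiagSum (fun x x' => ENNReal.ofReal (labelledDiff W B q x x')) y / n ^ 2 +
        ENNReal.ofReal (1 / n * ∑ a, ∑ b, empiricalWeight q y a * B a b ^ 2 +
          transportCost (empiricalWeight q y) p B)) ^ (1 / 2 : ℝ) +
      deltaDist 2 (weightMeasure p) B π W := by
  have hn' : (0 : ℝ) < n := Nat.cast_pos.2 hn
  have hprob := isProbabilityMeasure_uniformWeight hn
  have : Nonempty (Fin n) := ⟨⟨0, hn⟩⟩
  have : Nonempty (Fin k) := by
    by_contra h
    rw [not_nonempty_iff] at h
    simp at hp1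
  set ph := empiricalWeight q y
  have hph0 : ∀ a, 0 ≤ ph a := fun a => Finset.sum_nonneg fun i _ => div_nonneg (hq0 _ _) hn'.le
  have hph1 : ∑ a, ph a = 1 := by
    simp only [ph, empiricalWeight]
    rw [Finset.sum_comm]
    simp only [← Finset.sum_div, hq1]
    simp [hn.ne']
  have hpp := isProbabilityMeasure_weightMeasure hp hp1
  have hpph := isProbabilityMeasure_weightMeasure hph0 hph1
  -- This couples the uniform measure on the sample with the empirical block weights, which are
  -- close to but different from `p`.
  set w : Fin n → Fin k → ℝ := fun i a => q a (y i) / n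
  have hw : ∀ i a, 0 ≤ w i a := fun i a => div_nonneg (hq0 _ _) hn'.le
  have hw1 : ∀ i, ∑ a, w i a = 1 / n := fun i => by simp only [w, ← Finset.sum_div, hq1]
  set H := sampledMatrix W y
  set U := offDiagSum (fun x x' => ENNReal.ofReal (labelledDiff W B q x x')) y
  set D := 1 / (n : ℝ) * ∑ a, ∑ b, ph a * B a b ^ 2
  set T := transportCost ph p B
  have hD0 : 0 ≤ D := mul_nonneg (by positivity) (Finset.sum_nonneg fun a _ =>
    Finset.sum_nonneg fun b _ => mul_nonneg (hph0 a) (sq_nonneg _))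
  have hT0 : 0 ≤ T := by
    refine mul_nonneg (by norm_num) (Finset.sum_nonneg fun a _ => Finset.sum_nonneg fun b _ => ?_)
    have := hph0 b; have := hp b; positivity
  have h1 : deltaDist 2 (uniformWeight n) H (weightMeasure ph) B ≤
      (U / n ^ 2 + ENNReal.ofReal (D + T)) ^ (1 / 2 : ℝ) := by
    have h2 := deltaDist_le_of_weights hw H B
    simp only [hw1] at h2
    refine h2.trans ?_
    rw [Real.sqrt_eq_rpow, ← ENNReal.ofReal_rpow_of_nonneg (Finset.sum_nonneg fun i _ =>
      Finset.sum_nonneg fun j _ => Finset.sum_nonneg fun a _ => Finset.sum_nonneg fun b _ =>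
        mul_nonneg (mul_nonneg (hw i a) (hw j b)) (sq_nonneg _)) (by norm_num)]
    refine ENNReal.rpow_le_rpow ?_ (by norm_num)
    -- Off the diagonal the coupling cost is the labelled difference divided by `n²`. On the
    -- diagonal `H` vanishes, and one of the two weights is bounded by `1/n`.
    have h3 : ∀ i j, ∑ a, ∑ b, w i a * w j b * (H i j - B a b) ^ 2 ≤
        (if i = j then 0 else labelledDiff W B q (y i) (y j)) / n ^ 2 +
        if i = j then 1 / (n : ℝ) * ∑ a, ∑ b, w i a * B a b ^ 2 else 0 := by
      intro i j
      by_cases hij : i = j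
      · subst hij
        simp only [if_true, zero_div, zero_add, H, sampledMatrix, Finset.mul_sum]
        refine Finset.sum_le_sum fun a _ => Finset.sum_le_sum fun b _ => ?_
        have : w i b ≤ 1 / n := by
          rw [← hw1 i]
          exact Finset.single_le_sum (fun c _ => hw i c) (Finset.mem_univ b)
        have h4 := mul_le_mul_of_nonneg_right this (mul_nonneg (hw i a) (sq_nonneg (B a b)))
        nlinarith
      · simp only [hij, if_false, add_zero, H, sampledMatrix, labelledDiff, Finset.sum_div]
        refine le_of_eq (Finset.sum_congr rfl fun a _ => Finset.sum_congr rfl fun b _ => ?_)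
        simp only [w]
        field_simp
    have h5 : ∑ i, ∑ j, ∑ a, ∑ b, w i a * w j b * (H i j - B a b) ^ 2 ≤
        (∑ i, ∑ j, if i = j then 0 else labelledDiff W B q (y i) (y j)) / n ^ 2 + D := by
      refine (Finset.sum_le_sum fun i _ => Finset.sum_le_sum fun j _ => h3 i j).trans
        (le_of_eq ?_)
      simp only [Finset.sum_add_distrib, ← Finset.sum_div, Finset.sum_ite_eq, Finset.mem_univ,
        if_true, ← Finset.mul_sum]
      congr 2
      rw [Finset.sum_comm]
      refine Finset.sum_congr rfl fun a _ => ?_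
      rw [← Finset.sum_mul, ← Finset.mul_sum]
      rfl
    have hL0 : ∀ i j, 0 ≤ if i = j then 0 else labelledDiff W B q (y i) (y j) := fun i j => by
      split_ifs
      · exact le_rfl
      · exact labelledDiff_nonneg hq0 _ _
    have h6 : ENNReal.ofReal ((∑ i, ∑ j, if i = j then 0 else labelledDiff W B q (y i) (y j)) /
        n ^ 2) = U / n ^ 2 := by
      rw [ENNReal.ofReal_div_of_pos (by positivity), ENNReal.ofReal_pow hn'.le,
        ENNReal.ofReal_natCast, ENNReal.ofReal_sum_of_nonneg fun i _ =>
          Finset.sum_nonneg fun j _ => hL0 i j]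
      congr 1
      refine Finset.sum_congr rfl fun i _ => ?_
      rw [ENNReal.ofReal_sum_of_nonneg fun j _ => hL0 i j]
      refine Finset.sum_congr rfl fun j _ => ?_
      split_ifs <;> simp
    refine (ENNReal.ofReal_le_ofReal h5).trans ?_
    rw [ENNReal.ofReal_add (div_nonneg (Finset.sum_nonneg fun i _ => Finset.sum_nonneg
      fun j _ => hL0 i j) (by positivity)) hD0, h6]
    gcongr
    linarith
  have h2 : deltaDist 2 (weightMeasure ph) B (weightMeasure p) B ≤
      (U / n ^ 2 + ENNReal.ofReal (D + T)) ^ (1 / 2 : ℝ) := by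
    refine (deltaDist_weightMeasure_le hph0 hp (hph1.trans hp1.symm) hB).trans ?_
    rw [Real.sqrt_eq_rpow, ← ENNReal.ofReal_rpow_of_nonneg hT0 (by norm_num)]
    refine ENNReal.rpow_le_rpow (le_add_left (ENNReal.ofReal_le_ofReal ?_)) (by norm_num)
    linarith
  have hmH := measurable_uncurry_of_finite H
  have hmB := measurable_uncurry_of_finite B
  -- Go from `H` to `B` with the empirical weights, then to `B` with the weights `p`, then to `W`.
  -- The first two distances are bounded by the same root, whence the factor `2`.
  calc _ ≤ deltaDist 2 (uniformWeight n) H (weightMeasure ph) B +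
        deltaDist 2 (weightMeasure ph) B π W := deltaDist_triangle (by norm_num) hmH hmB hW
    _ ≤ deltaDist 2 (uniformWeight n) H (weightMeasure ph) B +
        (deltaDist 2 (weightMeasure ph) B (weightMeasure p) B +
          deltaDist 2 (weightMeasure p) B π W) := by
        gcongr
        exact deltaDist_triangle (by norm_num) hmB hmB hW
    _ ≤ _ := by
        rw [← add_assoc, two_mul]
        gcongr

end sampledMatrix

/-! ### Moment bounds for a sample of fixed size -/

section sampling

variable {Ω : Type*} [MeasurableSpace Ω] {π : Measure Ω} [IsProbabilityMeasure π]
  {X : Type*} [MeasurableSpace X] {P : Measure X} [IsProbabilityMeasure P] {n k : ℕ}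

lemma IsSample.integral_comp {ι : Type*} {x : ι → X → Ω} (h : IsSample π P x) (i : ι)
    {g : Ω → ℝ} (hg : Measurable g) : ∫ ω, g (x i ω) ∂P = ∫ y, g y ∂π := by
  rw [← h.law i, integral_map (h.measurable i).aemeasurable hg.aestronglyMeasurable]

lemma IsSample.integral_average {x : Fin n → X → Ω} (h : IsSample π P x) (hn : 0 < n)
    {g : Ω → ℝ} (hg : Measurable g) (h0 : ∀ y, 0 ≤ g y) (h1 : ∀ y, g y ≤ 1) :
    ∫ ω, ∑ i, g (x i ω) / n ∂P = ∫ y, g y ∂π := by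
  have hi : ∀ i, Integrable (fun ω => g (x i ω) / n) P := fun i =>
    (Integrable.of_bound (C := 1) (hg.comp (h.measurable i)).aestronglyMeasurable
      (Eventually.of_forall fun ω => by
        simp only [Function.comp, Real.norm_eq_abs, abs_of_nonneg (h0 _), h1])).div_const _
  rw [integral_finsetSum _ fun i _ => hi i]
  simp only [integral_div, h.integral_comp _ hg]
  have : (n : ℝ) ≠ 0 := Nat.cast_ne_zero.2 hn.ne'
  simp; field_simp

/-- Variances of independent summands add, and `g² ≤ g` because `0 ≤ g ≤ 1`. Keeping the mean of `g`
as a factor makes the relative error of a block weight of order `1/(n κ)`. -/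
lemma IsSample.integral_average_sub_sq_le {x : Fin n → X → Ω} (h : IsSample π P x) (hn : 0 < n)
    {g : Ω → ℝ} (hg : Measurable g) (h0 : ∀ y, 0 ≤ g y) (h1 : ∀ y, g y ≤ 1) :
    ∫ ω, (∑ i, g (x i ω) / n - ∫ y, g y ∂π) ^ 2 ∂P ≤ (∫ y, g y ∂π) / n := by
  have hn' : (n : ℝ) ≠ 0 := Nat.cast_ne_zero.2 hn.ne'
  have hm : ∀ i, Measurable fun ω => g (x i ω) / n := fun i => (hg.comp (h.measurable i)).div_const _
  have hb : ∀ i ω, ‖g (x i ω) / n‖ ≤ 1 := fun i ω => by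
    rw [Real.norm_eq_abs, abs_of_nonneg (div_nonneg (h0 _) n.cast_nonneg)]
    exact div_le_one_of_le₀ ((h1 _).trans (by exact_mod_cast hn)) n.cast_nonneg
  have hL : ∀ i ∈ Finset.univ, MemLp (fun ω => g (x i ω) / n) 2 P := fun i _ =>
    MemLp.of_bound (hm i).aestronglyMeasurable 1 (Eventually.of_forall (hb i))
  have hs : MemLp (∑ i, fun ω => g (x i ω) / n) 2 P := memLp_finsetSum' _ hL
  have hind : Set.Pairwise (↑(Finset.univ : Finset (Fin n))) fun i j =>
      IndepFun (fun ω => g (x i ω) / n) (fun ω => g (x j ω) / n) P := fun i _ j _ hij =>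
    (h.indep.indepFun hij).comp (φ := fun y => g y / n) (ψ := fun y => g y / n)
      (hg.div_const _) (hg.div_const _)
  have hv := IndepFun.variance_sum hL hind
  have e : (∑ i, fun ω => g (x i ω) / n) = fun ω => ∑ i, g (x i ω) / n := by
    ext ω; simp
  rw [e] at hv
  rw [variance_eq_integral (by rw [← e]; exact hs.aestronglyMeasurable.aemeasurable),
    h.integral_average hn hg h0 h1] at hv
  rw [hv]
  have hi : Integrable g π := Integrable.of_bound (C := 1) hg.aestronglyMeasurable
    (Eventually.of_forall fun y => by rw [Real.norm_eq_abs, abs_of_nonneg (h0 _)]; exact h1 y)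
  calc _ ≤ ∑ i : Fin n, (∫ y, g y ∂π) / n ^ 2 := by
        refine Finset.sum_le_sum fun i _ => ?_
        refine (variance_le_expectation_sq (hm i).aestronglyMeasurable).trans ?_
        have e2 : ∫ ω, ((fun ω => g (x i ω) / n) ^ 2) ω ∂P = ∫ y, (g y / n) ^ 2 ∂π := by
          rw [← h.integral_comp i ((hg.div_const _).pow_const 2)]
          rfl
        rw [e2, ← integral_div]
        refine integral_mono_of_nonneg (Eventually.of_forall fun y => sq_nonneg _)
          (hi.div_const _) (Eventually.of_forall fun y => ?_)
        simp only [div_pow]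
        gcongr
        nlinarith [h0 y, h1 y]
    _ = _ := by simp; field_simp

/-- The mean of the error terms caused by the diagonal and by the empirical label weights. -/
lemma IsSample.integral_label_error_le {x : Fin n → X → Ω} (h : IsSample π P x) (hn : 0 < n)
    {q : Fin k → Ω → ℝ} (hq : ∀ a, Measurable (q a)) (hq0 : ∀ a x, 0 ≤ q a x)
    (hq1 : ∀ x, ∑ a, q a x = 1) {p : Fin k → ℝ} (hqp : ∀ a, ∫ x, q a x ∂π = p a)
    {κ η : ℝ} (hκ : 0 < κ) (hp : ∀ a, κ ≤ p a) (h0 : 0 < η) (h1 : η ≤ 1)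
    (hη : 1 / (n * κ) ≤ η ^ 2) (B : Fin k → Fin k → ℝ) :
    ∫⁻ ω, ENNReal.ofReal (1 / n * ∑ a, ∑ b, empiricalWeight q (fun i => x i ω) a * B a b ^ 2 +
        transportCost (empiricalWeight q fun i => x i ω) p B) ∂P ≤
      ENNReal.ofReal (33 * η * weightedNorm p B ^ 2) := by
  have hn' : (0 : ℝ) < n := Nat.cast_pos.2 hn
  have hp0 : ∀ a, 0 < p a := fun a => hκ.trans_le (hp a)
  have hqle : ∀ a x, q a x ≤ 1 := fun a y => by
    rw [← hq1 y]; exact Finset.single_le_sum (fun b _ => hq0 b y) (Finset.mem_univ a)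
  set ph : X → Fin k → ℝ := fun ω => empiricalWeight q fun i => x i ω
  have hphm : ∀ a, Measurable fun ω => ph ω a := fun a =>
    Finset.measurable_fun_sum _ fun i _ => ((hq a).comp (h.measurable i)).div_const _
  have hph0 : ∀ ω a, 0 ≤ ph ω a := fun ω a =>
    Finset.sum_nonneg fun i _ => div_nonneg (hq0 _ _) hn'.le
  have hph1 : ∀ ω a, ph ω a ≤ 1 := fun ω a => by
    calc ph ω a ≤ ∑ i : Fin n, 1 / (n : ℝ) :=
          Finset.sum_le_sum fun i _ => div_le_div_of_nonneg_right (hqle _ _) hn'.le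
      _ = 1 := by simp; field_simp
  have hp1 : ∀ a, p a ≤ 1 := fun a => by
    rw [← hqp a, ← h.integral_average hn (hq a) (hq0 a) (hqle a)]
    calc _ ≤ ∫ ω, (1 : ℝ) ∂P := integral_mono_of_nonneg (Eventually.of_forall fun ω => hph0 ω a)
            (integrable_const _) (Eventually.of_forall fun ω => hph1 ω a)
      _ = 1 := by simp
  have hphi : ∀ a, Integrable (fun ω => ph ω a) P := fun a =>
    Integrable.of_bound (C := 1) (hphm a).aestronglyMeasurable (Eventually.of_forall fun ω => by
      rw [Real.norm_eq_abs, abs_of_nonneg (hph0 _ _)]; exact hph1 ω a)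
  set Y : X → Fin k → ℝ := fun ω a => (ph ω a - p a) ^ 2 / p a ^ 2
  have hYi : ∀ a, Integrable (fun ω => Y ω a) P := fun a => by
    refine (Integrable.of_bound (C := 1) (((hphm a).sub_const _).pow_const 2).aestronglyMeasurable
      (Eventually.of_forall fun ω => ?_)).div_const _
    rw [Real.norm_eq_abs, abs_of_nonneg (sq_nonneg _), sq_le_one_iff_abs_le_one, abs_le]
    constructor <;> linarith [hph0 ω a, hph1 ω a, hp0 a, hp1 a]
  have hYint : ∀ a, ∫ ω, Y ω a ∂P ≤ η ^ 2 := fun a => by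
    have h2 := h.integral_average_sub_sq_le hn (hq a) (hq0 a) (hqle a)
    rw [hqp a] at h2
    rw [integral_div]
    calc _ ≤ p a / n / p a ^ 2 := div_le_div_of_nonneg_right h2 (sq_nonneg _)
      _ = 1 / (n * p a) := by have := hp0 a; field_simp
      _ ≤ 1 / (n * κ) := by
        have := hp a
        gcongr
      _ ≤ _ := hη
  have hI : ∀ (c₁ c₂ c₃ : ℝ) a b, Integrable (fun ω => c₁ * (c₂ * Y ω a + (Y ω b + c₃))) P :=
    fun c₁ c₂ c₃ a b => Integrable.const_mul (Integrable.add ((hYi a).const_mul _)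
      (Integrable.add (hYi b) (integrable_const _))) _
  have hai : Integrable (fun ω => affineCost η p B (Y ω)) P :=
    integrable_finsetSum _ fun a _ => integrable_finsetSum _ fun b _ => hI _ _ _ a b
  have hae : ∫ ω, affineCost η p B (Y ω) ∂P = affineCost η p B fun a => ∫ ω, Y ω a ∂P := by
    unfold affineCost
    rw [integral_finsetSum _ fun a _ => integrable_finsetSum _ fun b _ => hI _ _ _ a b]
    refine Finset.sum_congr rfl fun a _ => ?_
    rw [integral_finsetSum _ fun b _ => hI _ _ _ a b]
    refine Finset.sum_congr rfl fun b _ => ?_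
    rw [integral_const_mul]
    congr 1
    have h2 : Integrable (fun ω => Y ω b + (η ^ 2 / 2 + 9 / 2 * η)) P :=
      (hYi b).add (integrable_const _)
    rw [integral_add ((hYi a).const_mul _) h2, integral_const_mul,
      integral_add (hYi b) (integrable_const _)]
    simp
  have hdi : Integrable (fun ω => 1 / (n : ℝ) * ∑ a, ∑ b, ph ω a * B a b ^ 2) P :=
    (integrable_finsetSum _ fun a _ => integrable_finsetSum _ fun b _ =>
      (hphi a).mul_const _).const_mul _
  have hde : ∫ ω, 1 / (n : ℝ) * ∑ a, ∑ b, ph ω a * B a b ^ 2 ∂P ≤ η * weightedNorm p B ^ 2 := by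
    rw [integral_const_mul, integral_finsetSum _ fun a _ => integrable_finsetSum _ fun b _ =>
      (hphi a).mul_const _]
    have e : ∀ a, ∫ ω, ∑ b, ph ω a * B a b ^ 2 ∂P = ∑ b, p a * B a b ^ 2 := fun a => by
      rw [integral_finsetSum _ fun b _ => (hphi a).mul_const _]
      refine Finset.sum_congr rfl fun b _ => ?_
      rw [integral_mul_const]
      congr 1
      rw [← hqp a]
      exact h.integral_average hn (hq a) (hq0 a) (hqle a)
    simp only [e]
    rw [weightedNorm_sq fun a => (hp0 a).le, Finset.mul_sum, Finset.mul_sum]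
    refine Finset.sum_le_sum fun a _ => ?_
    rw [Finset.mul_sum, Finset.mul_sum]
    refine Finset.sum_le_sum fun b _ => ?_
    -- The diagonal term carries only one weight `p a`; this inequality trades the factor `1/n` for
    -- the missing weight `p b`.
    have h2 : 1 / (n : ℝ) ≤ η * p b := by
      have h3 : 1 / (n : ℝ) = κ * (1 / (n * κ)) := by field_simp
      rw [h3]
      calc _ ≤ κ * η ^ 2 := by gcongr
        _ ≤ p b * η := by
          have := hp b
          have := (hp0 b).le
          have h4 : η ^ 2 ≤ η := by nlinarith
          gcongr
        _ = _ := mul_comm _ _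
    have h5 := mul_le_mul_of_nonneg_right h2 (mul_nonneg (hp0 a).le (sq_nonneg (B a b)))
    linarith
  have haff := affineCost_le h0 h1 (fun a => (hp0 a).le) B hYint
  have hd0 : ∀ ω, 0 ≤ 1 / (n : ℝ) * ∑ a, ∑ b, ph ω a * B a b ^ 2 := fun ω =>
    mul_nonneg (by positivity) (Finset.sum_nonneg fun a _ => Finset.sum_nonneg fun b _ =>
      mul_nonneg (hph0 ω a) (sq_nonneg _))
  have ha0 : ∀ ω, 0 ≤ affineCost η p B (Y ω) := fun ω =>
    affineCost_nonneg h0 (fun a => (hp0 a).le) B fun a => by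
      exact div_nonneg (sq_nonneg _) (sq_nonneg _)
  calc _ ≤ ∫⁻ ω, ENNReal.ofReal (1 / (n : ℝ) * ∑ a, ∑ b, ph ω a * B a b ^ 2 +
        affineCost η p B (Y ω)) ∂P := by
        refine lintegral_mono fun ω => ENNReal.ofReal_le_ofReal ?_
        gcongr
        exact transportCost_le_affineCost h0 h1 hp0
          (fun a => by rw [sub_self, abs_zero]; exact mul_nonneg h0.le (hp0 a).le) B
    _ = ENNReal.ofReal (∫ ω, (1 / (n : ℝ) * ∑ a, ∑ b, ph ω a * B a b ^ 2 +
        affineCost η p B (Y ω)) ∂P) :=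
        (ofReal_integral_eq_lintegral_ofReal (hdi.add hai)
          (Eventually.of_forall fun ω => add_nonneg (hd0 ω) (ha0 ω))).symm
    _ ≤ _ := by
        refine ENNReal.ofReal_le_ofReal ?_
        rw [integral_add hdi hai, hae]
        linarith

/-- Markov's inequality. The strict inequality in the event keeps it true when the mean bound `c` is
`0`, as can happen for the tail of a bounded graphon. -/
lemma measure_lt_le_inv_of_lintegral_le {f : X → ℝ≥0∞} (hf : AEMeasurable f P) {c M : ℝ≥0∞}
    (h : ∫⁻ ω, f ω ∂P ≤ c) (hM : M ≠ 0) : P {ω | M * c < f ω} ≤ M⁻¹ := by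
  rcases eq_or_ne c ∞ with rfl | hc
  · simp [ENNReal.mul_top hM]
  rcases eq_or_ne c 0 with rfl | hc0
  · have h1 : P {ω | M * 0 < f ω} = 0 := by
      have := (lintegral_eq_zero_iff' hf).1 (le_antisymm h bot_le)
      rw [measure_eq_zero_iff_ae_notMem]
      filter_upwards [this] with ω hω
      simp [hω]
    rw [h1]; exact bot_le
  rcases eq_or_ne M ∞ with rfl | hMt
  · simp [ENNReal.top_mul hc0]
  have h2 := mul_meas_ge_le_lintegral₀ hf (M * c)
  have h3 : M * c * P {ω | M * c < f ω} ≤ c :=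
    (mul_le_mul_right (measure_mono fun ω (hω : M * c < f ω) => hω.le) _).trans (h2.trans h)
  rw [← one_div, ENNReal.le_div_iff_mul_le (Or.inl hM) (Or.inl hMt)]
  have h4 : c * (P {ω | M * c < f ω} * M) ≤ c * 1 := by
    rw [mul_one]; refine le_trans (le_of_eq ?_) h3; ring
  exact (ENNReal.mul_le_mul_iff_right hc0 hc).1 h4

/-- A bound in probability for the distance of the sampled matrix to the graphon. -/
lemma IsSample.measure_lt_deltaDist_le {x : Fin n → X → Ω} (h : IsSample π P x) (hn : 0 < n)
    {W : Ω → Ω → ℝ} (hW : Measurable (Function.uncurry W)) {B : Fin k → Fin k → ℝ}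
    (hB : ∀ a b, B a b = B b a) {p : Fin k → ℝ} {κ η : ℝ} (hκ : 0 < κ) (hp : ∀ a, κ ≤ p a)
    (hp1 : ∑ a, p a = 1) (h0 : 0 < η) (h1 : η ≤ 1) (hη : 1 / (n * κ) ≤ η ^ 2) {c M : ℝ≥0∞}
    (hc : deltaDist 2 (weightMeasure p) B π W < c) (hM : M ≠ 0) :
    P {ω | 2 * (M * (c ^ 2 + ENNReal.ofReal (33 * η * weightedNorm p B ^ 2))) ^ (1 / 2 : ℝ) + c <
      deltaDist 2 (uniformWeight n) (sampledMatrix W fun i => x i ω) π W} ≤ M⁻¹ := by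
  have hc' := hc
  simp only [deltaDist, iInf_lt_iff] at hc'
  obtain ⟨ν, hν, hlt⟩ := hc'
  have hp0 : ∀ a, 0 ≤ p a := fun a => hκ.le.trans (hp a)
  have := isProbabilityMeasure_weightMeasure hp0 hp1
  have := hν.isProbabilityMeasure
  obtain ⟨q, hq, hq0, hq1, hf, hqp⟩ := hν.exists_fractional_labels hp0 hp1
  have hqp' : ∀ a, ∫ y, q a y ∂π = p a := fun a => by
    rw [integral_eq_lintegral_of_nonneg_ae (Eventually.of_forall (hq0 a))
      (hq a).aestronglyMeasurable, hqp a, ENNReal.toReal_ofReal (hp0 a)]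
  set U : X → ℝ≥0∞ := fun ω => offDiagSum (fun y y' => ENNReal.ofReal (labelledDiff W B q y y'))
    fun i => x i ω
  set R : X → ℝ≥0∞ := fun ω =>
    ENNReal.ofReal (1 / n * ∑ a, ∑ b, empiricalWeight q (fun i => x i ω) a * B a b ^ 2 +
        transportCost (empiricalWeight q fun i => x i ω) p B)
  have hLm : Measurable (Function.uncurry fun y y' => ENNReal.ofReal (labelledDiff W B q y y')) :=
    (measurable_labelledDiff hW hq).ennreal_ofReal
  have hUm : Measurable U := (measurable_offDiagSum hLm).comp
    (measurable_pi_lambda _ fun i => h.measurable i)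
  have hphm : ∀ a, Measurable fun ω => empiricalWeight q (fun i => x i ω) a := fun a =>
    Finset.measurable_fun_sum _ fun i _ => ((hq a).comp (h.measurable i)).div_const _
  have hRm : Measurable R := by
    refine Measurable.ennreal_ofReal (Measurable.add ?_ ?_)
    · exact (Finset.measurable_fun_sum _ fun a _ => Finset.measurable_fun_sum _ fun b _ =>
        (hphm a).mul_const _).const_mul _
    · unfold transportCost
      refine (Finset.measurable_fun_sum _ fun a _ => Finset.measurable_fun_sum _ fun b _ => ?_).const_mul _
      have := hphm a
      have := hphm b
      fun_prop
  have hint : ∫⁻ ω, (U ω / n ^ 2 + R ω) ∂P ≤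
      c ^ 2 + ENNReal.ofReal (33 * η * weightedNorm p B ^ 2) := by
    rw [lintegral_add_right _ hRm]
    refine add_le_add ?_ (h.integral_label_error_le hn hq hq0 hq1 hqp' hκ hp h0 h1 hη B)
    simp only [div_eq_mul_inv]
    rw [lintegral_mul_const _ hUm]
    have h2 := h.lintegral_offDiagSum_le hLm
    rw [lintegral_labelledDiff hW hq hq0 hf] at h2
    rw [← div_eq_mul_inv]
    refine ENNReal.div_le_of_le_mul' (h2.trans ?_)
    gcongr
  refine (measure_mono fun ω hω => ?_).trans
    (measure_lt_le_inv_of_lintegral_le ((hUm.div_const _).add hRm).aemeasurable hint hM)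
  have h3 := deltaDist_sampledMatrix_le (π := π) hn hW hB hp0 hp1 hq0 hq1 (fun i => x i ω)
  simp only [Set.mem_ofPred_eq] at hω ⊢
  by_contra! h4
  refine absurd hω (not_lt.2 (h3.trans ?_))
  have h4' : U ω / n ^ 2 + R ω ≤ _ := h4
  gcongr

end sampling
/-! ## Approximation by block models -/

section stepFunctions

variable {Ω : Type*} [MeasurableSpace Ω] {π : Measure Ω} [IsProbabilityMeasure π] {k : ℕ}

lemma weightMeasure_fiber {c : Ω → Fin k} (hc : Measurable c) :
    weightMeasure (fun a => (π (c ⁻¹' {a})).toReal) = π.map c := by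
  rw [eq_weightMeasure (π.map c)]
  congr 1; ext a
  rw [Measure.map_apply hc (measurableSet_singleton a)]

/-- Removing the null blocks of a block model. -/
lemma exists_blockModel_pos {p : Fin k → ℝ} (hp : ∀ a, 0 ≤ p a) (hp1 : ∑ a, p a = 1)
    {B : Fin k → Fin k → ℝ} (hB : ∀ a b, 0 < p a → 0 < p b → B a b = B b a)
    (hB0 : ∀ a b, 0 < p a → 0 < p b → 0 ≤ B a b) {W : Ω → Ω → ℝ}
    (hW : Measurable (Function.uncurry W)) :
    ∃ b : BlockModel, b.IsValid ∧ (∃ f : Fin b.k → Fin k, (∀ i, b.p i = p (f i)) ∧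
      (∀ i, 0 < p (f i)) ∧ ∀ i j, b.B i j = B (f i) (f j)) ∧
      b.deltaTo 2 π W ≤ deltaDist 2 (weightMeasure p) B π W := by
  let S := {a // 0 < p a}
  let e : Fin (Fintype.card S) ≃ S := (Fintype.equivFin S).symm
  have hsum : ∀ g : Fin k → ℝ, (∀ a, p a = 0 → g a = 0) → ∑ i, g (e i) = ∑ a, g a := fun g hg => by
    rw [e.sum_comp fun s : S => g s]
    exact (Finset.sum_subtype (Finset.univ.filter fun a => 0 < p a) (by simp) g).symm.trans
      (Finset.sum_filter_of_ne fun a _ h =>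
        lt_of_le_of_ne (hp a) fun h0 => h (hg a h0.symm))
  let b : BlockModel := ⟨Fintype.card S, fun i => p (e i), fun i j => B (e i) (e j)⟩
  have hb : b.IsValid := ⟨fun i => hp _, (hsum p fun _ h => h).trans hp1,
    fun i j => hB _ _ (e i).2 (e j).2, fun i j => hB0 _ _ (e i).2 (e j).2⟩
  refine ⟨b, hb, ⟨fun i => e i, fun i => rfl, fun i => (e i).2, fun _ _ => rfl⟩, ?_⟩
  have hprob : IsProbabilityMeasure b.measure := isProbabilityMeasure_weightMeasure hb.p_nonneg hb.p_sum
  have := isProbabilityMeasure_weightMeasure hp hp1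
  have : Nonempty (Fin b.k) := by
    by_contra h
    rw [not_nonempty_iff] at h
    simpa using hb.p_sum
  have hmap : (weightMeasure b.p).map (fun i => (e i : Fin k)) = weightMeasure p := by
    rw [map_weightMeasure hb.p_nonneg]
    congr 1; ext a
    have h1 := hsum (fun c => if c = a then p c else 0) fun c h => by simp [h]
    simp only [Finset.sum_ite_eq', Finset.mem_univ, if_true] at h1
    exact h1
  -- The inclusion of the remaining blocks carries their weights to `p` and is a coupling of cost
  -- zero.
  have h0 : deltaDist 2 b.measure b.B (weightMeasure p) B ≤ 0 := by
    have h1 := deltaDist_le_of_map (p := 2) (μ := weightMeasure b.p) measurable_id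
      (g := fun i => (e i : Fin k)) Measurable.of_discrete (measurable_uncurry_of_finite b.B)
      (measurable_uncurry_of_finite B)
    rw [Measure.map_id, hmap] at h1
    refine h1.trans (le_of_eq ?_)
    have : (fun q : Fin b.k × Fin b.k => b.B (id q.1) (id q.2) - B (e q.1) (e q.2)) = 0 := by
      ext q; exact sub_self _
    rw [this, eLpNorm_zero]
  calc b.deltaTo 2 π W ≤ deltaDist 2 b.measure b.B (weightMeasure p) B +
        deltaDist 2 (weightMeasure p) B π W :=
        deltaDist_triangle (by norm_num) (measurable_uncurry_of_finite b.B)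
          (measurable_uncurry_of_finite B) hW
    _ ≤ 0 + _ := add_le_add_left h0 _
    _ = _ := zero_add _

/-- Functions that depend on the classes of the two variables in a finite partition only. -/
def IsStepFunction (f : Ω × Ω → ℝ) : Prop :=
  ∃ (k : ℕ) (c : Ω → Fin k) (B : Fin k → Fin k → ℝ), Measurable c ∧ f = fun z => B (c z.1) (c z.2)

lemma IsStepFunction.measurable {f : Ω × Ω → ℝ} (h : IsStepFunction f) : Measurable f := by
  obtain ⟨k, c, B, hc, rfl⟩ := h
  exact (measurable_uncurry_of_finite B).comp (f := fun z : Ω × Ω => (c z.1, c z.2))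
    ((hc.comp measurable_fst).prodMk (hc.comp measurable_snd))

/-- Pass to the common refinement of the two partitions. -/
lemma IsStepFunction.map₂ {f g : Ω × Ω → ℝ} (hf : IsStepFunction f) (hg : IsStepFunction g)
    (φ : ℝ → ℝ → ℝ) : IsStepFunction fun z => φ (f z) (g z) := by
  obtain ⟨k, c, B, hc, rfl⟩ := hf
  obtain ⟨l, d, D, hd, rfl⟩ := hg
  refine ⟨k * l, fun x => finProdFinEquiv (c x, d x), fun i j =>
    φ (B (finProdFinEquiv.symm i).1 (finProdFinEquiv.symm j).1)
      (D (finProdFinEquiv.symm i).2 (finProdFinEquiv.symm j).2), ?_, ?_⟩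
  · exact (Measurable.of_discrete (f := (finProdFinEquiv : Fin k × Fin l → Fin (k * l)))).comp
      (hc.prodMk hd)
  · ext z; simp

/-- These sets form an algebra that contains the measurable rectangles and hence generates the
product σ-algebra. -/
lemma measureDense_stepSets :
    (π.prod π).MeasureDense {s : Set (Ω × Ω) | IsStepFunction (s.indicator fun _ => (1 : ℝ))} := by
  refine Measure.MeasureDense.of_generateFrom_isSetAlgebra_finite _ ⟨?_, ?_, ?_⟩ ?_
  · exact ⟨1, fun _ => 0, fun _ _ => 0, measurable_const, by ext; simp⟩
  · intro s hs
    have := hs.map₂ hs fun a _ => 1 - a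
    refine Eq.mpr (congrArg IsStepFunction ?_) this
    ext z
    by_cases h : z ∈ s <;> simp [h]
  · intro s t hs ht
    have := hs.map₂ ht max
    refine Eq.mpr (congrArg IsStepFunction ?_) this
    ext z
    by_cases h : z ∈ s <;> by_cases h' : z ∈ t <;> simp [h, h']
  · refine le_antisymm ?_ ?_
    · rw [← generateFrom_prod]
      refine MeasurableSpace.generateFrom_mono ?_
      rintro _ ⟨s, hs, t, ht, rfl⟩
      have hs' : IsStepFunction fun z : Ω × Ω => s.indicator (fun _ => (1 : ℝ)) z.1 :=
        ⟨2, fun x => if x ∈ s then 1 else 0, fun i _ => if i = 1 then 1 else 0,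
          Measurable.ite hs measurable_const measurable_const, by
            ext z; by_cases h : z.1 ∈ s <;> simp [h]⟩
      have ht' : IsStepFunction fun z : Ω × Ω => t.indicator (fun _ => (1 : ℝ)) z.2 :=
        ⟨2, fun x => if x ∈ t then 1 else 0, fun _ i => if i = 1 then 1 else 0,
          Measurable.ite ht measurable_const measurable_const, by
            ext z; by_cases h : z.2 ∈ t <;> simp [h]⟩
      have := hs'.map₂ ht' fun a b => a * b
      refine Eq.mpr (congrArg IsStepFunction ?_) this
      ext z
      by_cases h : z.1 ∈ s <;> by_cases h' : z.2 ∈ t <;> simp [h, h']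
    · refine MeasurableSpace.generateFrom_le fun s hs => ?_
      have := hs.measurable (measurableSet_singleton (1 : ℝ))
      convert this using 1
      ext z
      by_cases h : z ∈ s <;> simp [h]

lemma exists_isStepFunction_eLpNorm_sub_le {f : Ω × Ω → ℝ} (hf : MemLp f 2 (π.prod π)) {ε : ℝ≥0∞}
    (hε : ε ≠ 0) : ∃ g, eLpNorm (f - g) 2 (π.prod π) ≤ ε ∧ IsStepFunction g := by
  refine hf.induction_dense (by norm_num) _ ?_ (fun f g hf hg => hf.map₂ hg fun a b => a + b)
    (fun f hf => hf.measurable.aestronglyMeasurable) hε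
  intro c s hs _ ε hε
  obtain ⟨δ, hδ, h⟩ := exists_eLpNorm_indicator_le (μ := π.prod π) (p := 2) (by norm_num) c hε
  obtain ⟨t, ht, hlt⟩ := (measureDense_stepSets (π := π)).approx s hs (measure_ne_top _ _) δ
    (by exact_mod_cast hδ)
  refine ⟨t.indicator fun _ => c, ?_, ?_⟩
  · rw [eLpNorm_sub_comm, eLpNorm_indicator_sub_indicator]
    refine h _ (hlt.le.trans ?_)
    simp
  · have := ht.map₂ ht fun a _ => c * a
    refine Eq.mpr (congrArg IsStepFunction ?_) this
    ext z
    by_cases h : z ∈ t <;> simp [h]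

/-- Square integrable graphons can be approximated by block models without null blocks. -/
lemma IsGraphon.exists_blockModel_deltaTo_le {W : Ω → Ω → ℝ} (hW : IsGraphon π W)
    (hW2 : graphonNorm 2 π W < ∞) {ε : ℝ≥0∞} (hε : ε ≠ 0) :
    ∃ b : BlockModel, b.IsValid ∧ (∀ i, 0 < b.p i) ∧ b.deltaTo 2 π W ≤ ε := by
  have hL : MemLp (Function.uncurry W) 2 (π.prod π) := ⟨hW.measurable.aestronglyMeasurable, hW2⟩
  obtain ⟨g, hg, hgs⟩ := exists_isStepFunction_eLpNorm_sub_le hL (ε := ε / 2) (by simpa using hε)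
  have hgm := hgs.measurable
  have hle : eLpNorm (fun z => (|Function.uncurry W z - g z| + |Function.uncurry W z - g z.swap|))
      2 (π.prod π) ≤ ε := by
    refine (eLpNorm_add_le (hW.measurable.sub hgm).norm.aestronglyMeasurable
      (hW.measurable.sub (hgm.comp measurable_swap)).norm.aestronglyMeasurable
      (by norm_num)).trans ?_
    have h1 : eLpNorm (fun z => |Function.uncurry W z - g z|) 2 (π.prod π) ≤ ε / 2 := by
      refine le_trans (le_of_eq ?_) hg
      exact eLpNorm_norm fun z => Function.uncurry W z - g z
    have h2 : eLpNorm (fun z => |Function.uncurry W z - g z.swap|) 2 (π.prod π) ≤ ε / 2 := by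
      refine le_trans (le_of_eq ?_) h1
      rw [← eLpNorm_comp_measurePreserving (f := Prod.swap)
        (g := fun z => |Function.uncurry W z - g z|)
        (hW.measurable.sub hgm).norm.aestronglyMeasurable Measure.measurePreserving_swap]
      congr 1
      ext z
      have : Function.uncurry W z.swap = Function.uncurry W z := hW.symm _ _
      simp [this]
    calc _ ≤ ε / 2 + ε / 2 := add_le_add h1 h2
      _ = ε := ENNReal.add_halves ε
  obtain ⟨k, c, B, hc, hgB⟩ := hgs
  -- Symmetrizing and cutting off at `0` makes the step function a block model. As `W` is symmetric
  -- and nonnegative, the error stays below the sum of the errors of the step function and of its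
  -- transpose.
  set B' : Fin k → Fin k → ℝ := fun i j => max 0 ((B i j + B j i) / 2)
  set p : Fin k → ℝ := fun a => (π (c ⁻¹' {a})).toReal
  have hp1 : ∑ a, p a = 1 := by
    rw [← ENNReal.toReal_sum fun a _ => measure_ne_top _ _,
      sum_measure_preimage_singleton _ fun a _ => hc (measurableSet_singleton a)]
    simp
  obtain ⟨b, hb, ⟨f, hf, hf0, -⟩, hle'⟩ := exists_blockModel_pos (π := π) (p := p) (B := B')
    (fun a => ENNReal.toReal_nonneg) hp1
    (fun i j _ _ => by simp only [B', add_comm]) (fun _ _ _ _ => le_max_left _ _) hW.measurable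
  refine ⟨b, hb, fun i => (hf i).symm ▸ hf0 i, hle'.trans ?_⟩
  have h1 := deltaDist_le_of_map (p := 2) (μ := π) hc measurable_id
    (measurable_uncurry_of_finite B') hW.measurable
  rw [Measure.map_id, ← weightMeasure_fiber hc] at h1
  refine h1.trans (le_trans (eLpNorm_mono_real fun z => ?_) hle)
  rw [hgB]
  obtain ⟨x, y⟩ := z
  simp only [B', Function.uncurry_apply_pair, Prod.fst_swap, Prod.snd_swap, id, Real.norm_eq_abs]
  have := hW.nonneg x y
  rcases le_total ((B (c x) (c y) + B (c y) (c x)) / 2) 0 with h | h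
  · rw [max_eq_left h, zero_sub, abs_neg, abs_of_nonneg this]
    have := le_abs_self (W x y - B (c x) (c y))
    have := le_abs_self (W x y - B (c y) (c x))
    linarith
  · rw [max_eq_right h]
    rw [abs_le]
    have := le_abs_self (W x y - B (c x) (c y))
    have := le_abs_self (W x y - B (c y) (c x))
    have := neg_abs_le (W x y - B (c x) (c y))
    have := neg_abs_le (W x y - B (c y) (c x))
    have := abs_nonneg (W x y - B (c x) (c y))
    have := abs_nonneg (W x y - B (c y) (c x))
    constructor <;> linarith

end stepFunctions
/-! ## Almost sure convergence of the sampled matrices -/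

section almostSure

variable {Ω : Type*} [MeasurableSpace Ω] {π : Measure Ω} [IsProbabilityMeasure π]
  {X : Type*} [MeasurableSpace X] {P : Measure X} [IsProbabilityMeasure P] {k : ℕ}

lemma tendsto_transportCost {ι : Type*} {l : Filter ι} {ph : ι → Fin k → ℝ} {p : Fin k → ℝ}
    (h : ∀ a, Tendsto (fun i => ph i a) l (𝓝 (p a))) (B : Fin k → Fin k → ℝ) :
    Tendsto (fun i => transportCost (ph i) p B) l (𝓝 0) := by
  have h1 : Tendsto (fun i => transportCost (ph i) p B) l (𝓝 (transportCost p p B)) := by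
    exact (tendsto_finsetSum _ fun a _ => tendsto_finsetSum _ fun b _ =>
      ((((h a).sub tendsto_const_nhds).abs).mul
        ((h b).add tendsto_const_nhds)).const_mul _).const_mul _
  convert h1
  simp [transportCost]

lemma IsSample.ae_tendsto_empiricalWeight {x : ℕ → X → Ω} (h : IsSample π P x)
    {q : Fin k → Ω → ℝ} (hq : ∀ a, Measurable (q a)) (hq0 : ∀ a x, 0 ≤ q a x)
    (hq1 : ∀ a x, q a x ≤ 1) :
    ∀ᵐ ω ∂P, ∀ a, Tendsto (fun n : ℕ => empiricalWeight q (fun i : Fin n => x i ω) a) atTop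
      (𝓝 (∫ y, q a y ∂π)) := by
  rw [ae_all_iff]
  intro a
  have hm : ∀ i, Measurable fun ω => q a (x i ω) := fun i => (hq a).comp (h.measurable i)
  have h1 := strong_law_ae_real (μ := P) (fun i ω => q a (x i ω))
    (Integrable.of_bound (C := 1) (hm 0).aestronglyMeasurable (Eventually.of_forall fun ω => by
      rw [Real.norm_eq_abs, abs_of_nonneg (hq0 _ _)]; exact hq1 _ _))
    (fun i j hij => (h.indep.indepFun hij).comp (hq a) (hq a))
    (fun i => by
      have : IdentDistrib (x i) (x 0) P P :=
        ⟨(h.measurable i).aemeasurable, (h.measurable 0).aemeasurable, by rw [h.law, h.law]⟩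
      exact this.comp (hq a))
  filter_upwards [h1] with ω hω
  rw [h.integral_comp 0 (hq a)] at hω
  refine hω.congr fun n => ?_
  rw [empiricalWeight, ← Finset.sum_div, Finset.sum_range]

/-- Approximate `W` by block models with error `2 ^ (-m)`. For all large `m` the pair average is
small for every `n` at once; with such an `m` fixed, the strong law makes the error of the empirical
block weights vanish as `n → ∞`. -/
lemma IsSample.ae_tendsto_deltaDist {x : ℕ → X → Ω} (h : IsSample π P x) {W : Ω → Ω → ℝ}
    (hW : IsGraphon π W) (hW2 : graphonNorm 2 π W < ∞) :
    ∀ᵐ ω ∂P, Tendsto (fun n : ℕ => deltaDist 2 (uniformWeight n)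
      (sampledMatrix W fun i : Fin n => x i ω) π W) atTop (𝓝 0) := by
  have key : ∀ m : ℕ, ∃ (k : ℕ) (p : Fin k → ℝ) (B : Fin k → Fin k → ℝ) (q : Fin k → Ω → ℝ),
      (∀ a, 0 ≤ p a) ∧ ∑ a, p a = 1 ∧ (∀ a b, B a b = B b a) ∧ (∀ a, Measurable (q a)) ∧
      (∀ a x, 0 ≤ q a x) ∧ (∀ x, ∑ a, q a x = 1) ∧ (∀ a, ∫ y, q a y ∂π = p a) ∧
      deltaDist 2 (weightMeasure p) B π W ≤ (1 / 2) ^ m ∧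
      ∫⁻ z, ENNReal.ofReal (labelledDiff W B q z.1 z.2) ∂(π.prod π) ≤ (1 / 4) ^ m := by
    intro m
    have hpos : (1 / 2 : ℝ≥0∞) ^ m / 2 ≠ 0 := by simp
    obtain ⟨b, hb, -, hle⟩ := hW.exists_blockModel_deltaTo_le hW2 hpos
    have hlt : deltaDist 2 (weightMeasure b.p) b.B π W < (1 / 2) ^ m :=
      lt_of_le_of_lt hle (ENNReal.half_lt_self (by simp) (by simp))
    have hlt' := hlt
    simp only [deltaDist, iInf_lt_iff] at hlt'
    obtain ⟨ν, hν, hν2⟩ := hlt'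
    have := isProbabilityMeasure_weightMeasure hb.p_nonneg hb.p_sum
    have := hν.isProbabilityMeasure
    obtain ⟨q, hq, hq0, hq1, hf, hqp⟩ := hν.exists_fractional_labels hb.p_nonneg hb.p_sum
    refine ⟨b.k, b.p, b.B, q, hb.p_nonneg, hb.p_sum, hb.B_symm, hq, hq0, hq1, fun a => ?_, hlt.le,
      ?_⟩
    · rw [integral_eq_lintegral_of_nonneg_ae (Eventually.of_forall (hq0 a))
        (hq a).aestronglyMeasurable, hqp a, ENNReal.toReal_ofReal (hb.p_nonneg a)]
    · refine (lintegral_labelledDiff (B := b.B) hW.measurable hq hq0 hf).trans_le ?_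
      have e : (1 / 4 : ℝ≥0∞) ^ m = ((1 / 2) ^ m) ^ 2 := by
        rw [← pow_mul, mul_comm m 2, pow_mul]
        congr 1
        rw [one_div, one_div, sq, ← ENNReal.mul_inv (by simp) (by simp)]
        norm_num
      rw [e]
      exact pow_le_pow_left₀ zero_le hν2.le 2
  choose k p B q hp0 hp1 hB hq hq0 hq1 hqp hδ hint using key
  have hq1' : ∀ m a y, q m a y ≤ 1 := fun m a y => by
    rw [← hq1 m y]; exact Finset.single_le_sum (fun b _ => hq0 m b y) (Finset.mem_univ a)
  have hae1 := h.ae_eventually_offDiagSum_le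
    (f := fun m y y' => ENNReal.ofReal (labelledDiff W (B m) (q m) y y'))
    (fun m => (measurable_labelledDiff hW.measurable (hq m)).ennreal_ofReal) hint
  have hae2 := ae_all_iff.2 fun m => h.ae_tendsto_empiricalWeight (hq m) (hq0 m) (hq1' m)
  filter_upwards [hae1, hae2] with ω h1 h2
  rw [ENNReal.tendsto_nhds_zero]
  intro ε hε
  have hpow : Tendsto (fun m : ℕ => (1 / 2 : ℝ≥0∞) ^ m) atTop (𝓝 0) :=
    ENNReal.tendsto_pow_atTop_nhds_zero_of_lt_one (by simp)
  have hlim : Tendsto (fun m : ℕ => 2 * ((1 / 2 : ℝ≥0∞) ^ m + (1 / 2) ^ m) ^ (1 / 2 : ℝ) +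
      (1 / 2) ^ m) atTop (𝓝 0) := by
    have e1 : Tendsto (fun m : ℕ => (1 / 2 : ℝ≥0∞) ^ m + (1 / 2) ^ m) atTop (𝓝 0) := by
      simpa using hpow.add hpow
    have e2 := (ENNReal.continuous_rpow_const (y := (1 / 2 : ℝ))).tendsto 0 |>.comp e1
    have e3 := (ENNReal.Tendsto.const_mul e2 (Or.inr (by simp : (2 : ℝ≥0∞) ≠ ∞))).add hpow
    simpa using e3
  obtain ⟨m, hm1, hm2⟩ := (h1.and (ENNReal.tendsto_nhds_zero.1 hlim ε hε)).exists
  have hR : Tendsto (fun n : ℕ => 1 / (n : ℝ) * ∑ a, ∑ b,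
      empiricalWeight (q m) (fun i : Fin n => x i ω) a * B m a b ^ 2 +
      transportCost (empiricalWeight (q m) fun i : Fin n => x i ω) (p m) (B m)) atTop (𝓝 0) := by
    have hph : ∀ a, Tendsto (fun n : ℕ => empiricalWeight (q m) (fun i : Fin n => x i ω) a) atTop
        (𝓝 (p m a)) := fun a => hqp m a ▸ h2 m a
    have e1 : Tendsto (fun n : ℕ => ∑ a, ∑ b,
        empiricalWeight (q m) (fun i : Fin n => x i ω) a * B m a b ^ 2) atTop
        (𝓝 (∑ a, ∑ b, p m a * B m a b ^ 2)) :=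
      tendsto_finsetSum _ fun a _ => tendsto_finsetSum _ fun b _ => (hph a).mul_const _
    simpa using (tendsto_one_div_atTop_nhds_zero_nat.mul e1).add (tendsto_transportCost hph (B m))
  have hR' : ∀ᶠ n : ℕ in atTop, ENNReal.ofReal (1 / (n : ℝ) * ∑ a, ∑ b,
      empiricalWeight (q m) (fun i : Fin n => x i ω) a * B m a b ^ 2 +
      transportCost (empiricalWeight (q m) fun i : Fin n => x i ω) (p m) (B m)) ≤ (1 / 2) ^ m := by
    have e1 := ENNReal.tendsto_ofReal hR
    rw [ENNReal.ofReal_zero] at e1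
    exact ENNReal.tendsto_nhds_zero.1 e1 _ (by simp [pos_iff_ne_zero])
  filter_upwards [hR', eventually_gt_atTop 0] with n hn hn0
  refine (deltaDist_sampledMatrix_le hn0 hW.measurable (hB m) (hp0 m) (hp1 m) (hq0 m) (hq1 m)
    _).trans (le_trans ?_ hm2)
  gcongr
  · refine ENNReal.div_le_of_le_mul ?_
    exact hm1 n
  · exact hδ m

/-- The distance of the scaled edge probabilities to the sampled matrix. -/
lemma ofReal_matrixNorm2_sub_sampledMatrix {n : ℕ} (hn : 0 < n) {ρ : ℝ} (hρ : 0 < ρ)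
    (W : Ω → Ω → ℝ) (y : Fin n → Ω) :
    ENNReal.ofReal (matrixNorm2 (ρ⁻¹ • weightedGraph ρ W y - sampledMatrix W y)) =
      (offDiagSum (fun x x' => ENNReal.ofReal ((W x x' - min (W x x') ρ⁻¹) ^ 2)) y / n ^ 2) ^
        (1 / 2 : ℝ) := by
  have hn' : (0 : ℝ) < n := Nat.cast_pos.2 hn
  rw [matrixNorm2, Real.sqrt_eq_rpow, ← ENNReal.ofReal_rpow_of_nonneg (by positivity) (by norm_num)]
  congr 1
  rw [ENNReal.ofReal_mul (by positivity), one_div, ENNReal.ofReal_inv_of_pos (by positivity),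
    ENNReal.ofReal_pow hn'.le, ENNReal.ofReal_natCast, mul_comm, div_eq_mul_inv, offDiagSum]
  congr 1
  rw [ENNReal.ofReal_sum_of_nonneg fun i _ => by positivity]
  refine Finset.sum_congr rfl fun i _ => ?_
  rw [ENNReal.ofReal_sum_of_nonneg fun i _ => by positivity]
  refine Finset.sum_congr rfl fun j _ => ?_
  have e : (ρ⁻¹ • weightedGraph ρ W y - sampledMatrix W y) i j =
      ρ⁻¹ * weightedGraph ρ W y i j - sampledMatrix W y i j := rfl
  rw [e, weightedGraph, sampledMatrix]
  split_ifs with hij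
  · simp
  · rw [sq_abs, mul_min_of_nonneg _ _ (inv_nonneg.2 hρ.le), inv_mul_cancel_left₀ hρ.ne', mul_one,
      min_comm, ← neg_sub, neg_sq]

lemma measurable_tail {W : Ω → Ω → ℝ} (hW : Measurable (Function.uncurry W)) (c : ℝ) :
    Measurable (Function.uncurry fun x y => ENNReal.ofReal ((W x y - min (W x y) c) ^ 2)) :=
  ((hW.sub (hW.min measurable_const)).pow_const 2).ennreal_ofReal

lemma IsSample.measure_lt_matrixNorm2_le {n : ℕ} {x : Fin n → X → Ω} (h : IsSample π P x)
    (hn : 0 < n) {W : Ω → Ω → ℝ} (hW : Measurable (Function.uncurry W)) {ρ : ℝ} (hρ : 0 < ρ)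
    {M : ℝ≥0∞} (hM : M ≠ 0) :
    P {ω | M ^ (1 / 2 : ℝ) * tailNorm 2 ρ π W < ENNReal.ofReal (matrixNorm2
      (ρ⁻¹ • weightedGraph ρ W (fun i => x i ω) - sampledMatrix W fun i => x i ω))} ≤ M⁻¹ := by
  have hm := measurable_tail hW ρ⁻¹
  have hUm : Measurable fun ω => offDiagSum
      (fun y y' => ENNReal.ofReal ((W y y' - min (W y y') ρ⁻¹) ^ 2)) fun i => x i ω :=
    (measurable_offDiagSum hm).comp (measurable_pi_lambda _ fun i => h.measurable i)
  have hint : ∫⁻ ω, offDiagSum (fun y y' => ENNReal.ofReal ((W y y' - min (W y y') ρ⁻¹) ^ 2))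
      (fun i => x i ω) / n ^ 2 ∂P ≤ tailNorm 2 ρ π W ^ 2 := by
    simp only [div_eq_mul_inv]
    rw [lintegral_mul_const _ hUm, ← div_eq_mul_inv]
    refine ENNReal.div_le_of_le_mul' ((h.lintegral_offDiagSum_le hm).trans (le_of_eq ?_))
    rw [tailNorm, graphonNorm, eLpNorm_two_sq]
    rfl
  refine (measure_mono fun ω hω => ?_).trans
    (measure_lt_le_inv_of_lintegral_le (hUm.div_const _).aemeasurable hint hM)
  simp only [Set.mem_ofPred_eq] at hω ⊢
  rw [ofReal_matrixNorm2_sub_sampledMatrix hn hρ] at hω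
  by_contra! h4
  refine absurd hω (not_lt.2 ((ENNReal.rpow_le_rpow h4 (by norm_num)).trans (le_of_eq ?_)))
  rw [ENNReal.mul_rpow_of_nonneg _ _ (by norm_num), ← ENNReal.rpow_natCast, ← ENNReal.rpow_mul]
  norm_num

lemma exists_lintegral_tail_le {W : Ω → Ω → ℝ} (hW : IsGraphon π W) (hW2 : graphonNorm 2 π W < ∞)
    {ε : ℝ≥0∞} (hε : 0 < ε) :
    ∃ T : ℕ, ∫⁻ z, ENNReal.ofReal ((W z.1 z.2 - min (W z.1 z.2) T) ^ 2) ∂(π.prod π) ≤ ε := by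
  have h1 : Tendsto (fun T : ℕ => ∫⁻ z, ENNReal.ofReal ((W z.1 z.2 - min (W z.1 z.2) T) ^ 2)
      ∂(π.prod π)) atTop (𝓝 (∫⁻ z, 0 ∂(π.prod π))) := by
    refine tendsto_lintegral_of_dominated_convergence
      (fun z : Ω × Ω => ENNReal.ofReal (W z.1 z.2 ^ 2)) (fun T => measurable_tail hW.measurable T)
      (fun T => Eventually.of_forall fun z => ENNReal.ofReal_le_ofReal ?_) ?_
      (Eventually.of_forall fun z => ?_)
    · have := hW.nonneg z.1 z.2
      have h2 : 0 ≤ min (W z.1 z.2) T := le_min this (Nat.cast_nonneg _)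
      have h3 := min_le_left (W z.1 z.2) T
      exact pow_le_pow_left₀ (by linarith) (by linarith) 2
    · have := eLpNorm_two_sq (π.prod π) (Function.uncurry W)
      refine ne_of_lt ?_
      refine lt_of_eq_of_lt this.symm ?_
      exact ENNReal.pow_lt_top hW2
    · refine tendsto_const_nhds.congr' ?_
      filter_upwards [eventually_ge_atTop ⌈W z.1 z.2⌉₊] with T hT
      rw [min_eq_left ((Nat.le_ceil _).trans (by exact_mod_cast hT))]
      simp
  rw [lintegral_zero] at h1
  exact (ENNReal.tendsto_nhds_zero.1 h1 ε hε).exists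

/-- Choose levels `T m` at which the squared tail has integral at most `4 ^ (-m)`; the uniform
pair-average bound applies to these fixed functions. Since `ρ n → 0`, the truncation level `(ρ n)⁻¹`
eventually exceeds any `T m`, and the tail above it is smaller. -/
lemma IsSample.ae_tendsto_matrixNorm2 {x : ℕ → X → Ω} (h : IsSample π P x) {W : Ω → Ω → ℝ}
    (hW : IsGraphon π W) (hW2 : graphonNorm 2 π W < ∞) {ρ : ℕ → ℝ} (hρ : ∀ n, 0 < ρ n)
    (hρ0 : Tendsto ρ atTop (𝓝 0)) :
    ∀ᵐ ω ∂P, Tendsto (fun n : ℕ => matrixNorm2 ((ρ n)⁻¹ • weightedGraph (ρ n) W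
      (fun i : Fin n => x i ω) - sampledMatrix W fun i : Fin n => x i ω)) atTop (𝓝 0) := by
  choose T hT using fun m : ℕ => exists_lintegral_tail_le hW hW2
    (ε := (1 / 4) ^ m) (by simp [pos_iff_ne_zero])
  have hae := h.ae_eventually_offDiagSum_le
    (f := fun m y y' => ENNReal.ofReal ((W y y' - min (W y y') (T m)) ^ 2))
    (fun m => measurable_tail hW.measurable _) hT
  filter_upwards [hae] with ω h1
  suffices hs : Tendsto (fun n : ℕ => ENNReal.ofReal (matrixNorm2 ((ρ n)⁻¹ • weightedGraph (ρ n) W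
      (fun i : Fin n => x i ω) - sampledMatrix W fun i : Fin n => x i ω))) atTop (𝓝 0) by
    have h2 := (ENNReal.tendsto_toReal ENNReal.zero_ne_top).comp hs
    refine h2.congr fun n => ?_
    exact ENNReal.toReal_ofReal (matrixNorm2_nonneg _)
  rw [ENNReal.tendsto_nhds_zero]
  intro ε hε
  have hpow : Tendsto (fun m : ℕ => ((1 / 2 : ℝ≥0∞) ^ m) ^ (1 / 2 : ℝ)) atTop (𝓝 0) := by
    have e2 := (ENNReal.continuous_rpow_const (y := (1 / 2 : ℝ))).tendsto 0 |>.comp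
      (ENNReal.tendsto_pow_atTop_nhds_zero_of_lt_one (r := 1 / 2) (by simp))
    rw [ENNReal.zero_rpow_of_pos (by norm_num)] at e2
    exact e2
  obtain ⟨m, hm1, hm2⟩ := (h1.and (ENNReal.tendsto_nhds_zero.1 hpow ε hε)).exists
  have hT' : ∀ᶠ n in atTop, (T m : ℝ) ≤ (ρ n)⁻¹ := by
    have : Tendsto (fun n => (ρ n)⁻¹) atTop atTop :=
      Tendsto.inv_tendsto_nhdsGT_zero (tendsto_nhdsWithin_iff.2
        ⟨hρ0, Eventually.of_forall fun n => hρ n⟩)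
    exact this.eventually_ge_atTop _
  filter_upwards [hT', eventually_gt_atTop 0] with n hn hn0
  rw [ofReal_matrixNorm2_sub_sampledMatrix hn0 (hρ n)]
  refine le_trans (ENNReal.rpow_le_rpow (ENNReal.div_le_of_le_mul (le_trans ?_ (hm1 n)))
    (by norm_num)) hm2
  refine Finset.sum_le_sum fun i _ => Finset.sum_le_sum fun j _ => ?_
  split_ifs
  · exact le_rfl
  · refine ENNReal.ofReal_le_ofReal (pow_le_pow_left₀ (sub_nonneg.2 (min_le_left _ _)) ?_ 2)
    gcongr

end almostSure
/-! ## A deterministic bound for the least squares algorithm -/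

section deterministic

variable {n k : ℕ}

lemma graphonNorm_le_deltaDist_add {α β : Type*} [MeasurableSpace α] [MeasurableSpace β]
    {π : Measure α} {π' : Measure β} [IsProbabilityMeasure π] {W : α → α → ℝ} {W' : β → β → ℝ}
    (hW : Measurable (Function.uncurry W)) (hW' : Measurable (Function.uncurry W')) :
    graphonNorm 2 π W ≤ deltaDist 2 π W π' W' + graphonNorm 2 π' W' := by
  refine tsub_le_iff_right.1 (le_iInf₂ fun ν hν => tsub_le_iff_right.2 ?_)
  have := hν.isProbabilityMeasure
  have e1 : graphonNorm 2 π W =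
      eLpNorm (fun q : (α × β) × (α × β) => W q.1.1 q.2.1) 2 (ν.prod ν) := by
    rw [graphonNorm, ← hν.1, eLpNorm_prod_map measurable_fst hW]; rfl
  have e2 : graphonNorm 2 π' W' =
      eLpNorm (fun q : (α × β) × (α × β) => W' q.1.2 q.2.2) 2 (ν.prod ν) := by
    rw [graphonNorm, ← hν.2, eLpNorm_prod_map measurable_snd hW']; rfl
  have hm : Measurable fun q : (α × β) × (α × β) => W' q.1.2 q.2.2 :=
    hW'.comp (f := fun q : (α × β) × (α × β) => (q.1.2, q.2.2)) (by fun_prop)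
  rw [e1, e2]
  refine le_trans (le_of_eq ?_) (eLpNorm_add_le
    (measurable_coupling_diff hW hW').aestronglyMeasurable hm.aestronglyMeasurable (by norm_num))
  congr 1
  ext q; simp

lemma graphonNorm_weightMeasure {p : Fin k → ℝ} (hp : ∀ a, 0 ≤ p a) (B : Fin k → Fin k → ℝ) :
    graphonNorm 2 (weightMeasure p) B = ENNReal.ofReal (weightedNorm p B) :=
  eLpNorm_prod_weightMeasure hp B

lemma graphonNorm_uniformWeight (A : Matrix (Fin n) (Fin n) ℝ) :
    graphonNorm 2 (uniformWeight n) A = ENNReal.ofReal (matrixNorm2 A) := by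
  rw [matrixNorm2_eq_weightedNorm]
  exact graphonNorm_weightMeasure (fun _ => by positivity) A

lemma matrixNorm2_add_le (A A' : Matrix (Fin n) (Fin n) ℝ) :
    matrixNorm2 (A + A') ≤ matrixNorm2 A + matrixNorm2 A' := by
  simp only [matrixNorm2_eq_weightedNorm]
  exact weightedNorm_add_le (fun _ => by positivity) A A'

lemma matrixNorm2_smul {c : ℝ} (hc : 0 ≤ c) (A : Matrix (Fin n) (Fin n) ℝ) :
    matrixNorm2 (c • A) = c * matrixNorm2 A := by
  have h : ∑ i, ∑ j, |(c • A) i j| ^ 2 = c ^ 2 * ∑ i, ∑ j, |A i j| ^ 2 := by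
    simp only [Finset.mul_sum]
    refine Finset.sum_congr rfl fun i _ => Finset.sum_congr rfl fun j _ => ?_
    rw [Matrix.smul_apply, smul_eq_mul, abs_mul, mul_pow, sq_abs c]
  rw [matrixNorm2, h, matrixNorm2, mul_left_comm, Real.sqrt_mul (sq_nonneg c), Real.sqrt_sq hc]

lemma matrixNorm2_neg (A : Matrix (Fin n) (Fin n) ℝ) : matrixNorm2 (-A) = matrixNorm2 A := by
  simp [matrixNorm2]

lemma matrixNorm2_sub_comm (A A' : Matrix (Fin n) (Fin n) ℝ) :
    matrixNorm2 (A - A') = matrixNorm2 (A' - A) := by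
  rw [← matrixNorm2_neg, neg_sub]

lemma matrixNorm2_sub_le (A A' A'' : Matrix (Fin n) (Fin n) ℝ) :
    matrixNorm2 (A - A'') ≤ matrixNorm2 (A - A') + matrixNorm2 (A' - A'') := by
  simpa using matrixNorm2_add_le (A - A') (A' - A'')

/-- A single entry already contributes at least `κ² (B a b)²` to the squared norm. -/
lemma abs_le_weightedNorm_div {p : Fin k → ℝ} {κ : ℝ} (hκ : 0 < κ) (hp : ∀ a, κ ≤ p a)
    (B : Fin k → Fin k → ℝ) (a b : Fin k) : |B a b| ≤ weightedNorm p B / κ := by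
  have hp0 : ∀ a, 0 ≤ p a := fun a => hκ.le.trans (hp a)
  rw [le_div_iff₀ hκ]
  refine (pow_le_pow_iff_left₀ (by positivity) (weightedNorm_nonneg _ _) two_ne_zero).1 ?_
  rw [weightedNorm_sq hp0, mul_pow, sq_abs]
  have h1 : p a * p b * B a b ^ 2 ≤ ∑ i, ∑ j, p i * p j * B i j ^ 2 :=
    (Finset.single_le_sum (f := fun j => p a * p j * B a j ^ 2) (fun j _ => by
      have := hp0 a; have := hp0 j; positivity) (Finset.mem_univ b)).trans
    (Finset.single_le_sum (f := fun i => ∑ j, p i * p j * B i j ^ 2) (fun i _ =>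
      Finset.sum_nonneg fun j _ => by have := hp0 i; have := hp0 j; positivity)
      (Finset.mem_univ a))
  refine le_trans ?_ h1
  have h2 : κ * κ ≤ p a * p b := mul_le_mul (hp a) (hp b) hκ.le (hp0 a)
  linarith [mul_le_mul_of_nonneg_right h2 (sq_nonneg (B a b))]

lemma partClass_card_sum (σ : Fin n → Fin k) : ∑ a, (partClass σ a).card = n := by
  have := Finset.card_eq_sum_card_fiberwise (f := σ) (s := Finset.univ) (t := Finset.univ)
    fun _ _ => Finset.mem_coe.2 (Finset.mem_univ _)
  simpa [partClass] using this.symm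

/-- Disjoint classes of size at least `⌊n κ⌋` number at most `n / ⌊n κ⌋`. So the rounded competitor
never needs more classes than the algorithm has. -/
lemma le_numClasses {κ : ℝ} (hκ : 1 ≤ n * κ) {σ : Fin n → Fin k}
    (hσ : ∀ a, ⌊(n : ℝ) * κ⌋₊ ≤ (partClass σ a).card) : k ≤ numClasses n κ := by
  have h1 : (0 : ℝ) < ⌊(n : ℝ) * κ⌋₊ := by exact_mod_cast one_le_floor hκ
  have h2 : k * ⌊(n : ℝ) * κ⌋₊ ≤ n := by
    calc k * ⌊(n : ℝ) * κ⌋₊ = ∑ _a : Fin k, ⌊(n : ℝ) * κ⌋₊ := by simp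
      _ ≤ ∑ a, (partClass σ a).card := Finset.sum_le_sum fun a _ => hσ a
      _ = n := partClass_card_sum σ
  have h3 : (k : ℝ) ≤ n / ⌊(n : ℝ) * κ⌋₊ := by
    rw [le_div_iff₀ h1]; exact_mod_cast h2
  exact_mod_cast h3.trans (Nat.le_ceil _)

/-- Rounding of a block model to an admissible partition. -/
lemma exists_admissible (hn : 0 < n) {κ : ℝ} (hκ0 : 0 < κ) (hκ : 1 ≤ n * κ)
    {H : Matrix (Fin n) (Fin n) ℝ} (hH : ∀ i, H i i = 0) {b : BlockModel} (hb : b.IsValid)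
    (hbκ : ∀ i, κ ≤ b.p i) {d : ℝ}
    (hd : deltaDist 2 (uniformWeight n) H b.measure b.B < ENNReal.ofReal d) {η K : ℝ} (hη : 0 < η)
    (hη1 : η ≤ 1) (hηκ : 1 / (n * κ) ≤ η ^ 2) (hK : 0 < K) :
    ∃ (σ : Fin n → Fin (numClasses n κ))
      (B : Matrix (Fin (numClasses n κ)) (Fin (numClasses n κ)) ℝ), IsAdmissible κ σ ∧
      (∀ u v, |B (σ u) (σ v)| ≤ weightedNorm b.p b.B / κ) ∧
      matrixNorm2 (H - B.submatrix σ σ) ≤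
        Real.sqrt (d ^ 2 + η * weightedNorm b.p b.B ^ 2 + 32 * K * η * weightedNorm b.p b.B ^ 2) +
        Real.sqrt ((d ^ 2 + η * weightedNorm b.p b.B ^ 2) / K +
          32 * η * weightedNorm b.p b.B ^ 2) := by
  have hn' : (n : ℝ) ≠ 0 := Nat.cast_ne_zero.2 hn.ne'
  obtain ⟨w, hw, hw1, hw2, ho⟩ := exists_weights_of_deltaDist_lt (fun _ => by positivity)
    (by simp [hn']) hb.p_nonneg hd
  obtain ⟨σ, hσ, hle⟩ := exists_rounding hn hH hb.B_symm hκ0 hη hη1 hηκ hK hbκ hb.p_sum hw hw1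
    hw2 ho
  have hk := le_numClasses hκ hσ
  -- The competitor may use fewer classes; the surplus classes stay empty, which is admissible, and
  -- their entries are set to `0`.
  let B : Matrix (Fin (numClasses n κ)) (Fin (numClasses n κ)) ℝ := fun i j =>
    if h : (i : ℕ) < b.k ∧ (j : ℕ) < b.k then b.B ⟨i, h.1⟩ ⟨j, h.2⟩ else 0
  have hB : ∀ a c : Fin b.k, B (Fin.castLE hk a) (Fin.castLE hk c) = b.B a c := fun a c => by
    simp [B]
  refine ⟨fun u => Fin.castLE hk (σ u), B, ?_, fun u v => ?_, ?_⟩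
  · rintro i ⟨v, hv⟩
    simp only [partClass, Finset.mem_filter, Finset.mem_univ, true_and] at hv
    subst hv
    refine (hσ (σ v)).trans (le_of_eq (congrArg _ ?_))
    ext u
    simp [partClass]
  · rw [hB]
    exact abs_le_weightedNorm_div hκ0 hbκ b.B _ _
  · rw [matrixNorm2_eq_weightedNorm]
    refine le_trans (le_of_eq ?_) hle
    congr 1
    ext i j
    rw [Matrix.sub_apply, Matrix.submatrix_apply, hB]

/-- The values of the minimizer are averages of the adjacency matrix. -/
lemma abs_minimizer_le (hn : 0 < n) {κ : ℝ} (hκ0 : 0 < κ) (hκ : 1 ≤ n * κ)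
    {A Q : Matrix (Fin n) (Fin n) ℝ} {Δ : ℝ} (hclose : BlockClose (numClasses n κ) A Q Δ)
    {σ : Fin n → Fin (numClasses n κ)}
    {B : Matrix (Fin (numClasses n κ)) (Fin (numClasses n κ)) ℝ} (hσ : IsAdmissible κ σ)
    (hmin : ∀ (σ' : Fin n → Fin (numClasses n κ))
      (B' : Matrix (Fin (numClasses n κ)) (Fin (numClasses n κ)) ℝ), IsAdmissible κ σ' →
      matrixNorm2 (A - B.submatrix σ σ) ≤ matrixNorm2 (A - B'.submatrix σ' σ')) (u v : Fin n) :
    |B (σ u) (σ v)| ≤ 2 / κ * matrixNorm2 Q + 4 / κ ^ 2 * Δ := by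
  have hcard : ∀ u, ⌊(n : ℝ) * κ⌋₊ ≤ (partClass σ (σ u)).card := fun u =>
    hσ (σ u) ⟨u, by simp [partClass]⟩
  rw [eq_blockAvg_of_forall_le hn (fun B' => hmin σ B' hσ) u v]
  refine (abs_blockAvg_le hclose (one_le_floor hκ) (hcard u) (hcard v)).trans ?_
  have h1 := div_floor_le hκ0 hκ
  have h0 := hclose.nonneg hn (numClasses_pos hn hκ)
  have h2 : (4 : ℝ) / κ ^ 2 = (2 / κ) ^ 2 := by rw [div_pow]; norm_num
  rw [h2]
  have := matrixNorm2_nonneg Q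
  gcongr

/-- The labelling `σ` carries the uniform measure to the class weights, so it couples the block
model with `H` at the cost of the matrix distance. -/
lemma deltaTo_scale_le (hn : 0 < n) {Ω : Type*} [MeasurableSpace Ω] {π : Measure Ω}
    {W : Ω → Ω → ℝ} (hW : Measurable (Function.uncurry W)) (H : Matrix (Fin n) (Fin n) ℝ)
    (σ : Fin n → Fin k) (B : Matrix (Fin k) (Fin k) ℝ) (c : ℝ) :
    (BlockModel.scale c ⟨k, fun i => ((partClass σ i).card : ℝ) / n, B⟩).deltaTo 2 π W ≤
      deltaDist 2 (uniformWeight n) H π W +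
        ENNReal.ofReal (matrixNorm2 (H - (c • B).submatrix σ σ)) := by
  have : Nonempty (Fin k) := ⟨σ ⟨0, hn⟩⟩
  have := isProbabilityMeasure_uniformWeight hn
  have hmap : (uniformWeight n).map σ =
      weightMeasure fun i => ((partClass σ i).card : ℝ) / n := by
    rw [uniformWeight, map_weightMeasure fun _ => by positivity]
    congr 1; ext a
    rw [← Finset.sum_filter, Finset.sum_const, nsmul_eq_mul, mul_one_div, partClass]
  have hprob : IsProbabilityMeasure (weightMeasure fun i => ((partClass σ i).card : ℝ) / n) := by
    rw [← hmap]; exact Measure.isProbabilityMeasure_map Measurable.of_discrete.aemeasurable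
  have h1 := deltaDist_le_of_map (p := 2) (μ := uniformWeight n) (f := σ) Measurable.of_discrete
    measurable_id (measurable_uncurry_of_finite (c • B)) (measurable_uncurry_of_finite H)
  rw [Measure.map_id, hmap] at h1
  change deltaDist 2 (weightMeasure fun i => ((partClass σ i).card : ℝ) / n) (c • B) π W ≤ _
  refine (deltaDist_triangle (π₂ := uniformWeight n) (by norm_num)
    (measurable_uncurry_of_finite (c • B))
    (measurable_uncurry_of_finite H) hW).trans ?_
  rw [add_comm]
  refine add_le_add le_rfl (h1.trans (le_of_eq ?_))
  rw [matrixNorm2_sub_comm, matrixNorm2_eq_weightedNorm]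
  exact eLpNorm_prod_weightMeasure (fun _ => by positivity)
    (fun i j => (c • B) (σ i) (σ j) - H i j)

/-- The error of the least squares algorithm in terms of a competing block model. -/
lemma IsLeastSquaresOutput.deltaTo_le (hn : 0 < n) {κ ρ : ℝ} (hκ0 : 0 < κ) (hκ : 1 ≤ n * κ)
    (hρ : 0 < ρ) {G : SimpleGraph (Fin n)} {What : BlockModel}
    (hout : IsLeastSquaresOutput κ G What) {Ω : Type*} [MeasurableSpace Ω] {π : Measure Ω}
    {W : Ω → Ω → ℝ} (hW : Measurable (Function.uncurry W)) {Q H : Matrix (Fin n) (Fin n) ℝ}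
    (hH : ∀ i, H i i = 0) {Δ : ℝ}
    (hclose : BlockClose (numClasses n κ) (G.adjMatrix ℝ) Q (ρ * Δ)) {T h N : ℝ}
    (hT : matrixNorm2 (ρ⁻¹ • Q - H) ≤ T) (hh : matrixNorm2 H ≤ h) (hh0 : 0 < h)
    {b : BlockModel} (hb : b.IsValid) (hbκ : ∀ i, κ ≤ b.p i) (hN : weightedNorm b.p b.B ≤ N)
    (hN0 : 0 < N) {d : ℝ}
    (hd : deltaDist 2 (uniformWeight n) H b.measure b.B < ENNReal.ofReal d) {η K : ℝ} (hη : 0 < η)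
    (hη1 : η ≤ 1) (hηκ : 1 / (n * κ) ≤ η ^ 2) (hK : 0 < K) :
    (What.scale (1 / ρ)).deltaTo 2 π W ≤ deltaDist 2 (uniformWeight n) H π W +
      ENNReal.ofReal (2 * T + (Real.sqrt (d ^ 2 + η * N ^ 2 + 32 * K * η * N ^ 2) +
        Real.sqrt ((d ^ 2 + η * N ^ 2) / K + 32 * η * N ^ 2)) +
        Real.sqrt (2 * (2 / κ * (h + T) + 4 / κ ^ 2 * Δ + N / κ) * Δ)) := by
  obtain ⟨σ, B, hσ, hmin, rfl⟩ := hout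
  obtain ⟨σ', B', hσ', hB', hle⟩ := exists_admissible hn hκ0 hκ hH hb hbκ hd hη hη1 hηκ hK
  set A := G.adjMatrix ℝ
  have hT0 : 0 ≤ T := (matrixNorm2_nonneg _).trans hT
  have hΔ0 : 0 ≤ Δ := nonneg_of_mul_nonneg_right
    (hclose.nonneg hn (numClasses_pos hn hκ)) hρ
  have hQ : matrixNorm2 Q ≤ ρ * (h + T) := by
    have h1 := matrixNorm2_add_le (ρ⁻¹ • Q - H) H
    rw [sub_add_cancel, matrixNorm2_smul (inv_nonneg.2 hρ.le), inv_mul_le_iff₀ hρ] at h1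
    exact h1.trans (mul_le_mul_of_nonneg_left (by linarith) hρ.le)
  have hBb : ∀ u v, |B (σ u) (σ v)| ≤ ρ * (2 / κ * (h + T) + 4 / κ ^ 2 * Δ) := fun u v => by
    refine (abs_minimizer_le hn hκ0 hκ hclose hσ hmin u v).trans ?_
    have := mul_le_mul_of_nonneg_left hQ (by positivity : 0 ≤ 2 / κ)
    linarith
  have hBb' : ∀ u v, |(ρ • B') (σ' u) (σ' v)| ≤ ρ * (N / κ) := fun u v => by
    rw [Matrix.smul_apply, smul_eq_mul, abs_mul, abs_of_pos hρ]
    have := hB' u v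
    gcongr
    exact this.trans (by gcongr)
  -- The competitor lives on the scale of `W`, the adjacency matrix on the scale of `ρ W`; hence the
  -- comparison with `ρ • B'`.
  have hcmp := matrixNorm2_compare hn hclose (by positivity) (by positivity) hBb hBb'
    (hmin σ' (ρ • B') hσ')
  have e1 : ∀ D : Matrix (Fin n) (Fin n) ℝ,
      matrixNorm2 (ρ⁻¹ • Q - ρ⁻¹ • D) = ρ⁻¹ * matrixNorm2 (Q - D) := fun D => by
    rw [← smul_sub, matrixNorm2_smul (inv_nonneg.2 hρ.le)]
  have e2 : (ρ⁻¹ • (ρ • B').submatrix σ' σ') = B'.submatrix σ' σ' := by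
    ext i j
    simp [hρ.ne']
  have e3 : ρ⁻¹ * Real.sqrt (2 * (ρ * (2 / κ * (h + T) + 4 / κ ^ 2 * Δ) + ρ * (N / κ)) * (ρ * Δ)) =
      Real.sqrt (2 * (2 / κ * (h + T) + 4 / κ ^ 2 * Δ + N / κ) * Δ) := by
    have : 2 * (ρ * (2 / κ * (h + T) + 4 / κ ^ 2 * Δ) + ρ * (N / κ)) * (ρ * Δ) =
        ρ ^ 2 * (2 * (2 / κ * (h + T) + 4 / κ ^ 2 * Δ + N / κ) * Δ) := by ring
    rw [this, Real.sqrt_mul (sq_nonneg ρ), Real.sqrt_sq hρ.le, inv_mul_cancel_left₀ hρ.ne']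
  have hcmp' : matrixNorm2 (ρ⁻¹ • Q - ρ⁻¹ • B.submatrix σ σ) ≤
      matrixNorm2 (ρ⁻¹ • Q - B'.submatrix σ' σ') +
        Real.sqrt (2 * (2 / κ * (h + T) + 4 / κ ^ 2 * Δ + N / κ) * Δ) := by
    rw [← e2, e1, e1, ← e3, ← mul_add]
    exact mul_le_mul_of_nonneg_left hcmp (inv_nonneg.2 hρ.le)
  refine (deltaTo_scale_le hn hW H σ B (1 / ρ)).trans (add_le_add le_rfl
    (ENNReal.ofReal_le_ofReal ?_))
  have h1 := matrixNorm2_sub_le H (ρ⁻¹ • Q) (ρ⁻¹ • B.submatrix σ σ)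
  have h2 := matrixNorm2_sub_le (ρ⁻¹ • Q) H (B'.submatrix σ' σ')
  rw [matrixNorm2_sub_comm H (ρ⁻¹ • Q)] at h1
  have e4 : ((1 / ρ) • B).submatrix σ σ = ρ⁻¹ • B.submatrix σ σ := by
    ext i j; simp
  rw [e4]
  have h3 : weightedNorm b.p b.B ^ 2 ≤ N ^ 2 :=
    pow_le_pow_left₀ (weightedNorm_nonneg _ _) hN 2
  have h4 : Real.sqrt (d ^ 2 + η * weightedNorm b.p b.B ^ 2 +
      32 * K * η * weightedNorm b.p b.B ^ 2) ≤
      Real.sqrt (d ^ 2 + η * N ^ 2 + 32 * K * η * N ^ 2) := by gcongr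
  have h5 : Real.sqrt ((d ^ 2 + η * weightedNorm b.p b.B ^ 2) / K +
      32 * η * weightedNorm b.p b.B ^ 2) ≤
      Real.sqrt ((d ^ 2 + η * N ^ 2) / K + 32 * η * N ^ 2) := by gcongr
  linarith

end deterministic
/-! ## The oracle inequality -/

section oracle

variable {Ω : Type u} [MeasurableSpace Ω] {π : Measure Ω} [IsProbabilityMeasure π] {n : ℕ}
  {W : Ω → Ω → ℝ}

lemma sum_le_sq_mul_matrixNorm2 (A : Matrix (Fin n) (Fin n) ℝ) :
    ∑ i, ∑ j, A i j ≤ (n : ℝ) ^ 2 * matrixNorm2 A := by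
  rcases Nat.eq_zero_or_pos n with rfl | hn
  · simp
  have hn' : (0 : ℝ) < n := Nat.cast_pos.2 hn
  refine (le_abs_self _).trans (abs_le_of_sq_le_sq ?_
    (by have := matrixNorm2_nonneg A; positivity))
  rw [mul_pow, matrixNorm2_sq]
  have h := sq_sum_le_card_mul_sum_sq (s := (Finset.univ : Finset (Fin n × Fin n)))
    (f := fun z => A z.1 z.2)
  rw [Fintype.sum_prod_type, Fintype.sum_prod_type] at h
  refine h.trans (le_of_eq ?_)
  simp
  field_simp

lemma sum_weightedGraph_le {ρ : ℝ} (hρ : 0 < ρ) (y : Fin n → Ω) :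
    ∑ i, ∑ j, weightedGraph ρ W y i j ≤ ρ * n ^ 2 * matrixNorm2 (sampledMatrix W y) := by
  have h := mul_le_mul_of_nonneg_left (sum_le_sq_mul_matrixNorm2 (sampledMatrix W y)) hρ.le
  rw [← mul_assoc] at h
  refine le_trans ?_ h
  simp only [Finset.mul_sum]
  refine Finset.sum_le_sum fun i _ => Finset.sum_le_sum fun j _ => ?_
  unfold weightedGraph sampledMatrix
  split_ifs
  · simp
  · exact min_le_right _ _

lemma sampledMatrix_diag (y : Fin n → Ω) (i : Fin n) : sampledMatrix W y i i = 0 := by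
  simp [sampledMatrix]

lemma ofReal_matrixNorm2_sampledMatrix_le (hn : 0 < n) (hW : Measurable (Function.uncurry W))
    (y : Fin n → Ω) :
    ENNReal.ofReal (matrixNorm2 (sampledMatrix W y)) ≤
      deltaDist 2 (uniformWeight n) (sampledMatrix W y) π W + graphonNorm 2 π W := by
  have := isProbabilityMeasure_uniformWeight hn
  rw [← graphonNorm_uniformWeight]
  exact graphonNorm_le_deltaDist_add (measurable_uncurry_of_finite _) hW

lemma BlockModel.IsValid.isProbabilityMeasure {b : BlockModel} (hb : b.IsValid) :
    IsProbabilityMeasure b.measure :=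
  isProbabilityMeasure_weightMeasure hb.p_nonneg hb.p_sum

lemma ofReal_weightedNorm_le {b : BlockModel} (hb : b.IsValid)
    (hW : Measurable (Function.uncurry W)) :
    ENNReal.ofReal (weightedNorm b.p b.B) ≤ b.deltaTo 2 π W + graphonNorm 2 π W := by
  have := hb.isProbabilityMeasure
  refine le_trans (le_of_eq (graphonNorm_weightMeasure hb.p_nonneg b.B).symm) ?_
  exact graphonNorm_le_deltaDist_add (π := b.measure) (measurable_uncurry_of_finite _) hW

lemma deltaDist_blockModel_le (hn : 0 < n) {b : BlockModel} (hb : b.IsValid)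
    (hW : Measurable (Function.uncurry W)) (H : Matrix (Fin n) (Fin n) ℝ) :
    deltaDist 2 (uniformWeight n) H b.measure b.B ≤
      deltaDist 2 (uniformWeight n) H π W + b.deltaTo 2 π W := by
  have := isProbabilityMeasure_uniformWeight hn
  have := hb.isProbabilityMeasure
  have : Nonempty (Fin n) := ⟨⟨0, hn⟩⟩
  refine (deltaDist_triangle (π₂ := π) (by norm_num) (measurable_uncurry_of_finite H) hW
    (measurable_uncurry_of_finite b.B)).trans ?_
  gcongr
  exact deltaDist_comm_le (measurable_uncurry_of_finite b.B) hW

/-- The zero block model with a single block is a competitor for every `κ ≤ 1`. -/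
lemma oracleError_le_graphonNorm (hW : Measurable (Function.uncurry W)) {κ : ℝ} (h1 : κ ≤ 1) :
    oracleError 2 κ π W ≤ graphonNorm 2 π W := by
  let b : BlockModel := ⟨1, fun _ => 1, fun _ _ => 0⟩
  have hb : b.IsValid := ⟨fun _ => zero_le_one, by simp [b], fun _ _ => rfl, fun _ _ => le_rfl⟩
  refine (iInf₂_le b ⟨hb, fun _ => h1⟩).trans ?_
  have hmap : π.map (fun _ => (0 : Fin 1)) = b.measure := by
    rw [Measure.map_const]; simp [BlockModel.measure, b]
  have h := deltaDist_le_of_map (p := 2) (μ := π) (f := fun _ => (0 : Fin 1)) measurable_const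
    measurable_id (measurable_uncurry_of_finite b.B) hW
  rw [hmap, Measure.map_id] at h
  refine h.trans (le_of_eq ?_)
  rw [graphonNorm, ← eLpNorm_neg]
  congr 1
  ext q
  simp [b, Function.uncurry]

lemma tailNorm_le_graphonNorm (hW : IsGraphon π W) {ρ : ℝ} (hρ : 0 < ρ) :
    tailNorm 2 ρ π W ≤ graphonNorm 2 π W := by
  refine eLpNorm_mono fun z => ?_
  have h0 := hW.nonneg z.1 z.2
  have h1 : 0 ≤ min (W z.1 z.2) ρ⁻¹ := le_min h0 (inv_nonneg.2 hρ.le)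
  have h2 := min_le_left (W z.1 z.2) ρ⁻¹
  simp only [Function.uncurry, Real.norm_eq_abs]
  rw [abs_of_nonneg h0, abs_of_nonneg (by linarith)]
  linarith

lemma sqrt_sqrt_eq_rpow {x : ℝ} (hx : 0 ≤ x) : Real.sqrt (Real.sqrt x) = x ^ (1 / 4 : ℝ) := by
  rw [Real.sqrt_eq_rpow, Real.sqrt_eq_rpow, ← Real.rpow_mul hx]
  norm_num

lemma sqrt_sq_add_le {c s N : ℝ} (hc : 0 ≤ c) (hs : 0 ≤ s) (hN : 0 ≤ N) :
    Real.sqrt (c ^ 2 + 33 * s ^ 2 * N ^ 2) ≤ c + 6 * N * s := by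
  rw [Real.sqrt_le_left (by positivity)]
  nlinarith [mul_nonneg hc (mul_nonneg hN hs), sq_nonneg (s * N)]

/-- The oracle inequality for one realization, with the probabilistic estimates as hypotheses. -/
lemma IsLeastSquaresOutput.deltaTo_le_oracle (hW : IsGraphon π W) {L : ℝ} (hL0 : 1 ≤ L)
    (hL : graphonNorm 2 π W ≤ ENNReal.ofReal L) {κ ρ : ℝ} (hn : 2 ≤ n) (hκ0 : 0 < κ)
    (hκ : 1 ≤ n * κ) (hρ : 0 < ρ) (hκ1 : κ ≤ 1) {C : ℝ} (hC : 1 ≤ C)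
    (hs : (1 + Real.log (1 / κ)) / κ ^ 2 ≤ C * (ρ * n)) {y : Fin n → Ω} {G : SimpleGraph (Fin n)}
    {What : BlockModel} (hout : IsLeastSquaresOutput κ G What) {b : BlockModel} (hb : b.IsValid)
    (hbκ : ∀ i, κ ≤ b.p i) {s e g N a h τ : ℝ} (hs0 : s ^ 4 = 1 / (n * κ)) (hspos : 0 < s)
    (he : oracleError 2 κ π W = ENNReal.ofReal e) (he0 : 0 ≤ e)
    (hbe : b.deltaTo 2 π W < ENNReal.ofReal (e + s)) (hg : 0 ≤ g) (hN : N = 2 * L + 1)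
    (ha : a = 2 * g * (1 + 6 * N) + 1) (hh : h = L + a * (L + 2)) (hτ : 0 ≤ τ)
    (hD : deltaDist 2 (uniformWeight n) (sampledMatrix W y) π W ≤
      ENNReal.ofReal (2 * (g * Real.sqrt ((e + s) ^ 2 + 33 * s ^ 2 * N ^ 2)) + (e + s)))
    (hT : ENNReal.ofReal (matrixNorm2 (ρ⁻¹ • weightedGraph ρ W y - sampledMatrix W y)) ≤
      ENNReal.ofReal g * tailNorm 2 ρ π W)
    (hclose : ∑ u, ∑ v, weightedGraph ρ W y u v ≤ ρ * n ^ 2 * h →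
      BlockClose (numClasses n κ) (G.adjMatrix ℝ) (weightedGraph ρ W y)
        (τ * ρ * Real.sqrt ((1 + Real.log (1 / κ)) / (ρ * n)))) :
    (What.scale (1 / ρ)).deltaTo 2 π W ≤ ENNReal.ofReal (12 * a + 2 * g + 4 + 24 * N +
      Real.sqrt (2 * (2 * (h + g * L) + 4 * (τ * Real.sqrt C) + N) * τ)) *
        oracleBound π W n κ ρ := by
  have hn0 : 0 < n := by omega
  have hn' : (0 : ℝ) < n := Nat.cast_pos.2 hn0
  have hlog := one_le_one_add_log hκ0 hκ1
  have hN1 : 0 < N := by linarith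
  have ha1 : 1 ≤ a := by rw [ha]; nlinarith [mul_nonneg hg hN1.le]
  have hh0 : 0 < h := by rw [hh]; nlinarith
  -- sizes
  have heL : e ≤ L := by
    have h1 := (he ▸ oracleError_le_graphonNorm hW.measurable hκ1).trans hL
    exact (ENNReal.ofReal_le_ofReal_iff (by linarith)).1 h1
  have hnκ : 0 < n * κ := by positivity
  have hs1 : s ≤ 1 := by
    have h1 : s ^ 4 ≤ 1 := by rw [hs0]; exact (div_le_one hnκ).2 hκ
    by_contra! h2
    exact absurd h1 (not_le.2 (one_lt_pow₀ h2 (by norm_num)))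
  obtain ⟨t, ht0, ht⟩ : ∃ t : ℝ, 0 ≤ t ∧ tailNorm 2 ρ π W = ENNReal.ofReal t :=
    ⟨(tailNorm 2 ρ π W).toReal, ENNReal.toReal_nonneg, (ENNReal.ofReal_toReal
      (ne_top_of_le_ne_top ENNReal.ofReal_ne_top
        ((tailNorm_le_graphonNorm hW hρ).trans hL))).symm⟩
  have htL : t ≤ L := by
    have h1 := (ht ▸ tailNorm_le_graphonNorm hW hρ).trans hL
    exact (ENNReal.ofReal_le_ofReal_iff (by linarith)).1 h1
  set Dr := 2 * (g * Real.sqrt ((e + s) ^ 2 + 33 * s ^ 2 * N ^ 2)) + (e + s) with hDr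
  have hDr0 : 0 ≤ Dr := by positivity
  -- The constant `a` turns the sampling error into a multiple of the oracle error plus the slack
  -- `s`; then `h` bounds the norm of the sampled matrix in terms of `L` and the probability level
  -- only.
  have hDra : Dr ≤ a * (e + 2 * s) := by
    have h1 := mul_le_mul_of_nonneg_left
      (sqrt_sq_add_le (c := e + s) (by linarith) hspos.le hN1.le) hg
    have h2 : g * (e + s + 6 * N * s) ≤ g * (1 + 6 * N) * (e + 2 * s) := by
      have h3 : e + s + 6 * N * s ≤ (1 + 6 * N) * (e + 2 * s) := by
        nlinarith [mul_nonneg hN1.le he0, mul_nonneg hN1.le hspos.le]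
      linarith [mul_le_mul_of_nonneg_left h3 hg]
    rw [hDr, ha]
    linarith
  have hDrL : Dr ≤ a * (L + 2) := hDra.trans (by
    have : e + 2 * s ≤ L + 2 := by linarith
    gcongr)
  have hH : matrixNorm2 (sampledMatrix W y) ≤ h := by
    have h1 := (ofReal_matrixNorm2_sampledMatrix_le (π := π) hn0 hW.measurable y).trans
      (add_le_add hD hL)
    rw [← ENNReal.ofReal_add hDr0 (by linarith)] at h1
    have h2 := (ENNReal.ofReal_le_ofReal_iff (by linarith)).1 h1
    rw [hh]; linarith
  have hTt : matrixNorm2 (ρ⁻¹ • weightedGraph ρ W y - sampledMatrix W y) ≤ g * t := by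
    rw [ht, ← ENNReal.ofReal_mul hg] at hT
    exact (ENNReal.ofReal_le_ofReal_iff (by positivity)).1 hT
  have hNb : weightedNorm b.p b.B ≤ N := by
    have h1 := (ofReal_weightedNorm_le hb hW.measurable).trans (add_le_add hbe.le hL)
    rw [← ENNReal.ofReal_add (by linarith) (by linarith)] at h1
    have h2 := (ENNReal.ofReal_le_ofReal_iff (by linarith)).1 h1
    linarith
  have hd : deltaDist 2 (uniformWeight n) (sampledMatrix W y) b.measure b.B <
      ENNReal.ofReal (Dr + (e + s)) := by
    refine (deltaDist_blockModel_le (π := π) hn0 hb hW.measurable _).trans_lt ?_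
    rw [ENNReal.ofReal_add hDr0 (by linarith)]
    exact ENNReal.add_lt_add_of_le_of_lt (ne_top_of_le_ne_top ENNReal.ofReal_ne_top hD) hD hbe
  set θ := (1 + Real.log (1 / κ)) / (ρ * n) with hθ
  have hθ0 : 0 ≤ θ := by positivity
  have hcl : BlockClose (numClasses n κ) (G.adjMatrix ℝ) (weightedGraph ρ W y)
      (ρ * (τ * Real.sqrt θ)) := by
    have h1 := hclose ((sum_weightedGraph_le hρ y).trans (by gcongr))
    have h2 : ρ * (τ * Real.sqrt θ) = τ * ρ * Real.sqrt θ := by ring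
    rwa [h2]
  have hη : 1 / (n * κ) ≤ (s ^ 2) ^ 2 := by rw [← pow_mul, hs0]
  have hη1 : s ^ 2 ≤ 1 := by nlinarith
  -- Here `η = s²` is the smallest value allowed by `1 / (n κ) ≤ η²`, and `K = 1` suffices since
  -- constant factors do not matter.
  have hmain := hout.deltaTo_le (π := π) hn0 hκ0 hκ hρ hW.measurable (sampledMatrix_diag y) hcl hTt hH hh0
    hb hbκ hNb hN1 hd (by positivity) hη1 hη one_pos
  -- the two remaining scales
  set r := ((1 + Real.log (1 / κ)) / (κ ^ 2 * ρ * n)) ^ (1 / 4 : ℝ) with hr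
  set q := (Real.log n / (κ * n)) ^ (1 / 4 : ℝ) with hq
  have hr0 : 0 ≤ r := Real.rpow_nonneg (by positivity) _
  have hlogn : 0 ≤ Real.log n := Real.log_nonneg (by exact_mod_cast hn0)
  have hq0 : 0 ≤ q := Real.rpow_nonneg (by positivity) _
  -- The slack is the fourth root of `1 / (n κ)`. Only `16 log n ≥ 1` is used, which holds for `n ≥
  -- 2`; for `n = 1` the logarithm would vanish.
  have hsq : s ≤ 2 * q := by
    have h1 : q ^ 4 = Real.log n / (κ * n) := by
      rw [hq, ← Real.rpow_natCast, ← Real.rpow_mul (by positivity)]; norm_num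
    have h2 : 1 / 16 ≤ Real.log n := by
      have h3 : Real.log 2 ≤ Real.log n := Real.log_le_log (by norm_num) (by exact_mod_cast hn)
      have := Real.log_two_gt_d9
      linarith
    refine (pow_le_pow_iff_left₀ hspos.le (by positivity) (by norm_num : (4 : ℕ) ≠ 0)).1 ?_
    rw [hs0, mul_pow, h1, mul_comm κ, ← mul_div_assoc]
    gcongr
    linarith
  -- The density assumption gives `√θ ≤ √C κ`. This turns the quadratic term `Δ²/κ²` into a multiple
  -- of `√θ/κ`, the order of the others, and the root of `√θ/κ` is exactly `r`.
  have hSr : Real.sqrt (2 * (2 / κ * (h + g * t) + 4 / κ ^ 2 * (τ * Real.sqrt θ) + N / κ) *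
      (τ * Real.sqrt θ)) ≤
      Real.sqrt (2 * (2 * (h + g * L) + 4 * (τ * Real.sqrt C) + N) * τ) * r := by
    have h1 : Real.sqrt θ ≤ Real.sqrt C * κ := by
      have h3 : θ ≤ C * κ ^ 2 := by
        rw [hθ, div_le_iff₀ (by positivity)]
        have := (div_le_iff₀ (by positivity)).1 hs
        linarith
      calc Real.sqrt θ ≤ Real.sqrt (C * κ ^ 2) := Real.sqrt_le_sqrt h3
        _ = _ := by rw [Real.sqrt_mul (by linarith), Real.sqrt_sq hκ0.le]
    have h2 : r = Real.sqrt (Real.sqrt θ / κ) := by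
      have h3 : Real.sqrt θ / κ = Real.sqrt ((1 + Real.log (1 / κ)) / (κ ^ 2 * ρ * n)) := by
        rw [← Real.sqrt_sq hκ0.le, ← Real.sqrt_div hθ0, Real.sqrt_sq hκ0.le]
        congr 1
        rw [hθ]; field_simp
      rw [h3, sqrt_sqrt_eq_rpow (by positivity)]
    rw [h2, ← Real.sqrt_mul (by have := Real.sqrt_nonneg C; positivity)]
    refine Real.sqrt_le_sqrt ?_
    have h4 : 4 / κ ^ 2 * (τ * Real.sqrt θ) ≤ 4 * (τ * Real.sqrt C) / κ := by
      calc _ ≤ 4 / κ ^ 2 * (τ * (Real.sqrt C * κ)) := by gcongr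
        _ = _ := by field_simp
    have h5 : 2 / κ * (h + g * t) + 4 / κ ^ 2 * (τ * Real.sqrt θ) + N / κ ≤
        (2 * (h + g * L) + 4 * (τ * Real.sqrt C) + N) / κ := by
      have h6 : 2 / κ * (h + g * t) ≤ 2 * (h + g * L) / κ := by
        rw [div_mul_eq_mul_div]
        gcongr
      rw [add_div, add_div]
      linarith
    calc _ ≤ 2 * ((2 * (h + g * L) + 4 * (τ * Real.sqrt C) + N) / κ) * (τ * Real.sqrt θ) := by
          gcongr
      _ = _ := by ring
  have hR : Real.sqrt ((Dr + (e + s)) ^ 2 + s ^ 2 * N ^ 2 + 32 * 1 * s ^ 2 * N ^ 2) +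
      Real.sqrt (((Dr + (e + s)) ^ 2 + s ^ 2 * N ^ 2) / 1 + 32 * s ^ 2 * N ^ 2) ≤
      2 * (Dr + (e + s) + 6 * N * s) := by
    have h1 := sqrt_sq_add_le (c := Dr + (e + s)) (by linarith) hspos.le hN1.le
    have e1 : (Dr + (e + s)) ^ 2 + s ^ 2 * N ^ 2 + 32 * 1 * s ^ 2 * N ^ 2 =
      (Dr + (e + s)) ^ 2 + 33 * s ^ 2 * N ^ 2 := by ring
    have e2 : ((Dr + (e + s)) ^ 2 + s ^ 2 * N ^ 2) / 1 + 32 * s ^ 2 * N ^ 2 =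
      (Dr + (e + s)) ^ 2 + 33 * s ^ 2 * N ^ 2 := by ring
    rw [e1, e2]
    linarith
  refine (hmain.trans (add_le_add hD le_rfl)).trans ?_
  set S := Real.sqrt (2 * (2 * (h + g * L) + 4 * (τ * Real.sqrt C) + N) * τ) with hS
  have hS0 : 0 ≤ S := Real.sqrt_nonneg _
  have e0 : oracleBound π W n κ ρ = ENNReal.ofReal (e + r + q + t) := by
    rw [oracleBound, he, ht, ENNReal.ofReal_add (by positivity) ht0,
      ENNReal.ofReal_add (by positivity) hq0, ENNReal.ofReal_add he0 hr0]
  rw [e0, ← ENNReal.ofReal_mul (by positivity), ← ENNReal.ofReal_add hDr0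
    (by have := Real.sqrt_nonneg; positivity)]
  refine ENNReal.ofReal_le_ofReal ?_
  have f0 : 0 ≤ e + r + q + t := by positivity
  have f1 : a * (e + 2 * s) ≤ a * (4 * (e + r + q + t)) :=
    mul_le_mul_of_nonneg_left (by linarith) (by linarith)
  have f2 : N * s ≤ N * (2 * (e + r + q + t)) :=
    mul_le_mul_of_nonneg_left (by linarith) hN1.le
  have f3 : g * t ≤ g * (e + r + q + t) := mul_le_mul_of_nonneg_left (by linarith) hg
  have f4 : S * r ≤ S * (e + r + q + t) := mul_le_mul_of_nonneg_left (by linarith) hS0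
  linarith

end oracle
-- The oracle inequality in probability
section oracleProbability

/-- The oracle inequality holds with high probability. -/
lemma exists_oracle_constant (C L ε : ℝ) (hε : 0 < ε) : ∃ M : ℝ≥0,
    ∀ (Ω : Type u) [MeasurableSpace Ω] (π : Measure Ω) [IsProbabilityMeasure π]
      (W : Ω → Ω → ℝ), IsGraphon π W → graphonNorm 2 π W ≤ ENNReal.ofReal L →
    ∀ (n : ℕ) (κ ρ : ℝ), 2 ≤ n → 1 / (n : ℝ) < κ → κ ≤ 1 → 0 < ρ → ρ ≤ 1 →
      (1 + Real.log (1 / κ)) / κ ^ 2 ≤ C * (ρ * n) →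
    ∀ (X : Type v) [MeasurableSpace X] (P : Measure X) [IsProbabilityMeasure P]
      (x : Fin n → X → Ω) (G : X → SimpleGraph (Fin n)), IsWRandomGraph π W ρ P x G →
      P {ω | ∃ What : BlockModel, IsLeastSquaresOutput κ (G ω) What ∧
          (M : ℝ≥0∞) * oracleBound π W n κ ρ < (What.scale (1 / ρ)).deltaTo 2 π W}
        ≤ ENNReal.ofReal ε := by
  obtain ⟨C', hC1, hCC⟩ : ∃ C' : ℝ, 1 ≤ C' ∧ C ≤ C' := ⟨max C 1, le_max_right _ _, le_max_left _ _⟩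
  obtain ⟨L', hL1, hLL⟩ : ∃ L' : ℝ, 1 ≤ L' ∧ L ≤ L' := ⟨max L 1, le_max_right _ _, le_max_left _ _⟩
  obtain ⟨K, hK0, hK⟩ : ∃ K : ℝ, 0 ≤ K ∧ Real.exp (-K) ≤ ε / 3 := by
    refine ⟨max 0 (Real.log (3 / ε)), le_max_left _ _, ?_⟩
    rw [Real.exp_neg, inv_le_comm₀ (Real.exp_pos _) (by positivity), inv_div]
    calc 3 / ε = Real.exp (Real.log (3 / ε)) := (Real.exp_log (by positivity)).symm
      _ ≤ _ := Real.exp_le_exp.2 (le_max_right _ _)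
  -- The error budget is split into three parts `ε/3`: Markov's inequality for two squared
  -- quantities, hence the root, and the deviation bound `exp (-K n)` for the edges.
  set g := Real.sqrt (3 / ε) with hg
  have hg0 : 0 ≤ g := Real.sqrt_nonneg _
  obtain ⟨N, hN⟩ : ∃ N : ℝ, N = 2 * L' + 1 := ⟨_, rfl⟩
  obtain ⟨a, ha⟩ : ∃ a : ℝ, a = 2 * g * (1 + 6 * N) + 1 := ⟨_, rfl⟩
  obtain ⟨h, hh⟩ : ∃ h : ℝ, h = L' + a * (L' + 2) := ⟨_, rfl⟩
  have hN0 : 0 < N := by linarith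
  have ha0 : 0 < a := by rw [ha]; positivity
  have hh0 : 0 ≤ h := by rw [hh]; positivity
  have hτ := deviationConst_nonneg hC1 hh0 hK0
  refine ⟨(12 * a + 2 * g + 4 + 24 * N + Real.sqrt (2 * (2 * (h + g * L') +
    4 * (deviationConst C' h K * Real.sqrt C') + N) * deviationConst C' h K)).toNNReal, ?_⟩
  intro Ω _ π _ W hW hL n κ ρ hn hκn hκ1 hρ hρ1 hs X _ P _ x G hG
  have hn0 : 0 < n := by omega
  have hn' : (0 : ℝ) < n := Nat.cast_pos.2 hn0
  have hκ0 : 0 < κ := lt_trans (by positivity) hκn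
  have hκ : 1 ≤ n * κ := by
    rw [div_lt_iff₀ hn'] at hκn
    linarith
  have hs' : (1 + Real.log (1 / κ)) / κ ^ 2 ≤ C' * (ρ * n) := hs.trans (by gcongr)
  have hL' : graphonNorm 2 π W ≤ ENNReal.ofReal L' := hL.trans (ENNReal.ofReal_le_ofReal hLL)
  obtain ⟨s, hspos, hs0⟩ : ∃ s : ℝ, 0 < s ∧ s ^ 4 = 1 / (n * κ) := by
    refine ⟨(1 / (n * κ)) ^ (1 / 4 : ℝ), Real.rpow_pos_of_pos (by positivity) _, ?_⟩
    rw [← Real.rpow_natCast, ← Real.rpow_mul (by positivity)]; norm_num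
  have hs1 : s ≤ 1 := by
    have h1 : s ^ 4 ≤ 1 := by rw [hs0]; exact (div_le_one (by positivity)).2 hκ
    by_contra! h2
    exact absurd h1 (not_le.2 (one_lt_pow₀ h2 (by norm_num)))
  have hne : oracleError 2 κ π W ≠ ∞ := ne_top_of_le_ne_top ENNReal.ofReal_ne_top
    ((oracleError_le_graphonNorm hW.measurable hκ1).trans hL')
  obtain ⟨e, he0, he⟩ : ∃ e : ℝ, 0 ≤ e ∧ oracleError 2 κ π W = ENNReal.ofReal e :=
    ⟨_, ENNReal.toReal_nonneg, (ENNReal.ofReal_toReal hne).symm⟩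
  have heL : e ≤ L' := by
    have h1 := (he ▸ oracleError_le_graphonNorm hW.measurable hκ1).trans hL'
    exact (ENNReal.ofReal_le_ofReal_iff (by linarith)).1 h1
  -- The infimum need not be attained, so the competitor is optimal up to `s`. It is chosen before
  -- the randomness.
  obtain ⟨b, ⟨hb, hbκ⟩, hbe⟩ : ∃ b : BlockModel, (b.IsValid ∧ ∀ i, κ ≤ b.p i) ∧
      b.deltaTo 2 π W < ENNReal.ofReal (e + s) := by
    have h1 : oracleError 2 κ π W < ENNReal.ofReal (e + s) := by
      rw [he]; exact (ENNReal.ofReal_lt_ofReal_iff (by linarith)).2 (by linarith)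
    simpa only [oracleError, iInf_lt_iff, exists_prop] using h1
  have hNb : weightedNorm b.p b.B ≤ N := by
    have h1 := (ofReal_weightedNorm_le hb hW.measurable).trans (add_le_add hbe.le hL')
    rw [← ENNReal.ofReal_add (by linarith) (by linarith)] at h1
    have h2 := (ENNReal.ofReal_le_ofReal_iff (by linarith)).1 h1
    linarith
  have hsample := hG.isSample
  have hM : ENNReal.ofReal (3 / ε) ≠ 0 := by
    rw [Ne, ENNReal.ofReal_eq_zero, not_le]; positivity
  have hMinv : (ENNReal.ofReal (3 / ε))⁻¹ = ENNReal.ofReal (ε / 3) := by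
    rw [← ENNReal.ofReal_inv_of_pos (by positivity), inv_div]
  have hE1 := hsample.measure_lt_deltaDist_le hn0 hW.measurable hb.B_symm hκ0 hbκ hb.p_sum
    (η := s ^ 2) (by positivity) (by nlinarith) (by rw [← pow_mul, hs0]) hbe hM
  have hE2 := hsample.measure_lt_matrixNorm2_le hn0 hW.measurable hρ hM
  have hE3 := hG.measure_not_blockClose_le hW hρ hρ1 hn0 hκ0 hκ1 hκ hC1 hh0 hK0 hs'
  rw [hMinv] at hE1 hE2
  have hE3' : ENNReal.ofReal (Real.exp (-(K * n))) ≤ ENNReal.ofReal (ε / 3) := by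
    refine ENNReal.ofReal_le_ofReal (le_trans (Real.exp_le_exp.2 ?_) hK)
    have : (1 : ℝ) ≤ n := by exact_mod_cast hn0
    nlinarith
  have hsum : ENNReal.ofReal (ε / 3) + ENNReal.ofReal (ε / 3) + ENNReal.ofReal (ε / 3) =
      ENNReal.ofReal ε := by
    rw [← ENNReal.ofReal_add (by positivity) (by positivity),
      ← ENNReal.ofReal_add (by positivity) (by positivity)]
    congr 1; ring
  rw [← hsum]
  refine (measure_mono ?_).trans ((measure_union_le _ _).trans (add_le_add
    ((measure_union_le _ _).trans (add_le_add hE1 hE2)) (hE3.trans hE3')))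
  rintro ω ⟨What, hout, hlt⟩
  by_contra hω
  simp only [Set.mem_union, Set.mem_ofPred_eq, not_or, not_lt, not_and, not_not] at hω
  obtain ⟨⟨h1, h2⟩, h3⟩ := hω
  have hMg : ENNReal.ofReal (3 / ε) ^ (1 / 2 : ℝ) = ENNReal.ofReal g := by
    rw [ENNReal.ofReal_rpow_of_nonneg (by positivity) (by norm_num), hg, Real.sqrt_eq_rpow]
  rw [hMg] at h2
  refine absurd hlt (not_lt.2 ?_)
  refine hout.deltaTo_le_oracle hW hL1 hL' hn hκ0 hκ hρ hκ1 hC1 hs' hb hbκ hs0 hspos he he0 hbe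
    hg0 hN ha hh hτ (h1.trans ?_) h2 h3
  have hes : 0 ≤ e + s := by linarith
  generalize e + s = c at *
  have hR0 := Real.sqrt_nonneg (c ^ 2 + 33 * s ^ 2 * N ^ 2)
  have e2 : ENNReal.ofReal (2 * (g * Real.sqrt (c ^ 2 + 33 * s ^ 2 * N ^ 2)) + c) =
      2 * (ENNReal.ofReal g * ENNReal.ofReal (Real.sqrt (c ^ 2 + 33 * s ^ 2 * N ^ 2))) +
        ENNReal.ofReal c := by
    rw [ENNReal.ofReal_add (by positivity) hes, ENNReal.ofReal_mul zero_le_two,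
      ENNReal.ofReal_mul hg0]
    simp
  rw [e2, ENNReal.mul_rpow_of_nonneg _ _ (by norm_num), hMg]
  gcongr
  rw [Real.sqrt_eq_rpow, ← ENNReal.ofReal_rpow_of_nonneg (by positivity) (by norm_num)]
  refine ENNReal.rpow_le_rpow ?_ (by norm_num)
  rw [← ENNReal.ofReal_pow hes, ← ENNReal.ofReal_add (by positivity) (by positivity)]
  refine ENNReal.ofReal_le_ofReal ?_
  have := weightedNorm_nonneg b.p b.B
  gcongr

end oracleProbability
/-! ## The output as a competitor for the oracle -/

section lowerBound

/-- Weights that are almost at least `κ` are close to weights that are at least `κ`. -/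
lemma exists_weights_ge {l : ℕ} {p : Fin l → ℝ} {κ τ : ℝ} (h : ∀ i, κ - τ ≤ p i)
    (h1 : ∑ i, p i = 1) (hl : l * κ ≤ 1) :
    ∃ p' : Fin l → ℝ, (∀ i, κ ≤ p' i) ∧ ∑ i, p' i = 1 ∧ ∑ i, |p' i - p i| ≤ 2 * (l * max τ 0) := by
  set t : ℝ := max τ 0
  -- Raise every weight to at least `κ` and shrink the excesses over `κ` by a common factor `s`
  -- until the total is `1` again. This is possible because `l * κ ≤ 1`.
  set e : Fin l → ℝ := fun i => max (p i - κ) 0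
  set S := ∑ i, e i with hS
  have he : ∀ i, 0 ≤ e i := fun i => le_max_right _ _
  have hS0 : 0 ≤ S := Finset.sum_nonneg fun i _ => he i
  have hlow : 1 - l * κ ≤ S := by
    calc 1 - l * κ = ∑ i, (p i - κ) := by simp [Finset.sum_sub_distrib, h1]
      _ ≤ S := Finset.sum_le_sum fun i _ => le_max_left _ _
  have hdef : ∀ i, |κ + e i - p i| ≤ t := fun i => by
    simp only [e, t]
    rcases le_total (p i - κ) 0 with h2 | h2
    · rw [max_eq_right h2, abs_le]
      constructor <;> linarith [h i, le_max_left τ 0, le_max_right τ 0]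
    · rw [max_eq_left h2]
      simp
  have hsumt : ∑ i, |κ + e i - p i| ≤ l * t := by
    calc _ ≤ ∑ _i : Fin l, t := Finset.sum_le_sum fun i _ => hdef i
      _ = _ := by simp
  -- If there is no excess, then `l * κ = 1` already, and any factor works.
  obtain ⟨s, hs0, hs1, hsS⟩ : ∃ s : ℝ, 0 ≤ s ∧ s ≤ 1 ∧ s * S = 1 - l * κ := by
    rcases hS0.eq_or_lt with h0 | h0
    · exact ⟨0, le_rfl, zero_le_one, by linarith⟩
    · exact ⟨(1 - l * κ) / S, div_nonneg (by linarith) hS0, (div_le_one h0).2 hlow,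
        div_mul_cancel₀ _ h0.ne'⟩
  refine ⟨fun i => κ + s * e i, fun i => ?_, ?_, ?_⟩
  · linarith [mul_nonneg hs0 (he i)]
  · simp only [Finset.sum_add_distrib, ← Finset.mul_sum, Finset.sum_const, Finset.card_univ,
      Fintype.card_fin, nsmul_eq_mul]
    linarith
  · have h2 : ∑ i, |κ + s * e i - (κ + e i)| = S - (1 - l * κ) := by
      have : ∀ i, |κ + s * e i - (κ + e i)| = e i - s * e i := fun i => by
        rw [abs_sub_comm, abs_of_nonneg] <;> nlinarith [he i]
      simp only [this, Finset.sum_sub_distrib, ← Finset.mul_sum]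
      linarith
    have h3 : S - (1 - l * κ) ≤ l * t := by
      refine le_trans ?_ hsumt
      calc S - (1 - l * κ) = ∑ i, (κ + e i - p i) := by
            simp [Finset.sum_sub_distrib, Finset.sum_add_distrib, h1, hS]; ring
        _ ≤ _ := Finset.sum_le_sum fun i _ => le_abs_self _
    calc _ ≤ ∑ i, (|κ + s * e i - (κ + e i)| + |κ + e i - p i|) :=
          Finset.sum_le_sum fun i _ => abs_sub_le _ _ _
      _ ≤ _ := by rw [Finset.sum_add_distrib]; linarith

lemma transportCost_le {l : ℕ} {p p' : Fin l → ℝ} (hp : ∀ i, 0 ≤ p i) (hp' : ∀ i, 0 ≤ p' i)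
    (h1 : ∑ i, p i = 1) (h1' : ∑ i, p' i = 1) {B : Fin l → Fin l → ℝ} {c : ℝ}
    (hB : ∀ i j, |B i j| ≤ c) :
    transportCost p p' B ≤ 8 * c ^ 2 * ∑ i, |p i - p' i| := by
  have h2 : ∑ i, ∑ j, B i j ^ 2 * (|p i - p' i| * (p j + p' j)) ≤
      ∑ i, ∑ j, c ^ 2 * (|p i - p' i| * (p j + p' j)) := by
    refine Finset.sum_le_sum fun i _ => Finset.sum_le_sum fun j _ =>
      mul_le_mul_of_nonneg_right (sq_le_sq' (abs_le.1 (hB i j)).1 (abs_le.1 (hB i j)).2)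
        (mul_nonneg (abs_nonneg _) (add_nonneg (hp j) (hp' j)))
  have h3 : ∑ i, ∑ j, c ^ 2 * (|p i - p' i| * (p j + p' j)) =
      c ^ 2 * (2 * ∑ i, |p i - p' i|) := by
    simp only [← Finset.mul_sum, Finset.sum_add_distrib, h1, h1', ← Finset.sum_mul]
    ring
  unfold transportCost
  linarith

/-- After its empty classes are dropped, the output is a block model, being made of averages of a
symmetric nonnegative matrix, with weights that miss `κ` by at most `1/n`. Since its entries are
bounded by `c`, repairing the weights costs little. -/
lemma IsLeastSquaresOutput.oracleError_le {n : ℕ} (hn : 0 < n) {κ ρ : ℝ} (hκ0 : 0 < κ)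
    (hκ : 1 ≤ n * κ) (hlarge : (n : ℝ) / ⌊(n : ℝ) * κ⌋₊ < ⌊1 / κ⌋₊ + 1) (hρ : 0 < ρ)
    {G : SimpleGraph (Fin n)} {What : BlockModel}
    (hout : IsLeastSquaresOutput κ G What) {Ω : Type*} [MeasurableSpace Ω] {π : Measure Ω}
    [IsProbabilityMeasure π] {W : Ω → Ω → ℝ} (hW : Measurable (Function.uncurry W))
    {Q : Matrix (Fin n) (Fin n) ℝ} {Δ c : ℝ}
    (hclose : BlockClose (numClasses n κ) (G.adjMatrix ℝ) Q (ρ * Δ))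
    (hc : 2 / κ * (ρ⁻¹ * matrixNorm2 Q) + 4 / κ ^ 2 * Δ ≤ c) :
    oracleError 2 κ π W ≤ ENNReal.ofReal (Real.sqrt (16 * c ^ 2 / κ * (1 / n))) +
      (What.scale (1 / ρ)).deltaTo 2 π W := by
  have hn' : (0 : ℝ) < n := Nat.cast_pos.2 hn
  obtain ⟨σ, B, hσ, hmin, rfl⟩ := hout
  set A := G.adjMatrix ℝ with hA
  set p : Fin (numClasses n κ) → ℝ := fun i => ((partClass σ i).card : ℝ) / n
  have hbound : ∀ u v, |ρ⁻¹ * B (σ u) (σ v)| ≤ c := fun u v => by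
    refine le_trans ?_ hc
    rw [abs_mul, abs_of_pos (inv_pos.2 hρ), inv_mul_le_iff₀ hρ]
    refine (abs_minimizer_le hn hκ0 hκ hclose hσ hmin u v).trans (le_of_eq ?_)
    field_simp
  have hAs : ∀ i j, A i j = A j i := fun i j => by simp [hA, SimpleGraph.adj_comm]
  have havg : ∀ u v, B (σ u) (σ v) = blockAvg A σ (σ u) (σ v) := fun u v =>
    eq_blockAvg_of_forall_le hn (fun B' => hmin σ B' hσ) u v
  have hp : ∀ a, 0 ≤ p a := fun a => by positivity
  have hp1 : ∑ a, p a = 1 := by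
    simp only [p, ← Finset.sum_div]
    rw [← Nat.cast_sum, partClass_card_sum, div_self hn'.ne']
  have hmem : ∀ a, 0 < p a → ∃ u, σ u = a := fun a ha => by
    have h1 : (partClass σ a).Nonempty := by
      rw [← Finset.card_pos]
      by_contra h
      have h2 : (partClass σ a).card = 0 := by omega
      simp [p, h2] at ha
    obtain ⟨u, hu⟩ := h1
    exact ⟨u, by simpa [partClass] using hu⟩
  obtain ⟨b, hb, ⟨f, hf, hf0, hfB⟩, hle⟩ := exists_blockModel_pos (π := π)
    (B := fun i j => ρ⁻¹ * B i j) hp hp1 (fun a a' ha ha' => by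
      obtain ⟨u, rfl⟩ := hmem a ha
      obtain ⟨v, rfl⟩ := hmem a' ha'
      rw [havg, havg, blockAvg_comm hAs])
    (fun a a' ha ha' => by
      obtain ⟨u, rfl⟩ := hmem a ha
      obtain ⟨v, rfl⟩ := hmem a' ha'
      rw [havg]
      refine mul_nonneg (inv_nonneg.2 hρ.le) (blockAvg_nonneg (fun i j => ?_) _ _ _)
      rw [hA, SimpleGraph.adjMatrix_apply]
      split_ifs <;> norm_num) hW
  have hle' : b.deltaTo 2 π W ≤
      (BlockModel.scale (1 / ρ) ⟨numClasses n κ, p, B⟩).deltaTo 2 π W := by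
    refine hle.trans (le_of_eq ?_)
    change _ = deltaDist 2 (weightMeasure p) ((1 / ρ) • B) π W
    congr 1
    ext i j
    simp
  have hpb : ∀ i, (⌊(n : ℝ) * κ⌋₊ : ℝ) / n ≤ b.p i := fun i => by
    rw [hf]
    obtain ⟨u, hu⟩ := hmem _ (hf0 i)
    have : ⌊(n : ℝ) * κ⌋₊ ≤ (partClass σ (f i)).card := hσ _ ⟨u, by simp [partClass, hu]⟩
    simp only [p]
    gcongr
  have hm : (0 : ℝ) < ⌊(n : ℝ) * κ⌋₊ := by exact_mod_cast one_le_floor hκ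
  -- Weights at least `κ` exist only for at most `1/κ` blocks. The number of nonempty classes is at
  -- most `n / ⌊n κ⌋`, and `hlarge` forces this integer down to `⌊1/κ⌋`.
  have hlκ : b.k * κ ≤ 1 := by
    have h1 : b.k * ((⌊(n : ℝ) * κ⌋₊ : ℝ) / n) ≤ 1 := by
      rw [← hb.p_sum]
      calc _ = ∑ _i : Fin b.k, (⌊(n : ℝ) * κ⌋₊ : ℝ) / n := by simp
        _ ≤ _ := Finset.sum_le_sum fun i _ => hpb i
    have h2 : (b.k : ℝ) ≤ n / ⌊(n : ℝ) * κ⌋₊ := by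
      rw [le_div_iff₀ hm]
      rw [← mul_div_assoc, div_le_one hn'] at h1
      exact h1
    have h3 : b.k ≤ ⌊1 / κ⌋₊ := by
      have h4 := h2.trans_lt hlarge
      exact Nat.lt_succ_iff.1 (by exact_mod_cast h4)
    have h5 : (b.k : ℝ) ≤ 1 / κ := (Nat.cast_le.2 h3).trans (Nat.floor_le (by positivity))
    rwa [le_div_iff₀ hκ0] at h5
  have hpκ : ∀ i, κ - 1 / n ≤ b.p i := fun i => by
    refine le_trans ?_ (hpb i)
    rw [le_div_iff₀ hn', sub_mul, one_div, inv_mul_cancel₀ hn'.ne']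
    linarith [Nat.lt_floor_add_one ((n : ℝ) * κ)]
  obtain ⟨p', hp', hp1', hsum⟩ := exists_weights_ge hpκ hb.p_sum hlκ
  rw [max_eq_left (by positivity)] at hsum
  let b' : BlockModel := ⟨b.k, p', b.B⟩
  have hb' : b'.IsValid := ⟨fun i => hκ0.le.trans (hp' i), hp1', hb.B_symm, hb.B_nonneg⟩
  have hBc : ∀ i j, |b.B i j| ≤ c := fun i j => by
    rw [hfB]
    obtain ⟨u, hu⟩ := hmem _ (hf0 i)
    obtain ⟨v, hv⟩ := hmem _ (hf0 j)
    rw [← hu, ← hv]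
    exact hbound u v
  have htc : transportCost p' b.p b.B ≤ 16 * c ^ 2 / κ * (1 / n) := by
    refine (transportCost_le hb'.p_nonneg hb.p_nonneg hp1' hb.p_sum hBc).trans ?_
    have h1 : (b.k : ℝ) ≤ 1 / κ := by rwa [le_div_iff₀ hκ0]
    calc 8 * c ^ 2 * ∑ i, |p' i - b.p i| ≤ 8 * c ^ 2 * (2 * (1 / κ * (1 / n))) := by
          gcongr
          exact hsum.trans (by gcongr)
      _ = _ := by ring
  have := hb'.isProbabilityMeasure
  have := hb.isProbabilityMeasure
  have : Nonempty (Fin b'.k) := by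
    by_contra h
    rw [not_nonempty_iff] at h
    simpa using hb'.p_sum
  calc oracleError 2 κ π W ≤ b'.deltaTo 2 π W := iInf₂_le b' ⟨hb', hp'⟩
    _ ≤ deltaDist 2 b'.measure b'.B b.measure b.B + b.deltaTo 2 π W :=
      deltaDist_triangle (by norm_num) (measurable_uncurry_of_finite b'.B)
        (measurable_uncurry_of_finite b.B) hW
    _ ≤ _ := by
      refine add_le_add ((deltaDist_weightMeasure_le hb'.p_nonneg hb.p_nonneg
        (hp1'.trans hb.p_sum.symm) hb.B_symm).trans ?_) hle'
      exact ENNReal.ofReal_le_ofReal (Real.sqrt_le_sqrt htc)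

end lowerBound
/-! ## Almost sure convergence -/

section convergence

variable {Ω : Type u} [MeasurableSpace Ω] {π : Measure Ω} [IsProbabilityMeasure π]
  {W : Ω → Ω → ℝ}

/-- With `K = 1` the failure probabilities are at most `exp (-n)`, hence summable. Borel–Cantelli
needs no information on how the graphs for different `n` are related. -/
lemma IsWRandomGraph.ae_eventually_blockClose (hW : IsGraphon π W) {κ ρ : ℕ → ℝ}
    (hκ : ∀ n, 0 < κ n ∧ κ n ≤ 1) (hρ : ∀ n, 0 < ρ n) (hρ1 : ∀ᶠ n in atTop, ρ n ≤ 1)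
    (hnκ : ∀ᶠ n : ℕ in atTop, 1 ≤ n * κ n)
    (hs : ∀ᶠ n : ℕ in atTop, (1 + Real.log (1 / κ n)) / κ n ^ 2 ≤ ρ n * n)
    {X : Type v} [MeasurableSpace X] {P : Measure X} [IsProbabilityMeasure P] {x : ℕ → X → Ω}
    {G : ∀ n : ℕ, X → SimpleGraph (Fin n)}
    (hG : ∀ n : ℕ, IsWRandomGraph π W (ρ n) P (fun i : Fin n => x i) (G n)) {h : ℝ} (hh : 0 ≤ h) :
    ∀ᵐ ω ∂P, ∀ᶠ n : ℕ in atTop,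
      ∑ u, ∑ v, weightedGraph (ρ n) W (fun i : Fin n => x i ω) u v ≤ ρ n * n ^ 2 * h →
      BlockClose (numClasses n (κ n)) ((G n ω).adjMatrix ℝ)
        (weightedGraph (ρ n) W fun i : Fin n => x i ω)
        (deviationConst 1 h 1 * ρ n * Real.sqrt ((1 + Real.log (1 / κ n)) / (ρ n * n))) := by
  obtain ⟨n₀, hn₀⟩ := eventually_atTop.1 (hρ1.and (hnκ.and (hs.and (eventually_gt_atTop 0))))
  set bad : ℕ → Set X := fun n => if n₀ ≤ n then
    {ω | ∑ u, ∑ v, weightedGraph (ρ n) W (fun i : Fin n => x i ω) u v ≤ ρ n * n ^ 2 * h ∧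
      ¬ BlockClose (numClasses n (κ n)) ((G n ω).adjMatrix ℝ)
        (weightedGraph (ρ n) W fun i : Fin n => x i ω)
        (deviationConst 1 h 1 * ρ n * Real.sqrt ((1 + Real.log (1 / κ n)) / (ρ n * n)))} else ∅
    with hbad
  have hle : ∀ n, P (bad n) ≤ ENNReal.ofReal (Real.exp (-n)) := fun n => by
    by_cases hn : n₀ ≤ n
    · obtain ⟨h1, h2, h3, h4⟩ := hn₀ n hn
      have := (hG n).measure_not_blockClose_le hW (hρ n) h1 h4 (hκ n).1 (hκ n).2 h2 le_rfl hh
        zero_le_one (by rwa [one_mul])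
      simp only [hbad, hn, if_true]
      rwa [one_mul] at this
    · simp [hbad, hn]
  have hsum : ∑' n, P (bad n) ≠ ∞ :=
    ne_top_of_le_ne_top Real.summable_exp_neg_nat.tsum_ofReal_ne_top (ENNReal.tsum_le_tsum hle)
  filter_upwards [ae_eventually_notMem hsum] with ω hω
  filter_upwards [hω, eventually_ge_atTop n₀] with n h1 h2 h3
  simp only [hbad, h2, if_true, Set.mem_ofPred_eq, not_and, not_not] at h1
  exact h1 h3

/-- Insert the limits into the deterministic bound with one fixed competitor `b`: all errors vanish
except the rounding cost, which tends to `d + d/√K`. -/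
lemma eventually_deltaTo_le {κ ρ : ℕ → ℝ} (hW : Measurable (Function.uncurry W))
    {H Q : ∀ n : ℕ, Matrix (Fin n) (Fin n) ℝ} (hH : ∀ n i, H n i i = 0)
    {G : ∀ n : ℕ, SimpleGraph (Fin n)} {Δ : ℕ → ℝ} (hκ : ∀ n, 0 < κ n) (hρ : ∀ n, 0 < ρ n)
    (hnκ : ∀ᶠ n : ℕ in atTop, 1 ≤ n * κ n)
    (hη : Tendsto (fun n : ℕ => 1 / (n * κ n)) atTop (𝓝 0))
    (hΔ : Tendsto (fun n => Δ n / κ n) atTop (𝓝 0))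
    (hclose : ∀ᶠ n in atTop, BlockClose (numClasses n (κ n)) ((G n).adjMatrix ℝ) (Q n)
      (ρ n * Δ n))
    (hT : Tendsto (fun n => matrixNorm2 ((ρ n)⁻¹ • Q n - H n)) atTop (𝓝 0)) {h : ℝ} (hh0 : 0 < h)
    (hh : ∀ᶠ n in atTop, matrixNorm2 (H n) ≤ h)
    (hD : Tendsto (fun n => deltaDist 2 (uniformWeight n) (H n) π W) atTop (𝓝 0))
    {b : BlockModel} (hb : b.IsValid) (hbκ : ∀ᶠ n in atTop, ∀ i, κ n ≤ b.p i) {c : ℝ}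
    (hc : b.deltaTo 2 π W < ENNReal.ofReal c) {What : ℕ → BlockModel}
    (hout : ∀ᶠ n in atTop, IsLeastSquaresOutput (κ n) (G n) (What n)) :
    ∀ᶠ n in atTop, ((What n).scale (1 / ρ n)).deltaTo 2 π W ≤ ENNReal.ofReal c := by
  have hne : b.deltaTo 2 π W ≠ ∞ := ne_top_of_lt hc
  obtain ⟨d, hd0, hd, hdc⟩ : ∃ d : ℝ, 0 < d ∧ b.deltaTo 2 π W < ENNReal.ofReal d ∧ d < c := by
    rw [← ENNReal.ofReal_toReal hne] at hc ⊢
    have h0 : 0 ≤ (b.deltaTo 2 π W).toReal := ENNReal.toReal_nonneg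
    have h1 := (ENNReal.ofReal_lt_ofReal_iff_of_nonneg h0).1 hc
    refine ⟨((b.deltaTo 2 π W).toReal + c) / 2, by linarith, ?_, by linarith⟩
    rw [ENNReal.ofReal_lt_ofReal_iff_of_nonneg h0]
    linarith
  -- Chosen so that `d / √K = (c - d) / 2`. A fixed `K` such as `1` would double the oracle error
  -- and lose the exact limit.
  set K : ℝ := (2 * d / (c - d)) ^ 2 with hK
  have hcd : 0 < c - d := by linarith
  have hK0 : 0 < K := by positivity
  set N : ℝ := weightedNorm b.p b.B + 1 with hN
  have hN0 : 0 < N := by have := weightedNorm_nonneg b.p b.B; linarith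
  set T : ℕ → ℝ := fun n => matrixNorm2 ((ρ n)⁻¹ • Q n - H n) with hTdef
  set η : ℕ → ℝ := fun n => Real.sqrt (1 / (n * κ n)) with hηdef
  have hη0 : Tendsto η atTop (𝓝 0) := by
    have := (Real.continuous_sqrt.tendsto 0).comp hη
    rwa [Real.sqrt_zero] at this
  have hlim : Tendsto (fun n => deltaDist 2 (uniformWeight n) (H n) π W +
      ENNReal.ofReal (2 * T n + (Real.sqrt (d ^ 2 + η n * N ^ 2 + 32 * K * η n * N ^ 2) +
        Real.sqrt ((d ^ 2 + η n * N ^ 2) / K + 32 * η n * N ^ 2)) +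
        Real.sqrt (2 * (2 / κ n * (h + T n) + 4 / κ n ^ 2 * Δ n + N / κ n) * Δ n))) atTop
      (𝓝 (ENNReal.ofReal (d + (c - d) / 2))) := by
    have e1 : Tendsto (fun n => Real.sqrt (d ^ 2 + η n * N ^ 2 + 32 * K * η n * N ^ 2)) atTop
        (𝓝 d) := by
      have := (((hη0.mul_const (N ^ 2)).const_add (d ^ 2)).add
        ((hη0.const_mul (32 * K)).mul_const (N ^ 2))).sqrt
      simpa [Real.sqrt_sq hd0.le] using this
    have e2 : Tendsto (fun n => Real.sqrt ((d ^ 2 + η n * N ^ 2) / K + 32 * η n * N ^ 2)) atTop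
        (𝓝 ((c - d) / 2)) := by
      have := ((((hη0.mul_const (N ^ 2)).const_add (d ^ 2)).div_const K).add
        ((hη0.const_mul 32).mul_const (N ^ 2))).sqrt
      have e : d ^ 2 / K = ((c - d) / 2) ^ 2 := by rw [hK]; field_simp
      simpa [e, Real.sqrt_sq (by linarith : 0 ≤ (c - d) / 2)] using this
    have e3 : Tendsto (fun n =>
        Real.sqrt (2 * (2 / κ n * (h + T n) + 4 / κ n ^ 2 * Δ n + N / κ n) * Δ n)) atTop
        (𝓝 0) := by
      have h1 : Tendsto (fun n => Real.sqrt (2 * (2 * (h + T n) * (Δ n / κ n) +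
          4 * (Δ n / κ n) ^ 2 + N * (Δ n / κ n)))) atTop (𝓝 0) := by
        have := (((((hT.const_add h).const_mul 2).mul hΔ).add ((hΔ.pow 2).const_mul 4)).add
          (hΔ.const_mul N)).const_mul 2 |>.sqrt
        simpa using this
      refine h1.congr fun n => ?_
      congr 1
      have := (hκ n).ne'
      field_simp
    have e4 := ENNReal.tendsto_ofReal (((hT.const_mul 2).add (e1.add e2)).add e3)
    simpa using hD.add e4
  have hfin : ENNReal.ofReal (d + (c - d) / 2) < ENNReal.ofReal c :=
    (ENNReal.ofReal_lt_ofReal_iff (by linarith)).2 (by linarith)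
  have hDd : ∀ᶠ n in atTop, deltaDist 2 (uniformWeight n) (H n) π W + b.deltaTo 2 π W <
      ENNReal.ofReal d := by
    have := hD.add (tendsto_const_nhds (x := b.deltaTo 2 π W))
    rw [zero_add] at this
    exact this.eventually_lt_const hd
  have hηle : ∀ᶠ n in atTop, η n ≤ 1 := hη0.eventually_le_const one_pos
  filter_upwards [hlim.eventually_lt_const hfin, hDd, hηle, hnκ, hclose, hh, hbκ, hout,
    eventually_gt_atTop 0] with n g1 g2 g3 g4 g5 g6 g7 g8 g9
  refine le_trans ?_ g1.le
  have hpos : 0 < 1 / (n * κ n) := by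
    have : (0 : ℝ) < n := Nat.cast_pos.2 g9
    have := hκ n
    positivity
  exact g8.deltaTo_le g9 (hκ n) g4 (hρ n) hW (hH n) g5 le_rfl g6 hh0 hb g7 (by linarith) hN0
    ((deltaDist_blockModel_le g9 hb hW (H n)).trans_lt g2) (Real.sqrt_pos.2 hpos) g3
    (Real.sq_sqrt hpos.le).ge hK0

/-- The properties of a realization on which the limit theorems depend. -/
structure IsRegularRealization (π : Measure Ω) (W : Ω → Ω → ℝ) (κ ρ : ℕ → ℝ)
    (H Q : ∀ n : ℕ, Matrix (Fin n) (Fin n) ℝ) (G : ∀ n : ℕ, SimpleGraph (Fin n)) (Δ : ℕ → ℝ)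
    (h : ℝ) : Prop where
  diag : ∀ n i, H n i i = 0
  large : ∀ᶠ n : ℕ in atTop, 1 ≤ n * κ n
  inv_tendsto : Tendsto (fun n : ℕ => 1 / (n * κ n)) atTop (𝓝 0)
  dev_tendsto : Tendsto (fun n => Δ n / κ n) atTop (𝓝 0)
  close : ∀ᶠ n in atTop, BlockClose (numClasses n (κ n)) ((G n).adjMatrix ℝ) (Q n) (ρ n * Δ n)
  tail_tendsto : Tendsto (fun n => matrixNorm2 ((ρ n)⁻¹ • Q n - H n)) atTop (𝓝 0)
  pos : 0 < h
  norm_le : ∀ᶠ n in atTop, matrixNorm2 (H n) ≤ h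
  dist_tendsto : Tendsto (fun n => deltaDist 2 (uniformWeight n) (H n) π W) atTop (𝓝 0)

lemma IsWRandomGraph.ae_isRegularRealization (hW : IsGraphon π W) (hW2 : graphonNorm 2 π W < ∞)
    {κ ρ : ℕ → ℝ} (hκ : ∀ n, 0 < κ n ∧ κ n ≤ 1) (hρ : ∀ n, 0 < ρ n)
    (hρ0 : Tendsto ρ atTop (𝓝 0))
    (hθ : Tendsto (fun n : ℕ => (1 + Real.log (1 / κ n)) / κ n ^ 2 / (ρ n * n)) atTop (𝓝 0))
    {X : Type v} [MeasurableSpace X] {P : Measure X} [IsProbabilityMeasure P] {x : ℕ → X → Ω}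
    {G : ∀ n : ℕ, X → SimpleGraph (Fin n)}
    (hG : ∀ n : ℕ, IsWRandomGraph π W (ρ n) P (fun i : Fin n => x i) (G n)) :
    ∃ (Δ : ℕ → ℝ) (h : ℝ), ∀ᵐ ω ∂P, IsRegularRealization π W κ ρ
      (fun n => sampledMatrix W fun i : Fin n => x i ω)
      (fun n => weightedGraph (ρ n) W fun i : Fin n => x i ω) (fun n => G n ω) Δ h := by
  set h : ℝ := (graphonNorm 2 π W).toReal + 1 with hh
  have hh0 : 0 < h := by have := ENNReal.toReal_nonneg (a := graphonNorm 2 π W); linarith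
  set τ := deviationConst 1 h 1 with hτ
  set Δ : ℕ → ℝ := fun n => τ * Real.sqrt ((1 + Real.log (1 / κ n)) / (ρ n * n)) with hΔ
  have hlog : ∀ n, 1 ≤ 1 + Real.log (1 / κ n) := fun n => one_le_one_add_log (hκ n).1 (hκ n).2
  have hρ1 : ∀ᶠ n in atTop, ρ n ≤ 1 := hρ0.eventually_le_const one_pos
  have hs : ∀ᶠ n : ℕ in atTop, (1 + Real.log (1 / κ n)) / κ n ^ 2 ≤ ρ n * n := by
    filter_upwards [hθ.eventually_le_const one_pos, eventually_gt_atTop 0] with n h1 h2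
    have : 0 < ρ n * n := mul_pos (hρ n) (Nat.cast_pos.2 h2)
    rwa [div_le_one this] at h1
  -- For `κ ≤ 1` and `ρ ≤ 1` the quantity `1/(n κ)` is dominated by the ratio in the density
  -- assumption.
  have hinv : Tendsto (fun n : ℕ => 1 / (n * κ n)) atTop (𝓝 0) := by
    refine squeeze_zero' (Eventually.of_forall fun n => ?_) ?_ hθ
    · have := (hκ n).1
      positivity
    · filter_upwards [hρ1, eventually_gt_atTop 0] with n h1 h2
      have h3 : (0 : ℝ) < n := Nat.cast_pos.2 h2
      have h4 := hκ n
      have h5 := hρ n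
      have h6 := hlog n
      rw [div_div, div_le_div_iff₀ (mul_pos h3 h4.1)
        (mul_pos (pow_pos h4.1 2) (mul_pos h5 h3))]
      have h7 : κ n * ρ n ≤ 1 := mul_le_one₀ h4.2 h5.le h1
      have h8 : 0 < n * κ n := mul_pos h3 h4.1
      nlinarith [mul_le_mul_of_nonneg_right h7 h8.le, mul_le_mul_of_nonneg_right h6 h8.le]
  have hlarge : ∀ᶠ n : ℕ in atTop, 1 ≤ n * κ n := by
    filter_upwards [hinv.eventually_le_const one_pos, eventually_gt_atTop 0] with n h1 h2
    have : (0 : ℝ) < n * κ n := mul_pos (Nat.cast_pos.2 h2) (hκ n).1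
    rwa [div_le_one this] at h1
  have hdev : Tendsto (fun n => Δ n / κ n) atTop (𝓝 0) := by
    have h1 := hθ.sqrt.const_mul τ
    rw [Real.sqrt_zero, mul_zero] at h1
    refine h1.congr fun n => ?_
    have h4 := (hκ n).1
    simp only [hΔ]
    rw [div_right_comm, Real.sqrt_div' _ (sq_nonneg _), Real.sqrt_sq h4.le, mul_div_assoc]
  have hsample : IsSample π P x := IsSample.of_forall_fin fun n => (hG n).isSample
  refine ⟨Δ, h, ?_⟩
  filter_upwards [hsample.ae_tendsto_deltaDist hW hW2,
    hsample.ae_tendsto_matrixNorm2 hW hW2 hρ hρ0,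
    IsWRandomGraph.ae_eventually_blockClose hW hκ hρ hρ1 hlarge hs hG hh0.le] with ω h1 h2 h3
  have hnorm : ∀ᶠ n : ℕ in atTop, matrixNorm2 (sampledMatrix W fun i : Fin n => x i ω) ≤ h := by
    filter_upwards [h1.eventually_le_const zero_lt_one, eventually_gt_atTop 0] with n g1 g2
    have g3 := (ofReal_matrixNorm2_sampledMatrix_le (π := π) g2 hW.measurable
      fun i : Fin n => x i ω).trans (add_le_add g1 le_rfl)
    rw [← ENNReal.ofReal_toReal hW2.ne, ← ENNReal.ofReal_one,
      ← ENNReal.ofReal_add zero_le_one ENNReal.toReal_nonneg, add_comm (1 : ℝ)] at g3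
    exact (ENNReal.ofReal_le_ofReal_iff hh0.le).1 g3
  refine ⟨fun n i => sampledMatrix_diag _ i, hlarge, hinv, hdev, ?_, h2, hh0, hnorm, h1⟩
  filter_upwards [h3, hnorm] with n g1 g2
  have g3 := g1 ((sum_weightedGraph_le (hρ n) _).trans
    (mul_le_mul_of_nonneg_left g2 (mul_nonneg (hρ n).le (sq_nonneg _))))
  have e : ρ n * Δ n =
      τ * ρ n * Real.sqrt ((1 + Real.log (1 / κ n)) / (ρ n * n)) := by
    simp only [hΔ]; ring
  rwa [e]

lemma IsRegularRealization.eventually_deltaTo_lt (hW : IsGraphon π W) {κ ρ : ℕ → ℝ}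
    (hκ : ∀ n, 0 < κ n ∧ κ n ≤ 1) (hρ : ∀ n, 0 < ρ n)
    {H Q : ∀ n : ℕ, Matrix (Fin n) (Fin n) ℝ} {G : ∀ n : ℕ, SimpleGraph (Fin n)} {Δ : ℕ → ℝ}
    {h : ℝ} (hreg : IsRegularRealization π W κ ρ H Q G Δ h) {b : BlockModel} (hb : b.IsValid)
    (hbκ : ∀ᶠ n in atTop, ∀ i, κ n ≤ b.p i) {c : ℝ≥0∞} (hc : b.deltaTo 2 π W < c)
    {What : ℕ → BlockModel}
    (hout : ∀ᶠ n in atTop, IsLeastSquaresOutput (κ n) (G n) (What n)) :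
    ∀ᶠ n in atTop, ((What n).scale (1 / ρ n)).deltaTo 2 π W < c := by
  obtain ⟨r, h1, h2⟩ := ENNReal.lt_iff_exists_nnreal_btwn.1 hc
  rw [← ENNReal.ofReal_coe_nnreal] at h1 h2
  filter_upwards [eventually_deltaTo_le hW.measurable hreg.diag (fun n => (hκ n).1) hρ hreg.large
    hreg.inv_tendsto hreg.dev_tendsto hreg.close hreg.tail_tendsto hreg.pos hreg.norm_le
    hreg.dist_tendsto hb hbκ h1 hout] with n hn
  exact hn.trans_lt h2

lemma tendsto_div_floor {κ : ℝ} (hκ : 0 < κ) :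
    Tendsto (fun n : ℕ => (n : ℝ) / ⌊(n : ℝ) * κ⌋₊) atTop (𝓝 (1 / κ)) := by
  have h1 := (tendsto_nat_floor_mul_div_atTop (R := ℝ) hκ.le).comp tendsto_natCast_atTop_atTop
  have h2 := h1.inv₀ hκ.ne'
  rw [← one_div] at h2
  refine h2.congr fun n => ?_
  simp [mul_comm κ]

/-- From above, compare with any admissible block model below the prescribed level. From below, a
small change of the output is itself a competitor; its scaled entries stay bounded because the norms
do, so the change costs `O(n^(-1/2))`. -/
lemma IsRegularRealization.tendsto_oracleError (hW : IsGraphon π W) (hW2 : graphonNorm 2 π W < ∞)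
    {κ : ℝ} {ρ : ℕ → ℝ} (hκ0 : 0 < κ) (hκ1 : κ ≤ 1) (hρ : ∀ n, 0 < ρ n)
    {H Q : ∀ n : ℕ, Matrix (Fin n) (Fin n) ℝ} {G : ∀ n : ℕ, SimpleGraph (Fin n)} {Δ : ℕ → ℝ}
    {h : ℝ} (hreg : IsRegularRealization π W (fun _ => κ) ρ H Q G Δ h) {What : ℕ → BlockModel}
    (hout : ∀ᶠ n in atTop, IsLeastSquaresOutput κ (G n) (What n)) :
    Tendsto (fun n => ((What n).scale (1 / ρ n)).deltaTo 2 π W) atTop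
      (𝓝 (oracleError 2 κ π W)) := by
  have hne : oracleError 2 κ π W ≠ ∞ :=
    ne_top_of_le_ne_top hW2.ne (oracleError_le_graphonNorm hW.measurable hκ1)
  refine tendsto_order.2 ⟨fun a ha => ?_, fun a ha => ?_⟩
  · set c : ℝ := 2 / κ * (h + 1) + 4 / κ with hc
    have hr : Tendsto (fun n : ℕ => ENNReal.ofReal (Real.sqrt (16 * c ^ 2 / κ * (1 / n)))) atTop
        (𝓝 0) := by
      have h1 := ENNReal.tendsto_ofReal
        ((tendsto_one_div_atTop_nhds_zero_nat (𝕜 := ℝ)).const_mul (16 * c ^ 2 / κ)).sqrt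
      simpa using h1
    have hsub : Tendsto (fun n : ℕ => oracleError 2 κ π W -
        ENNReal.ofReal (Real.sqrt (16 * c ^ 2 / κ * (1 / n)))) atTop (𝓝 (oracleError 2 κ π W)) := by
      have := ENNReal.Tendsto.sub (tendsto_const_nhds (x := oracleError 2 κ π W)) hr
        (Or.inl hne)
      rwa [tsub_zero] at this
    have hfl : ∀ᶠ n : ℕ in atTop, (n : ℝ) / ⌊(n : ℝ) * κ⌋₊ < ⌊1 / κ⌋₊ + 1 :=
      (tendsto_div_floor hκ0).eventually_lt_const (Nat.lt_floor_add_one _)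
    filter_upwards [hsub.eventually_const_lt ha, hfl, hout, hreg.close, hreg.large, hreg.norm_le,
      hreg.tail_tendsto.eventually_le_const one_pos, hreg.dev_tendsto.eventually_le_const one_pos,
      eventually_gt_atTop 0] with n g1 g2 g3 g4 g5 g6 g7 g8 g9
    refine g1.trans_le (tsub_le_iff_left.2 ?_)
    refine g3.oracleError_le g9 hκ0 g5 g2 (hρ n) hW.measurable g4 ?_
    have h1 : (ρ n)⁻¹ * matrixNorm2 (Q n) ≤ h + 1 := by
      rw [← matrixNorm2_smul (inv_nonneg.2 (hρ n).le)]
      have := matrixNorm2_add_le ((ρ n)⁻¹ • Q n - H n) (H n)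
      rw [sub_add_cancel] at this
      linarith
    have h2 : 4 / κ ^ 2 * Δ n ≤ 4 / κ := by
      calc 4 / κ ^ 2 * Δ n = 4 / κ * (Δ n / κ) := by field_simp
        _ ≤ 4 / κ * 1 := by gcongr
        _ = _ := mul_one _
    have h3 := mul_le_mul_of_nonneg_left h1 (by positivity : 0 ≤ 2 / κ)
    linarith
  · obtain ⟨b, ⟨hb, hbκ⟩, hlt⟩ : ∃ b : BlockModel, (b.IsValid ∧ ∀ i, κ ≤ b.p i) ∧
        b.deltaTo 2 π W < a := by
      simpa only [oracleError, iInf_lt_iff, exists_prop] using ha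
    exact hreg.eventually_deltaTo_lt hW (fun _ => ⟨hκ0, hκ1⟩) hρ hb
      (Eventually.of_forall fun _ => hbκ) hlt hout

/-- Block models without null blocks approximate `W` arbitrarily well, and each of them satisfies
the weight constraint once `κ n` is below its smallest weight. -/
lemma IsRegularRealization.tendsto_zero (hW : IsGraphon π W) (hW2 : graphonNorm 2 π W < ∞)
    {κ ρ : ℕ → ℝ} (hκ : ∀ n, 0 < κ n ∧ κ n ≤ 1) (hκ0 : Tendsto κ atTop (𝓝 0))
    (hρ : ∀ n, 0 < ρ n) {H Q : ∀ n : ℕ, Matrix (Fin n) (Fin n) ℝ}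
    {G : ∀ n : ℕ, SimpleGraph (Fin n)} {Δ : ℕ → ℝ} {h : ℝ}
    (hreg : IsRegularRealization π W κ ρ H Q G Δ h) {What : ℕ → BlockModel}
    (hout : ∀ᶠ n in atTop, IsLeastSquaresOutput (κ n) (G n) (What n)) :
    Tendsto (fun n => ((What n).scale (1 / ρ n)).deltaTo 2 π W) atTop (𝓝 0) := by
  refine tendsto_order.2 ⟨fun a ha => absurd ha not_lt_zero, fun a ha => ?_⟩
  obtain ⟨c, hc0, hca⟩ := exists_between ha
  obtain ⟨b, hb, hbpos, hle⟩ := hW.exists_blockModel_deltaTo_le hW2 hc0.ne'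
  exact hreg.eventually_deltaTo_lt hW hκ hρ hb
    (eventually_all.2 fun i => hκ0.eventually_le_const (hbpos i)) (hle.trans_lt hca) hout

end convergence

theorem mainTheorem1 :
    -- (i) the oracle inequality in probability
    (∀ C L ε : ℝ, 0 < ε → ∃ M : ℝ≥0,
      ∀ (Ω : Type u) [MeasurableSpace Ω] (π : Measure Ω) [IsProbabilityMeasure π]
        (W : Ω → Ω → ℝ), IsGraphon π W → graphonNorm 1 π W = 1 →
        graphonNorm 2 π W ≤ ENNReal.ofReal L →
      ∀ (n : ℕ) (κ ρ : ℝ), 2 ≤ n → 1 / (n : ℝ) < κ → κ ≤ 1 → 0 < ρ → ρ ≤ 1 →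
        (1 + Real.log (1 / κ)) / κ ^ 2 ≤ C * (ρ * n) →
      ∀ (X : Type v) [MeasurableSpace X] (P : Measure X) [IsProbabilityMeasure P]
        (x : Fin n → X → Ω) (G : X → SimpleGraph (Fin n)), IsWRandomGraph π W ρ P x G →
        P {ω | ∃ What : BlockModel, IsLeastSquaresOutput κ (G ω) What ∧
            (M : ℝ≥0∞) * oracleBound π W n κ ρ < (What.scale (1 / ρ)).deltaTo 2 π W}
          ≤ ENNReal.ofReal ε) ∧
    -- (ii) almost sure convergence to the oracle error for fixed `κ`
    (∀ (Ω : Type u) [MeasurableSpace Ω] (π : Measure Ω) [IsProbabilityMeasure π]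
        (W : Ω → Ω → ℝ), IsGraphon π W → graphonNorm 1 π W = 1 → graphonNorm 2 π W < ∞ →
      ∀ (κ : ℝ) (ρ : ℕ → ℝ), 0 < κ → κ ≤ 1 → (∀ n, 0 < ρ n) → Tendsto ρ atTop (𝓝 0) →
        Tendsto (fun n : ℕ => (n : ℝ) * ρ n) atTop atTop →
      ∀ (X : Type v) [MeasurableSpace X] (P : Measure X) [IsProbabilityMeasure P]
        (x : ℕ → X → Ω) (G : ∀ n : ℕ, X → SimpleGraph (Fin n)),
        (∀ n : ℕ, IsWRandomGraph π W (ρ n) P (fun i : Fin n => x i) (G n)) →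
        ∀ᵐ ω ∂P, ∀ What : ℕ → BlockModel,
          (∀ᶠ n in atTop, IsLeastSquaresOutput κ (G n ω) (What n)) →
          Tendsto (fun n => ((What n).scale (1 / ρ n)).deltaTo 2 π W) atTop
            (𝓝 (oracleError 2 κ π W))) ∧
    -- (iii) almost sure consistency
    (∀ (Ω : Type u) [MeasurableSpace Ω] (π : Measure Ω) [IsProbabilityMeasure π]
        (W : Ω → Ω → ℝ), IsGraphon π W → graphonNorm 1 π W = 1 → graphonNorm 2 π W < ∞ →
      ∀ (κ ρ : ℕ → ℝ), (∀ n, 0 < κ n ∧ κ n ≤ 1) → (∀ n, 0 < ρ n) → Tendsto ρ atTop (𝓝 0) →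
        Tendsto (fun n : ℕ => (n : ℝ) * ρ n) atTop atTop → Tendsto κ atTop (𝓝 0) →
        (fun n : ℕ => (κ n ^ 2)⁻¹ * Real.log (1 / κ n)) =o[atTop]
          (fun n : ℕ => (n : ℝ) * ρ n) →
      ∀ (X : Type v) [MeasurableSpace X] (P : Measure X) [IsProbabilityMeasure P]
        (x : ℕ → X → Ω) (G : ∀ n : ℕ, X → SimpleGraph (Fin n)),
        (∀ n : ℕ, IsWRandomGraph π W (ρ n) P (fun i : Fin n => x i) (G n)) →
        ∀ᵐ ω ∂P, ∀ What : ℕ → BlockModel,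
          (∀ᶠ n in atTop, IsLeastSquaresOutput (κ n) (G n ω) (What n)) →
          Tendsto (fun n => ((What n).scale (1 / ρ n)).deltaTo 2 π W) atTop (𝓝 0)) := by
  refine ⟨fun C L ε hε => ?_, ?_, ?_⟩
  · obtain ⟨M, hM⟩ := exists_oracle_constant.{u, v} C L ε hε
    exact ⟨M, fun Ω _ π _ W hW _ hL => hM Ω π W hW hL⟩
  · intro Ω _ π _ W hW _ hW2 κ ρ hκ0 hκ1 hρ hρ0 hnρ X _ P _ x G hG
    have hθ : Tendsto (fun n : ℕ => (1 + Real.log (1 / κ)) / κ ^ 2 / (ρ n * n)) atTop (𝓝 0) := by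
      simp only [mul_comm (ρ _)]
      exact tendsto_const_nhds.div_atTop hnρ
    obtain ⟨Δ, h, hreg⟩ := IsWRandomGraph.ae_isRegularRealization (κ := fun _ => κ) hW hW2
      (fun _ => ⟨hκ0, hκ1⟩) hρ hρ0 hθ hG
    filter_upwards [hreg] with ω hω What hout
    exact hω.tendsto_oracleError hW hW2 hκ0 hκ1 hρ hout
  · intro Ω _ π _ W hW _ hW2 κ ρ hκ hρ hρ0 hnρ hκ0 ho X _ P _ x G hG
    have hθ : Tendsto (fun n : ℕ => (1 + Real.log (1 / κ n)) / κ n ^ 2 / (ρ n * n)) atTop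
        (𝓝 0) := by
      have h1 := ho.tendsto_div_nhds_zero.const_mul 2
      rw [mul_zero] at h1
      refine squeeze_zero' (Eventually.of_forall fun n => ?_) ?_ h1
      · have h2 := one_le_one_add_log (hκ n).1 (hκ n).2
        have h3 := hρ n
        positivity
      -- Once `κ n ≤ exp (-1)` the logarithm is at least `1`, so `1 + log (1/κ) ≤ 2 log (1/κ)`; this
      -- is the factor `2` in `h1`.
      · filter_upwards [hκ0.eventually_le_const (Real.exp_pos (-1))] with n hn
        have h2 : 1 ≤ Real.log (1 / κ n) := by
          rw [Real.le_log_iff_exp_le (one_div_pos.2 (hκ n).1), le_one_div (Real.exp_pos _)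
            (hκ n).1, one_div, ← Real.exp_neg]
          exact hn
        have h3 := hρ n
        rw [mul_comm (ρ n), ← mul_div_assoc, div_eq_inv_mul _ (κ n ^ 2), mul_left_comm]
        gcongr
        linarith
    obtain ⟨Δ, h, hreg⟩ := IsWRandomGraph.ae_isRegularRealization hW hW2 hκ hρ hρ0 hθ hG
    filter_upwards [hreg] with ω hω What hout
    exact hω.tendsto_zero hW hW2 hκ hκ0 hρ hout
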